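/- Let $0<\delta$ be a fixed failure probability. Consider hybrid machines consisting of a classical random access machine (with addition, truncated subtraction, comparison and fair coins, and real registers that can be loaded, added, subtracted and halved) which controls two quantum devices. Gates and computational-basis measurements act on a single device, so that the devices share no entanglement and interact only through classical communication; the gates are $H$, $S$, $T$, controlled-$Z$ and the rotations $e^{-i\beta_l X}$, $e^{-i\gamma_l Z\otimes Z}$ of the QAOA circuit below; every elementary instruction, gate, measurement, branching and loop iteration, as well as every evaluation of the post-processing function $f$, takes unit time. There are one program for such a machine and one polynomial $P$, both depending only on $\delta$, such that the following holds for all $n\ge 0$, $p\ge 1$. Let $G=(V,E)$ be a graph with $V=\{0,\dots,n-1\}$, and let $S\subseteq V$ be a $2/3$-balanced vertex separator, i.e. $V\setminus S$ is a disjoint union $A\cup B$ with no edge between $A$ and $B$ and $|A|,|B|\le 2n/3$; let $\kappa=|S|$ and assume $\kappa\le n/6$. Let $\gamma,\beta\in\mathbb{R}^p$ and let $$|\gamma,\beta\rangle=\prod_{l=p}^{1}\Bigl(\bigl(e^{-i\beta_l X}\bigr)^{\otimes n}\,e^{-i\gamma_l H_{\mathcal C}}\Bigr)|+\rangle^{\otimes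 n},\qquad H_{\mathcal C}=\sum_{\{i,j\}\in E}Z_iZ_j,$$ be the output state of the $p$-layer QAOA circuit for Max-Cut on $G$. Let $f:\{0,1\}^n\to[-1,1]$ and $0<\varepsilon\le 1$. Then, on input $(n,p,G,S,\lceil 1/\varepsilon\rceil)$, with access to $f$ and to the rotation gates with angles $\gamma_l,\beta_l$, and with two devices of $\lfloor 5n/6\rfloor$ qubits each, initially in the state $|0\cdots0\rangle$, the program outputs with probability at least $1-\delta$ a real number within $\varepsilon$ of $$\sum_{x\in\{0,1\}^n}f(x)\,\bigl|\langle x|\gamma,\beta\rangle\bigr|^2,$$ and it always halts within time $$\frac{4^{(2p-1)(\kappa+2)}\,P(p\,n)}{\varepsilon^2}.$$ -/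

import Mathlib

open scoped Matrix

noncomputable section

/-! ## Balanced vertex separators -/

/-- Removing `S` leaves two sets `A`, `B` of vertices with no edge between them, each of size at
most `δ |V|`. -/
def IsBalancedSeparator {n : ℕ} (δ : ℝ) (G : SimpleGraph (Fin n)) (S : Finset (Fin n)) : Prop :=
  ∃ A B : Finset (Fin n), Disjoint A B ∧ A ∪ B = Sᶜ ∧
    (∀ a ∈ A, ∀ b ∈ B, ¬ G.Adj a b) ∧
    (A.card : ℝ) ≤ δ * n ∧ (B.card : ℝ) ≤ δ * n

/-! ## Qubits, elementary gates and the QAOA circuit -/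

/-- A (possibly subnormalized) pure state of `m` qubits, by its amplitudes in the computational
basis. -/
abbrev QVec (m : ℕ) := (Fin m → Bool) → ℂ

/-- The squared Euclidean norm. -/
def normSq {m : ℕ} (ψ : QVec m) : ℝ := ∑ x, ‖ψ x‖ ^ 2

/-- The eigenvalue of Pauli `Z` on a basis state. -/
def zSign (b : Bool) : ℂ := if b then -1 else 1

/-- The Hadamard gate. -/
def hadamardGate : Matrix Bool Bool ℂ :=
  fun a b => ((Real.sqrt 2)⁻¹ : ℝ) * (if a && b then -1 else 1)

/-- The phase gate `diag (1, exp (i θ))`. -/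
def phaseGate (θ : ℝ) : Matrix Bool Bool ℂ :=
  Matrix.diagonal fun b => if b then Complex.exp (Complex.I * θ) else 1

/-- The rotation `exp (-i β X) = cos β - i sin β X`. -/
def xRotation (β : ℝ) : Matrix Bool Bool ℂ :=
  fun a b => if a = b then (Real.cos β : ℂ) else -Complex.I * (Real.sin β : ℂ)

/-- Pauli `Z` on qubit `i` of an `n`-qubit register. -/
def pauliZ {n : ℕ} (i : Fin n) : Matrix (Fin n → Bool) (Fin n → Bool) ℂ :=
  Matrix.diagonal fun x => zSign (x i)

open Classical in
/-- The Max-Cut cost operator `∑_{ij ∈ E} Z_i Z_j`. -/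
def costOperator {n : ℕ} (G : SimpleGraph (Fin n)) : Matrix (Fin n → Bool) (Fin n → Bool) ℂ :=
  ∑ i : Fin n, ∑ j : Fin n, if i < j ∧ G.Adj i j then pauliZ i * pauliZ j else 0

/-- The cost unitary `exp (-i γ H)` with `H` the cost operator. -/
def costUnitary {n : ℕ} (G : SimpleGraph (Fin n)) (γ : ℝ) :
    Matrix (Fin n → Bool) (Fin n → Bool) ℂ :=
  NormedSpace.exp ((-(Complex.I * γ)) • costOperator G)

/-- The mixing unitary, the `n`-fold tensor power of `exp (-i β X)`. -/
def mixingUnitary (n : ℕ) (β : ℝ) : Matrix (Fin n → Bool) (Fin n → Bool) ℂ :=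
  fun x y => ∏ j, xRotation β (x j) (y j)

/-- The output of the `p`-layer QAOA circuit for Max-Cut on `G`: the uniform superposition
(Hadamards on all qubits of `|0…0⟩`), followed by `p` layers, each the cost unitary and then the
mixing unitary. -/
def qaoaState {n p : ℕ} (G : SimpleGraph (Fin n)) (γ β : Fin p → ℝ) : QVec n :=
  Fin.foldl p (fun ψ l => mixingUnitary n (β l) *ᵥ (costUnitary G (γ l) *ᵥ ψ))
    (fun _ => ((((Real.sqrt 2)⁻¹ : ℝ) : ℂ)) ^ n)

/-- The expectation value in the state `ψ` of the diagonal observable `∑_x f(x) |x⟩⟨x|`. -/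
def expectation {n : ℕ} (f : (Fin n → Bool) → ℝ) (ψ : QVec n) : ℝ :=
  ∑ x, f x * ‖ψ x‖ ^ 2

/-! ## The hybrid machine

A classical random access machine (with addition, truncated subtraction, comparison, fair coins)
controls two quantum devices of `m` qubits each.  Every gate and every measurement acts on one
device, so the devices only interact through the classical controller, and given the classical
record their joint state is always a product.  Programs are finite texts; every elementary
instruction, every branching and every loop iteration takes one unit of time.  Expressions are part
of the program text, so their evaluation takes a bounded number of elementary operations. -/

namespace Hybrid

/-- Arithmetic expressions over a memory that consists of two-dimensional arrays of natural
numbers, with `get a i j` the entry `(i, j)` of array number `a`. -/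
inductive Expr
  | const (k : ℕ)
  | get (a : ℕ) (i j : Expr)
  | add (e e' : Expr)
  | sub (e e' : Expr)
  | lt (e e' : Expr)

abbrev Memory := ℕ → ℕ → ℕ → ℕ

/-- The value of an expression; a true comparison has the value `1`, a false one `0`. -/
def Expr.eval (M : Memory) : Expr → ℕ
  | .const k => k
  | .get a i j => M a (i.eval M) (j.eval M)
  | .add e e' => e.eval M + e'.eval M
  | .sub e e' => e.eval M - e'.eval M
  | .lt e e' => if e.eval M < e'.eval M then 1 else 0

/-- Writing `v` to the entry `(i, j)` of array `a`. -/
def Memory.set (M : Memory) (a i j v : ℕ) : Memory :=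
  fun a' i' j' => if a' = a ∧ i' = i ∧ j' = j then v else M a' i' j'

/-- The gates of a device: Hadamard, `S`, `T`, controlled `Z`, and the two kinds of rotation that
occur in the QAOA circuit, `exp (-i β_l X)` and `exp (-i γ_l Z Z)`. -/
inductive Gate
  | had (q : Expr)
  | sGate (q : Expr)
  | tGate (q : Expr)
  | cz (q q' : Expr)
  | rx (q l : Expr)
  | rzz (q q' l : Expr)

/-- Programs. -/
inductive Prog
  | skip
  | seq (c c' : Prog)
  /-- write the value of `e` to entry `(i, j)` of array `a` -/
  | assign (a : ℕ) (i j e : Expr)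
  /-- write a fair coin to entry `(i, j)` of array `a` -/
  | coin (a : ℕ) (i j : Expr)
  /-- run `c` if the value of `e` is not `0`, else `c'` -/
  | ite (e : Expr) (c c' : Prog)
  /-- run `c` for the values `0, …, N - 1` of entry `(0, 0)` of array `a`, where `N` is the value
  of `e` on entry to the loop -/
  | loop (a : ℕ) (e : Expr) (c : Prog)
  /-- load a natural number into real register `r` -/
  | realOfNat (r : ℕ) (e : Expr)
  /-- add two real registers -/
  | realAdd (r s t : ℕ)
  /-- subtract two real registers -/
  | realSub (r s t : ℕ)
  /-- halve real register `s` into `r` -/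
  | realHalf (r s : ℕ)
  /-- evaluate `f` at the bit string in column `0` of array `a`, into real register `r` -/
  | query (r a : ℕ)
  /-- apply a gate on device `d` -/
  | gate (d : Bool) (g : Gate)
  /-- measure qubit `q` of device `d` in the computational basis; the outcome is written to entry
  `(i, j)` of array `a` -/
  | measure (d : Bool) (q : Expr) (a : ℕ) (i j : Expr)

/-- What the elementary operations refer to: the angles of the rotation gates and the
post-processing function. -/
structure Env (n p : ℕ) where
  γ : Fin p → ℝ
  β : Fin p → ℝ
  f : (Fin n → Bool) → ℝ

/-- A branch of the computation: the classical data, one subnormalized vector for each device, and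
the probability of the coin outcomes of the branch.  A measurement projects without
renormalizing, so that the probability of a branch is `Config.prob`. -/
structure Config (m : ℕ) where
  mem : Memory
  reg : ℕ → ℝ
  dev : Bool → QVec m
  weight : ℝ
  time : ℕ

/-- The probability of a branch. -/
def Config.prob {m : ℕ} (s : Config m) : ℝ :=
  s.weight * (normSq (s.dev false) * normSq (s.dev true))

/-- One unit of time passes. -/
def Config.tick {m : ℕ} (s : Config m) : Config m := { s with time := s.time + 1 }

/-- A single-qubit gate on qubit `q`; nothing happens if there is no such qubit. -/
def applyOne {m : ℕ} (U : Matrix Bool Bool ℂ) (q : ℕ) (ψ : QVec m) : QVec m :=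
  if h : q < m then
    fun x => ∑ b, U (x ⟨q, h⟩) b * ψ (Function.update x ⟨q, h⟩ b)
  else ψ

/-- A diagonal two-qubit gate on two distinct qubits `q`, `q'`; nothing happens if there are no
such qubits. -/
def applyDiag {m : ℕ} (D : Bool → Bool → ℂ) (q q' : ℕ) (ψ : QVec m) : QVec m :=
  if h : q < m ∧ q' < m ∧ q ≠ q' then
    fun x => D (x ⟨q, h.1⟩) (x ⟨q', h.2.1⟩) * ψ x
  else ψ

/-- The action of a gate on a device. -/
def Gate.apply {n p m : ℕ} (E : Env n p) (M : Memory) : Gate → QVec m → QVec m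
  | .had q, ψ => applyOne hadamardGate (q.eval M) ψ
  | .sGate q, ψ => applyOne (phaseGate (Real.pi / 2)) (q.eval M) ψ
  | .tGate q, ψ => applyOne (phaseGate (Real.pi / 4)) (q.eval M) ψ
  | .cz q q', ψ =>
      applyDiag (fun a b => if a && b then -1 else 1) (q.eval M) (q'.eval M) ψ
  | .rx q l, ψ =>
      if h : l.eval M < p then applyOne (xRotation (E.β ⟨l.eval M, h⟩)) (q.eval M) ψ else ψ
  | .rzz q q' l, ψ =>
      if h : l.eval M < p then
        applyDiag (fun a b => Complex.exp (-(Complex.I * E.γ ⟨l.eval M, h⟩) * (zSign a * zSign b)))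
          (q.eval M) (q'.eval M) ψ
      else ψ

/-- The projection onto the outcome `b` of measuring qubit `q`. -/
def project {m : ℕ} (q : Fin m) (b : Bool) (ψ : QVec m) : QVec m :=
  fun x => if x q = b then ψ x else 0

/-- The branches after a measurement; a missing qubit has the outcome `0`. -/
def Config.measure {m : ℕ} (s : Config m) (d : Bool) (q a i j : ℕ) : List (Config m) :=
  if h : q < m then
    [false, true].map fun b =>
      { s with
        mem := s.mem.set a i j b.toNat
        dev := Function.update s.dev d (project ⟨q, h⟩ b (s.dev d)) }
  else [{ s with mem := s.mem.set a i j 0 }]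

/-- All branches of the execution of a program from a given configuration. -/
def Prog.exec {n p m : ℕ} (E : Env n p) : Prog → Config m → List (Config m)
  | .skip, s => [s]
  | .seq c c', s => (c.exec E s).flatMap fun s' => c'.exec E s'
  | .assign a i j e, s =>
      [{ s.tick with mem := s.mem.set a (i.eval s.mem) (j.eval s.mem) (e.eval s.mem) }]
  | .coin a i j, s =>
      [false, true].map fun b =>
        { s.tick with
          mem := s.mem.set a (i.eval s.mem) (j.eval s.mem) b.toNat
          weight := s.weight / 2 }
  | .ite e c c', s => if e.eval s.mem ≠ 0 then c.exec E s.tick else c'.exec E s.tick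
  | .loop a e c, s =>
      Nat.rec (motive := fun _ => List (Config m)) [s.tick]
        (fun k branches => branches.flatMap fun s' =>
          c.exec E { s'.tick with mem := s'.mem.set a 0 0 k })
        (e.eval s.mem)
  | .realOfNat r e, s => [{ s.tick with reg := Function.update s.reg r (e.eval s.mem) }]
  | .realAdd r t u, s => [{ s.tick with reg := Function.update s.reg r (s.reg t + s.reg u) }]
  | .realSub r t u, s => [{ s.tick with reg := Function.update s.reg r (s.reg t - s.reg u) }]
  | .realHalf r t, s => [{ s.tick with reg := Function.update s.reg r (s.reg t / 2) }]
  | .query r a, s =>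
      [{ s.tick with
          reg := Function.update s.reg r (E.f fun i => decide (s.mem a i 0 ≠ 0)) }]
  | .gate d g, s =>
      [{ s.tick with dev := Function.update s.dev d (g.apply E s.mem (s.dev d)) }]
  | .measure d q a i j, s =>
      s.tick.measure d (q.eval s.mem) a (i.eval s.mem) (j.eval s.mem)

open Classical in
/-- The input: `n`, `p` and an accuracy parameter `K` in array `0`, the adjacency matrix of `G` in
array `1`, the indicator vector of `S` in array `2`; everything else is `0`. -/
def inputMemory {n : ℕ} (p K : ℕ) (G : SimpleGraph (Fin n)) (S : Finset (Fin n)) : Memory :=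
  fun a i j =>
    if a = 0 ∧ j = 0 then
      (if i = 0 then n else if i = 1 then p else if i = 2 then K else 0)
    else if a = 1 then
      (if ∃ u v : Fin n, (u : ℕ) = i ∧ (v : ℕ) = j ∧ G.Adj u v then 1 else 0)
    else if a = 2 ∧ j = 0 then
      (if ∃ u ∈ S, (u : ℕ) = i then 1 else 0)
    else 0

/-- The initial configuration: both devices are in the state `|0…0⟩`. -/
def initial (m : ℕ) (M : Memory) : Config m where
  mem := M
  reg := fun _ => 0
  dev := fun _ x => if x = fun _ => false then 1 else 0
  weight := 1
  time := 0

open Classical in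
/-- The probability that real register `0`, the output, ends up within `ε` of `μ`. -/
def successProb {m : ℕ} (branches : List (Config m)) (μ ε : ℝ) : ℝ :=
  ((branches.filter fun s => |s.reg 0 - μ| ≤ ε).map Config.prob).sum

end Hybrid

end

/-! Place one union of components of `G - S` together with `S` on device 0, and the remaining
components together with scratch copies of `S` on device 1. Each side has at most `2n/3` vertices
and `|S| ≤ n/6`, so `5n/6` qubits suffice. All gates of the QAOA circuit are then local, except the
diagonal rotations on edges between `S` and device 1. These would be local too if, before each cost
layer, the basis values of `S` were copied coherently to device 1 and erased afterwards.

Erasing needs only classical communication: measure each copy in the Hadamard basis and, on outcome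
1, apply `Z` to the original. Copying is simulated by signed sampling. Write `x`, `x'` for the ket
and bra values of the originals and `y`, `y'` for those of the copies. Copying is the indicator of
`x = y`, `x' = y'`. Copies prepared in the state `|+⟩` contribute the constant `2^(-|S|)`, and the
later erasure enforces, at every vertex of `S`, that `x + x' + y + y'` is even. This leaves three
patterns per vertex: `x = x'`, `y = y'` (diagonal); `x = y`, `x' = y'` (copy); `x = y'`, `x' = y`
(swap). Random `S` phases, inverse to each other on the two devices, kill the proper swaps. Random
`CZ` phases on pairs kill every configuration that is not diagonal throughout or copy throughout.
The unwanted diagonal terms are subtracted by measuring originals and copies, flipping the sign of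
the sample, and discarding it if all outcomes agree, since those terms also belong to the copy
pattern. This is `copy_identity`; a fair coin chooses between the two procedures.

Every layer therefore costs a factor `2^(-(|S|+1))`. One run returns `f` with a sign, or `0`, and
its mean is `2^(-(|S|+1)p)` times the desired expectation value (`Layout.back_circuit`). Each sample
has absolute value at most 1, so by Chebyshev about `4^((|S|+1)p) / (δ ε²)` samples suffice
(`sum_samples_le`, `le_successProb`, `successProb_estimate`).

The quantum claims are proved in the Heisenberg picture. `Prog.back` pulls a memory-dependent
sesquilinear form back through a program, and `sum_exec_value` says that the form summed over all
branches equals the pulled-back form at the start. Loops then become products of explicit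
multipliers of kernels, evaluated on the basis states that a `Layout` describes.

The sets `A` and `B` are not part of the input. The classical part merges labels along the edges
outside `S`, so that no label class meets both `A` and `B`, and searches for an interval of labels
that balances the two devices; one exists by `exists_isBalanced`. -/

open scoped Matrix

noncomputable section

namespace Hybrid

section

/-! ## Sesquilinear kernels -/

/-- A sesquilinear form on the amplitudes of a register with qubits `ι`. -/
abbrev Kernel (ι : Type) := (ι → Bool) → (ι → Bool) → ℂ

section Kernel

variable {ι : Type} [DecidableEq ι]

/-- A single-qubit operator on qubit `i`. -/
def opOne (U : Matrix Bool Bool ℂ) (i : ι) (φ : (ι → Bool) → ℂ) : (ι → Bool) → ℂ :=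
  fun z => ∑ b, U (z i) b * φ (Function.update z i b)

/-- The kernel `K` pulled back along a single-qubit operator on qubit `i`. -/
def Kernel.one (U : Matrix Bool Bool ℂ) (i : ι) (K : Kernel ι) : Kernel ι :=
  fun z z' => ∑ b, ∑ c, U b (z i) * star (U c (z' i)) *
    K (Function.update z i b) (Function.update z' i c)

/-- The kernel `K` pulled back along a diagonal operator. -/
def Kernel.diag (D : (ι → Bool) → ℂ) (K : Kernel ι) : Kernel ι :=
  fun z z' => D z * star (D z') * K z z'

lemma Kernel.one_diagonal (D : Bool → ℂ) (i : ι) (K : Kernel ι) :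
    Kernel.one (Matrix.diagonal D) i K = Kernel.diag (fun z => D (z i)) K := by
  funext z z'
  simp only [Kernel.one, Kernel.diag]
  rw [Finset.sum_eq_single (z i), Finset.sum_eq_single (z' i)]
  · simp
  · intro b _ hb; simp [hb]
  · simp
  · intro b _ hb; simp [Matrix.diagonal_apply_ne _ hb]
  · simp

variable [Fintype ι]

/-- The kernel of the squared norm. -/
def Kernel.id : Kernel ι := fun z z' => if z = z' then 1 else 0

/-- The value of the form `K` at `φ`. -/
def pairing (K : Kernel ι) (φ : (ι → Bool) → ℂ) : ℂ :=
  ∑ z, ∑ z', K z z' * (φ z * star (φ z'))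

lemma pairing_eq_matrix (K : Kernel ι) (φ : (ι → Bool) → ℂ) :
    pairing K φ = ∑ z, φ z * ∑ z', K z z' * star (φ z') := by
  simp only [pairing, Finset.mul_sum]
  refine Finset.sum_congr rfl fun z _ => Finset.sum_congr rfl fun z' _ => by ring

/-- Exchanging the value of a coordinate with a free bit. -/
lemma sum_update_swap {R : Type*} [AddCommMonoid R] (i : ι)
    (F : (ι → Bool) → Bool → R) :
    ∑ z, ∑ b, F z b = ∑ z, ∑ b, F (Function.update z i b) (z i) := by
  rw [← Finset.sum_product', ← Finset.sum_product']
  refine Finset.sum_nbij' (fun q => (Function.update q.1 i q.2, q.1 i))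
    (fun q => (Function.update q.1 i q.2, q.1 i)) ?_ ?_ ?_ ?_ ?_ <;> simp

lemma sum_mul_opOne (U : Matrix Bool Bool ℂ) (i : ι) (φ A : (ι → Bool) → ℂ) :
    ∑ z, A z * opOne U i φ z = ∑ z, (∑ b, U b (z i) * A (Function.update z i b)) * φ z := by
  simp only [opOne, Finset.mul_sum, Finset.sum_mul]
  rw [sum_update_swap i]
  refine Finset.sum_congr rfl fun z _ => Finset.sum_congr rfl fun b _ => ?_
  simp; ring

/-- Passing from states to forms: the operator is moved off the vector by transposing it in the ket
variable and its conjugate in the bra variable. -/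
lemma pairing_opOne (U : Matrix Bool Bool ℂ) (i : ι) (K : Kernel ι) (φ : (ι → Bool) → ℂ) :
    pairing K (opOne U i φ) = pairing (K.one U i) φ := by
  have h1 : ∀ z, ∑ z', K z z' * star (opOne U i φ z') =
      ∑ z', (∑ b', star (U b' (z' i)) * K z (Function.update z' i b')) * star (φ z') := by
    intro z
    have := sum_mul_opOne U i φ (fun z' => star (K z z'))
    have h2 := congrArg star this
    simp only [star_sum, star_mul', star_star] at h2
    exact h2
  rw [pairing_eq_matrix]
  simp only [h1]
  have := sum_mul_opOne U i φ (fun z => ∑ z', (∑ b', star (U b' (z' i)) *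
    K z (Function.update z' i b')) * star (φ z'))
  rw [show ∑ z, opOne U i φ z * ∑ z', (∑ b', star (U b' (z' i)) *
    K z (Function.update z' i b')) * star (φ z') = _ from
    (Finset.sum_congr rfl fun z _ => mul_comm _ _), this]
  simp only [pairing, Kernel.one, Finset.sum_mul, Finset.mul_sum]
  refine Finset.sum_congr rfl fun z _ => ?_
  rw [Finset.sum_comm]
  refine Finset.sum_congr rfl fun z' _ => Finset.sum_congr rfl fun b _ =>
    Finset.sum_congr rfl fun b' _ => by ring

lemma pairing_diag (D : (ι → Bool) → ℂ) (K : Kernel ι) (φ : (ι → Bool) → ℂ) :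
    pairing K (fun z => D z * φ z) = pairing (K.diag D) φ := by
  simp only [pairing, Kernel.diag, star_mul']
  refine Finset.sum_congr rfl fun z _ => Finset.sum_congr rfl fun z' _ => by ring

lemma pairing_add (K K' : Kernel ι) (φ : (ι → Bool) → ℂ) :
    pairing (fun z z' => K z z' + K' z z') φ = pairing K φ + pairing K' φ := by
  simp only [pairing, add_mul, Finset.sum_add_distrib]

lemma pairing_smul (c : ℂ) (K : Kernel ι) (φ : (ι → Bool) → ℂ) :
    pairing (fun z z' => c * K z z') φ = c * pairing K φ := by
  simp only [pairing, Finset.mul_sum, mul_assoc]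

lemma pairing_id (c : ℂ) (φ : (ι → Bool) → ℂ) :
    pairing (fun z z' => if z = z' then c else 0) φ = c * ∑ z, ((‖φ z‖ ^ 2 : ℝ) : ℂ) := by
  simp only [pairing, ite_mul, zero_mul, Finset.sum_ite_eq, Finset.mem_univ, if_true,
    Finset.mul_sum]
  refine Finset.sum_congr rfl fun z _ => ?_
  rw [← starRingEnd_apply, Complex.mul_conj, Complex.normSq_eq_norm_sq]

end Kernel

/-! ## The joint state of the two devices -/

/-- The qubits of the two devices. -/
abbrev Qubit (m : ℕ) := Bool × Fin m

variable {m : ℕ}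

/-- The part of a joint basis state that belongs to device `d`. -/
def slice (z : Qubit m → Bool) (d : Bool) : Fin m → Bool := fun q => z (d, q)

/-- The amplitudes of the product state. -/
def amp (dev : Bool → QVec m) (z : Qubit m → Bool) : ℂ :=
  dev false (slice z false) * dev true (slice z true)

lemma slice_update_self (z : Qubit m → Bool) (d : Bool) (q : Fin m) (b : Bool) :
    slice (Function.update z (d, q) b) d = Function.update (slice z d) q b := by
  funext r
  by_cases h : r = q
  · subst h; simp [slice]
  · simp [slice, h]

lemma slice_update_of_ne (z : Qubit m → Bool) {d d' : Bool} (hd : d' ≠ d) (q : Fin m) (b : Bool) :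
    slice (Function.update z (d, q) b) d' = slice z d' := by
  funext r
  simp [slice, hd]

lemma amp_update_mul (dev : Bool → QVec m) (d : Bool) (D : (Fin m → Bool) → ℂ) :
    amp (Function.update dev d fun x => D x * dev d x) =
      fun z => D (slice z d) * amp dev z := by
  funext z
  cases d <;> simp [amp] <;> ring

lemma amp_applyOne (U : Matrix Bool Bool ℂ) (dev : Bool → QVec m) (d : Bool) (q : ℕ) :
    amp (Function.update dev d (applyOne U q (dev d))) =
      if h : q < m then opOne U (d, ⟨q, h⟩) (amp dev) else amp dev := by
  by_cases h : q < m
  · rw [dif_pos h]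
    funext z
    cases d
    · have : slice z false ⟨q, h⟩ = z (false, ⟨q, h⟩) := rfl
      simp [amp, applyOne, h, opOne, slice_update_self, slice_update_of_ne, this]
      ring
    · have : slice z true ⟨q, h⟩ = z (true, ⟨q, h⟩) := rfl
      simp [amp, applyOne, h, opOne, slice_update_self, slice_update_of_ne, this]
      ring
  · simp [applyOne, h]

lemma amp_applyDiag (D : Bool → Bool → ℂ) (dev : Bool → QVec m) (d : Bool) (q q' : ℕ) :
    amp (Function.update dev d (applyDiag D q q' (dev d))) =
      if h : q < m ∧ q' < m ∧ q ≠ q' then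
        fun z => D (z (d, ⟨q, h.1⟩)) (z (d, ⟨q', h.2.1⟩)) * amp dev z
      else amp dev := by
  by_cases h : q < m ∧ q' < m ∧ q ≠ q'
  · rw [dif_pos h, applyDiag, dif_pos h]
    exact amp_update_mul dev d fun x => D (x ⟨q, h.1⟩) (x ⟨q', h.2.1⟩)
  · rw [dif_neg h, applyDiag, dif_neg h]
    simp

lemma amp_project (dev : Bool → QVec m) (d : Bool) (q : Fin m) (b : Bool) :
    amp (Function.update dev d (project q b (dev d))) =
      fun z => (if z (d, q) = b then 1 else 0) * amp dev z := by
  have h : project q b (dev d) = fun x => (if x q = b then 1 else 0) * dev d x := by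
    funext x
    simp [project]
  rw [h, amp_update_mul dev d fun x => if x q = b then 1 else 0]
  rfl

/-- A basis state of the two devices is a pair of basis states. -/
def sliceEquiv (m : ℕ) : (Qubit m → Bool) ≃ (Fin m → Bool) × (Fin m → Bool) where
  toFun z := (slice z false, slice z true)
  invFun x := fun i => if i.1 then x.2 i.2 else x.1 i.2
  left_inv z := by
    funext ⟨d, q⟩
    cases d <;> simp [slice]
  right_inv x := by
    ext q <;> simp [slice]

/-- The joint state is a product, so its squared norm factors. This identifies `Config.prob` with
the value of the identity form. -/
lemma sum_norm_amp (dev : Bool → QVec m) :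
    ∑ z, ‖amp dev z‖ ^ 2 = normSq (dev false) * normSq (dev true) := by
  rw [normSq, normSq, Finset.sum_mul_sum, ← Fintype.sum_prod_type',
    ← Equiv.sum_comp (sliceEquiv m)]
  refine Finset.sum_congr rfl fun z _ => ?_
  simp [amp, sliceEquiv, mul_pow]

/-! ## Backward semantics -/

variable {n p : ℕ}

/-- A single-qubit operation of the kernel on qubit `q` of device `d`, if present. -/
def Kernel.atQubit (U : Matrix Bool Bool ℂ) (d : Bool) (q : ℕ) (K : Kernel (Qubit m)) :
    Kernel (Qubit m) :=
  if h : q < m then K.one U (d, ⟨q, h⟩) else K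

/-- A diagonal operation of the kernel on qubits `q`, `q'` of device `d`, if present. -/
def Kernel.atPair (D : Bool → Bool → ℂ) (d : Bool) (q q' : ℕ) (K : Kernel (Qubit m)) :
    Kernel (Qubit m) :=
  if h : q < m ∧ q' < m ∧ q ≠ q' then
    K.diag fun z => D (z (d, ⟨q, h.1⟩)) (z (d, ⟨q', h.2.1⟩))
  else K

/-- The phases of a controlled `Z`. -/
def czPhase (a b : Bool) : ℂ := if a && b then -1 else 1

/-- The phases of `exp (-i γ Z Z)`. -/
def zzPhase (γ : ℝ) (a b : Bool) : ℂ := Complex.exp (-(Complex.I * γ) * (zSign a * zSign b))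

/-- The action of a gate on kernels. -/
def Gate.pull (E : Env n p) (M : Memory) (d : Bool) : Gate → Kernel (Qubit m) → Kernel (Qubit m)
  | .had q => Kernel.atQubit hadamardGate d (q.eval M)
  | .sGate q => Kernel.atQubit (phaseGate (Real.pi / 2)) d (q.eval M)
  | .tGate q => Kernel.atQubit (phaseGate (Real.pi / 4)) d (q.eval M)
  | .cz q q' => Kernel.atPair czPhase d (q.eval M) (q'.eval M)
  | .rx q l => fun K =>
      if h : l.eval M < p then K.atQubit (xRotation (E.β ⟨l.eval M, h⟩)) d (q.eval M) else K
  | .rzz q q' l => fun K =>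
      if h : l.eval M < p then K.atPair (zzPhase (E.γ ⟨l.eval M, h⟩)) d (q.eval M) (q'.eval M)
      else K

lemma pairing_gate (E : Env n p) (M : Memory) (d : Bool) (g : Gate) (K : Kernel (Qubit m))
    (dev : Bool → QVec m) :
    pairing K (amp (Function.update dev d (g.apply E M (dev d)))) =
      pairing (g.pull E M d K) (amp dev) := by
  have h1 : ∀ U q, pairing K (amp (Function.update dev d (applyOne U q (dev d)))) =
      pairing (K.atQubit U d q) (amp dev) := by
    intro U q
    rw [amp_applyOne, Kernel.atQubit]
    split_ifs
    · rw [pairing_opOne]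
    · rfl
  have h2 : ∀ D q q', pairing K (amp (Function.update dev d (applyDiag D q q' (dev d)))) =
      pairing (K.atPair D d q q') (amp dev) := by
    intro D q q'
    rw [amp_applyDiag, Kernel.atPair]
    split_ifs
    · rw [pairing_diag]
    · rfl
  cases g with
  | had q => simp only [Gate.apply, Gate.pull, h1]
  | sGate q => simp only [Gate.apply, Gate.pull, h1]
  | tGate q => simp only [Gate.apply, Gate.pull, h1]
  | cz q q' =>
    simp only [Gate.apply, Gate.pull, h2]
    rfl
  | rx q l =>
    simp only [Gate.apply, Gate.pull]
    split_ifs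
    · simp only [h1]
    · simp
  | rzz q q' l =>
    simp only [Gate.apply, Gate.pull]
    split_ifs
    · simp only [h2]
      rfl
    · simp

/-- Measuring a qubit: the kernels of the two outcomes are restricted to the outcome. -/
def measureSem (d : Bool) (q : ℕ) (a i j : ℕ) (O : Memory → Kernel (Qubit m)) (M : Memory) :
    Kernel (Qubit m) :=
  if h : q < m then fun z z' =>
    if z (d, ⟨q, h⟩) = z' (d, ⟨q, h⟩) then O (M.set a i j (z (d, ⟨q, h⟩)).toNat) z z' else 0
  else O (M.set a i j 0)

/-- Iterating the semantics `B` of a loop body. -/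
def loopSem {K : Type} (a : ℕ) (B : (Memory → K) → Memory → K) : ℕ → (Memory → K) → Memory → K
  | 0, O => O
  | k + 1, O => loopSem a B k fun M => B O (M.set a 0 0 k)

/-- The induction rule for loops read backwards. The last iteration is pulled back first, so an
invariant indexed by `k` describes the form just before iteration `k` and descends from `N` to `0`.
-/
lemma loopSem_desc {K : Type} (a : ℕ) (B : (Memory → K) → Memory → K)
    (Q : ℕ → (Memory → K) → Prop) (N : ℕ)
    (h : ∀ k < N, ∀ O, Q (k + 1) O → Q k fun M => B O (M.set a 0 0 k))
    (O : Memory → K) (hO : Q N O) : Q 0 (loopSem a B N O) := by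
  induction N generalizing O with
  | zero => exact hO
  | succ N ih => exact ih (fun k hk => h k (by omega)) _ (h N (by omega) O hO)

/-- The branches after `k` iterations of a loop. -/
def loopBranches (E : Env n p) (a : ℕ) (c : Prog) (s : Config m) : ℕ → List (Config m)
  | 0 => [s.tick]
  | k + 1 => (loopBranches E a c s k).flatMap fun s' =>
      c.exec E { s'.tick with mem := s'.mem.set a 0 0 k }

lemma exec_loop (E : Env n p) (a : ℕ) (e : Expr) (c : Prog) (s : Config m) :
    (Prog.loop a e c).exec E s = loopBranches E a c s (e.eval s.mem) := by
  simp only [Prog.exec]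
  induction e.eval s.mem with
  | zero => rfl
  | succ N ih => simp only [loopBranches, ← ih]

lemma sum_flatMap {α β : Type} {R : Type*} [AddCommMonoid R] (L : List α) (F : α → List β)
    (g : β → R) : ((L.flatMap F).map g).sum = (L.map fun a => ((F a).map g).sum).sum := by
  induction L with
  | nil => simp
  | cons a L ih => simp [ih]

/-- The backward semantics: a program transforms forms on its final states, depending on the final
memory, into forms on its initial states. -/
def Prog.back (E : Env n p) :
    Prog → (Memory → Kernel (Qubit m)) → Memory → Kernel (Qubit m)
  | .skip, O => O
  | .seq c c', O => c.back E (c'.back E O)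
  | .assign a i j e, O => fun M => O (M.set a (i.eval M) (j.eval M) (e.eval M))
  | .coin a i j, O => fun M z z' =>
      (O (M.set a (i.eval M) (j.eval M) 0) z z' + O (M.set a (i.eval M) (j.eval M) 1) z z') / 2
  | .ite e c c', O => fun M => if e.eval M ≠ 0 then c.back E O M else c'.back E O M
  | .loop a e c, O => fun M => loopSem a (c.back E) (e.eval M) O M
  | .realOfNat _ _, O => O
  | .realAdd _ _ _, O => O
  | .realSub _ _ _, O => O
  | .realHalf _ _, O => O
  | .query _ _, O => O
  | .gate d g, O => fun M => g.pull E M d (O M)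
  | .measure d q a i j, O => fun M =>
      measureSem d (q.eval M) a (i.eval M) (j.eval M) O M

/-- The value of a memory-dependent form in a configuration. -/
def Config.value (O : Memory → Kernel (Qubit m)) (s : Config m) : ℂ :=
  s.weight * pairing (O s.mem) (amp s.dev)

lemma value_measure (s : Config m) (d : Bool) (q a i j : ℕ) (O : Memory → Kernel (Qubit m)) :
    ((s.measure d q a i j).map (Config.value O)).sum = s.value (measureSem d q a i j O) := by
  unfold Config.measure
  split_ifs with h
  · simp only [Config.value, List.map_cons, List.map_nil, List.sum_cons, List.sum_nil, add_zero,
      amp_project, pairing_diag, Bool.toNat_false, Bool.toNat_true, ← mul_add, ← pairing_add]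
    congr 2
    funext z z'
    simp only [Kernel.diag, measureSem, dif_pos h]
    cases z (d, ⟨q, h⟩) <;> cases z' (d, ⟨q, h⟩) <;> simp
  · simp [Config.value, measureSem, h]

/-- Duality of the Schrödinger and Heisenberg pictures. Branches are kept unnormalized, so the sum
over branches is linear and every instruction can be moved onto the form separately; coins average
two forms, and measurements sum the two projected ones. -/
theorem sum_exec_value (E : Env n p) (c : Prog) (O : Memory → Kernel (Qubit m)) (s : Config m) :
    ((c.exec E s).map (Config.value O)).sum = s.value (c.back E O) := by
  induction c generalizing O s with
  | skip => simp [Prog.exec, Prog.back]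
  | seq c c' ih ih' =>
    simp only [Prog.exec, Prog.back, sum_flatMap, ih']
    exact ih _ s
  | assign a i j e => simp [Prog.exec, Prog.back, Config.value, Config.tick]
  | coin a i j =>
    simp only [Prog.exec, Prog.back, Config.value, Config.tick, List.map_cons, List.map_nil,
      List.sum_cons, List.sum_nil, Bool.toNat_false, Bool.toNat_true, div_eq_inv_mul,
      pairing_smul, pairing_add]
    push_cast
    ring
  | ite e c c' ih ih' =>
    simp only [Prog.exec, Prog.back]
    split_ifs with h
    · rw [ih]; simp [Config.value, Config.tick, h]
    · rw [ih']; simp at h; simp [Config.value, Config.tick, h]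
  | loop a e c ih =>
    simp only [exec_loop, Prog.back]
    suffices H : ∀ N O, ((loopBranches E a c s N).map (Config.value O)).sum =
        s.value (loopSem a (c.back E) N O) by
      rw [H]; rfl
    intro N
    induction N with
    | zero => intro O; simp [loopBranches, loopSem, Config.value, Config.tick]
    | succ N ihN =>
      intro O
      simp only [loopSem, ← ihN, loopBranches, sum_flatMap, ih]
      rfl
  | realOfNat => simp [Prog.exec, Prog.back, Config.value, Config.tick]
  | realAdd => simp [Prog.exec, Prog.back, Config.value, Config.tick]
  | realSub => simp [Prog.exec, Prog.back, Config.value, Config.tick]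
  | realHalf => simp [Prog.exec, Prog.back, Config.value, Config.tick]
  | query => simp [Prog.exec, Prog.back, Config.value, Config.tick]
  | gate d g => simp [Prog.exec, Prog.back, Config.value, Config.tick, pairing_gate]
  | measure d q a i j =>
    simp only [Prog.exec, Prog.back, value_measure]
    simp [Config.value, Config.tick]

/-! ## Conservation of probability -/

lemma Kernel.one_id {ι : Type} [DecidableEq ι] [Fintype ι] {U : Matrix Bool Bool ℂ}
    (hU : Uᴴ * U = 1) (i : ι) :
    Kernel.one U i (Kernel.id : Kernel ι) = Kernel.id := by
  have hU' : ∀ a b, ∑ c, star (U c a) * U c b = if a = b then 1 else 0 := by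
    intro a b
    have := congrFun (congrFun hU a) b
    simpa [Matrix.mul_apply, Matrix.one_apply] using this
  funext z z'
  simp only [Kernel.one, Kernel.id]
  -- Two updated assignments coincide exactly when the new bits agree and the assignments agree away
  -- from `i`; the latter is expressed by setting both to `false` at `i`.
  have key : ∀ b b', Function.update z i b = Function.update z' i b' ↔
      b = b' ∧ Function.update z i false = Function.update z' i false := by
    intro b b'
    constructor
    · intro h
      have h1 := congrFun h i
      simp at h1
      refine ⟨h1, ?_⟩
      have := congrArg (fun w => Function.update w i false) h
      simpa using this
    · rintro ⟨rfl, h⟩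
      have := congrArg (fun w => Function.update w i b) h
      simpa using this
  have key2 : z = z' ↔ z i = z' i ∧ Function.update z i false = Function.update z' i false := by
    have := key (z i) (z' i)
    simpa using this
  rw [if_congr key2 rfl rfl]
  simp only [if_congr (key _ _) rfl rfl]
  by_cases h : Function.update z i false = Function.update z' i false
  · simp only [h, and_true, mul_ite, mul_one, mul_zero, Finset.sum_ite_eq, Finset.mem_univ,
      if_true]
    have := hU' (z' i) (z i)
    simp only [mul_comm (star _)] at this
    rw [this]
    simp [eq_comm]
  · simp [h]

lemma Kernel.diag_id {ι : Type} [DecidableEq ι] [Fintype ι] {D : (ι → Bool) → ℂ}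
    (hD : ∀ z, ‖D z‖ = 1) :
    Kernel.diag D (Kernel.id : Kernel ι) = Kernel.id := by
  funext z z'
  simp only [Kernel.diag, Kernel.id]
  split_ifs with h
  · subst h
    rw [← starRingEnd_apply, Complex.mul_conj, Complex.normSq_eq_norm_sq, hD]; simp
  · simp

lemma hadamardGate_unitary : hadamardGateᴴ * hadamardGate = 1 := by
  have h : ((Real.sqrt 2 : ℝ) : ℂ)⁻¹ * ((Real.sqrt 2 : ℝ) : ℂ)⁻¹ = 2⁻¹ := by
    rw [← mul_inv, ← Complex.ofReal_mul, Real.mul_self_sqrt (by norm_num)]; simp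
  ext a b
  cases a <;> cases b <;> (simp [Matrix.mul_apply, hadamardGate, h]; try norm_num)

lemma phaseGate_unitary (θ : ℝ) : (phaseGate θ)ᴴ * phaseGate θ = 1 := by
  have h : (starRingEnd ℂ) (Complex.exp (Complex.I * θ)) * Complex.exp (Complex.I * θ) = 1 := by
    rw [mul_comm, Complex.mul_conj, Complex.normSq_eq_norm_sq, mul_comm,
      Complex.norm_exp_ofReal_mul_I]; simp
  ext a b
  cases a <;> cases b <;> simp [Matrix.mul_apply, phaseGate, h]

lemma xRotation_unitary (β : ℝ) : (xRotation β)ᴴ * xRotation β = 1 := by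
  have h : (Complex.cos β) * Complex.cos β + Complex.sin β * Complex.sin β = 1 := by
    have := Complex.cos_sq_add_sin_sq (β : ℂ)
    linear_combination this
  have h1 : (starRingEnd ℂ) (Complex.cos β) = Complex.cos β := by
    rw [← Complex.ofReal_cos, Complex.conj_ofReal]
  have h2 : (starRingEnd ℂ) (Complex.sin β) = Complex.sin β := by
    rw [← Complex.ofReal_sin, Complex.conj_ofReal]
  ext a b
  cases a <;> cases b <;> simp [Matrix.mul_apply, xRotation, h1, h2]
  · linear_combination h - Complex.sin β * Complex.sin β * Complex.I_sq
  · ring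
  · ring
  · linear_combination h - Complex.sin β * Complex.sin β * Complex.I_sq

lemma norm_zzPhase (γ : ℝ) (a b : Bool) : ‖zzPhase γ a b‖ = 1 := by
  have : ∃ r : ℝ, -(Complex.I * γ) * (zSign a * zSign b) = r * Complex.I := by
    cases a <;> cases b <;> simp [zSign]
    · exact ⟨-γ, by push_cast; ring⟩
    · exact ⟨γ, by ring⟩
    · exact ⟨γ, by ring⟩
    · exact ⟨-γ, by push_cast; ring⟩
  obtain ⟨r, hr⟩ := this
  rw [zzPhase, hr, Complex.norm_exp_ofReal_mul_I]

lemma Gate.pull_id (E : Env n p) (M : Memory) (d : Bool) (g : Gate) :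
    g.pull E M d (Kernel.id : Kernel (Qubit m)) = Kernel.id := by
  have h1 : ∀ U q, Uᴴ * U = 1 →
      Kernel.atQubit U d q (Kernel.id : Kernel (Qubit m)) = Kernel.id := by
    intro U q hU
    unfold Kernel.atQubit
    split_ifs
    · exact Kernel.one_id hU _
    · rfl
  have h2 : ∀ D q q', (∀ a b, ‖D a b‖ = 1) →
      Kernel.atPair D d q q' (Kernel.id : Kernel (Qubit m)) = Kernel.id := by
    intro D q q' hD
    unfold Kernel.atPair
    split_ifs
    · exact Kernel.diag_id fun z => hD _ _
    · rfl
  cases g with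
  | had q => exact h1 _ _ hadamardGate_unitary
  | sGate q => exact h1 _ _ (phaseGate_unitary _)
  | tGate q => exact h1 _ _ (phaseGate_unitary _)
  | cz q q' => exact h2 _ _ _ fun a b => by cases a <;> cases b <;> simp [czPhase]
  | rx q l =>
    simp only [Gate.pull]
    split_ifs
    · exact h1 _ _ (xRotation_unitary _)
    · rfl
  | rzz q q' l =>
    simp only [Gate.pull]
    split_ifs
    · exact h2 _ _ _ (norm_zzPhase _)
    · rfl

/-- Gates are unitary and measurements complete, so the identity form is a fixed point. With
`sum_exec_value` this is conservation of probability. -/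
lemma Prog.back_id (E : Env n p) (c : Prog) :
    c.back E (fun _ => (Kernel.id : Kernel (Qubit m))) = fun _ => Kernel.id := by
  induction c with
  | seq c c' ih ih' => simp [Prog.back, ih, ih']
  | coin => funext M z z'; simp [Prog.back]
  | ite e c c' ih ih' => funext M; simp [Prog.back, ih, ih']
  | loop a e c ih =>
    funext M
    simp only [Prog.back]
    induction e.eval M with
    | zero => rfl
    | succ N ihN => simpa [loopSem, ih] using ihN
  | gate d g => funext M; simp [Prog.back, Gate.pull_id]
  | measure d q a i j =>
    funext M
    simp only [Prog.back, measureSem]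
    split_ifs with h
    · funext z z'
      by_cases hz : z = z' <;> simp [Kernel.id, hz]
    · rfl
  | _ => simp [Prog.back]

/-- The bridge from forms to probability: a function of the classical memory, weighted with branch
probabilities, is a multiple of the identity form. -/
lemma Config.value_id (s : Config m) (r : Memory → ℝ) :
    s.value (fun M z z' => if z = z' then (r M : ℂ) else 0) = ((r s.mem * s.prob : ℝ) : ℂ) := by
  simp only [Config.value, pairing_id, Config.prob, ← sum_norm_amp]
  push_cast; ring

lemma ofReal_list_sum (L : List ℝ) : ((L.sum : ℝ) : ℂ) = (L.map (fun x : ℝ => (x : ℂ))).sum := by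
  induction L with
  | nil => simp
  | cons a L ih => simp [ih]

theorem sum_exec_prob (E : Env n p) (c : Prog) (s : Config m) :
    ((c.exec E s).map Config.prob).sum = s.prob := by
  have h := sum_exec_value E c (fun _ => (Kernel.id : Kernel (Qubit m))) s
  rw [Prog.back_id] at h
  have hv : ∀ s : Config m, s.value (fun _ => Kernel.id) = (s.prob : ℂ) := by
    intro s
    have := s.value_id (fun _ => 1)
    simp only [Complex.ofReal_one, one_mul] at this
    exact this
  apply Complex.ofReal_injective
  rw [← hv, ← h, ofReal_list_sum, List.map_map]
  congr 1
  exact List.map_congr_left fun s _ => (hv s).symm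

/-- Weights stay nonnegative. -/
lemma weight_nonneg (E : Env n p) (c : Prog) (s : Config m) (hs : 0 ≤ s.weight) :
    ∀ s' ∈ c.exec E s, 0 ≤ s'.weight := by
  induction c generalizing s with
  | seq c c' ih ih' =>
    intro s' h
    simp only [Prog.exec, List.mem_flatMap] at h
    obtain ⟨s1, h1, h2⟩ := h
    exact ih' _ (ih _ hs _ h1) _ h2
  | ite e c c' ih ih' =>
    simp only [Prog.exec]
    split_ifs
    · exact ih _ hs
    · exact ih' _ hs
  | loop a e c ih =>
    simp only [exec_loop]
    induction e.eval s.mem with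
    | zero => simpa [loopBranches, Config.tick] using hs
    | succ N ihN =>
      intro s' h
      simp only [loopBranches, List.mem_flatMap] at h
      obtain ⟨s1, h1, h2⟩ := h
      exact ih { s1.tick with mem := s1.mem.set a 0 0 N } (ihN s1 h1) _ h2
  | measure d q a i j =>
    simp only [Prog.exec, Config.measure]
    split_ifs <;> simpa [Config.tick] using hs
  | coin =>
    simp only [Prog.exec, Config.tick, List.map_cons, List.map_nil, List.mem_cons,
      List.not_mem_nil, or_false]
    rintro s' (rfl | rfl) <;> exact div_nonneg hs zero_le_two
  | _ => simpa [Prog.exec, Config.tick] using hs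

lemma Config.prob_nonneg (s : Config m) (hs : 0 ≤ s.weight) : 0 ≤ s.prob := by
  have : ∀ ψ : QVec m, 0 ≤ normSq ψ := fun ψ => Finset.sum_nonneg fun _ _ => by positivity
  exact mul_nonneg hs (mul_nonneg (this _) (this _))

/-! ## Running time and untouched data -/

/-- All array reads are from arrays below `k`. -/
def Expr.readsBelow (k : ℕ) : Expr → Bool
  | .const _ => true
  | .get a i j => decide (a < k) && i.readsBelow k && j.readsBelow k
  | .add e e' => e.readsBelow k && e'.readsBelow k
  | .sub e e' => e.readsBelow k && e'.readsBelow k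
  | .lt e e' => e.readsBelow k && e'.readsBelow k

lemma Expr.eval_congr {k : ℕ} {M M' : Memory} (h : ∀ a < k, M' a = M a) (e : Expr)
    (he : e.readsBelow k) : e.eval M' = e.eval M := by
  induction e with
  | const => rfl
  | get a i j ih ih' =>
    simp only [Expr.readsBelow, Bool.and_eq_true, decide_eq_true_eq] at he
    simp [Expr.eval, h a he.1.1, ih he.1.2, ih' he.2]
  | add e e' ih ih' | sub e e' ih ih' | lt e e' ih ih' =>
    simp only [Expr.readsBelow, Bool.and_eq_true] at he
    simp [Expr.eval, ih he.1, ih' he.2]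

/-- The program writes only to arrays from `k` on, and the lengths of its loops are determined by
the arrays below `k`. -/
def Prog.wellBounded (k : ℕ) : Prog → Bool
  | .seq c c' => c.wellBounded k && c'.wellBounded k
  | .assign a _ _ _ => decide (k ≤ a)
  | .coin a _ _ => decide (k ≤ a)
  | .ite _ c c' => c.wellBounded k && c'.wellBounded k
  | .loop a e c => decide (k ≤ a) && e.readsBelow k && c.wellBounded k
  | .measure _ _ a _ _ => decide (k ≤ a)
  | _ => true

/-- A bound on the running time, when the lengths of the loops are read from the memory `M`. -/
def Prog.cost (M : Memory) : Prog → ℕ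
  | .skip => 0
  | .seq c c' => c.cost M + c'.cost M
  | .ite _ c c' => 1 + (c.cost M + c'.cost M)
  | .loop _ e c => 1 + e.eval M * (1 + c.cost M)
  | _ => 1

lemma Memory.set_ne (M : Memory) {a a' : ℕ} (h : a' ≠ a) (i j v : ℕ) :
    M.set a i j v a' = M a' := by
  funext i' j'; simp [Memory.set, h]

lemma Prog.cost_congr {k : ℕ} {M M' : Memory} (h : ∀ a < k, M' a = M a) (c : Prog)
    (hc : c.wellBounded k) : c.cost M' = c.cost M := by
  induction c with
  | seq c c' ih ih' | ite e c c' ih ih' =>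
    simp only [Prog.wellBounded, Bool.and_eq_true] at hc
    simp [Prog.cost, ih hc.1, ih' hc.2]
  | loop a e c ih =>
    simp only [Prog.wellBounded, Bool.and_eq_true] at hc
    simp [Prog.cost, ih hc.2, Expr.eval_congr h e hc.1.2]
  | _ => rfl

/-- Loop lengths are read only from arrays that are never written, so they can be evaluated in the
initial memory although the run itself is random. The invariance of those arrays has to be carried
through the induction together with the time. -/
theorem exec_time_le (E : Env n p) {k : ℕ} (c : Prog) (hc : c.wellBounded k) (s : Config m) :
    ∀ s' ∈ c.exec E s, (∀ a < k, s'.mem a = s.mem a) ∧ s'.time ≤ s.time + c.cost s.mem := by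
  have hset : ∀ (M : Memory) (b i j v : ℕ), k ≤ b → ∀ a < k, M.set b i j v a = M a :=
    fun M b i j v hb a ha => Memory.set_ne M (by omega) _ _ _
  induction c generalizing s with
  | seq c c' ih ih' =>
    intro s' h
    simp only [Prog.wellBounded, Bool.and_eq_true] at hc
    simp only [Prog.exec, List.mem_flatMap] at h
    obtain ⟨s1, h1, h2⟩ := h
    obtain ⟨a1, t1⟩ := ih hc.1 _ _ h1
    obtain ⟨a2, t2⟩ := ih' hc.2 _ _ h2
    refine ⟨fun a ha => (a2 a ha).trans (a1 a ha), ?_⟩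
    rw [Prog.cost_congr a1 c' hc.2] at t2
    simp only [Prog.cost]; omega
  | ite e c c' ih ih' =>
    intro s' h
    simp only [Prog.wellBounded, Bool.and_eq_true] at hc
    simp only [Prog.exec] at h
    split_ifs at h
    · obtain ⟨a1, t1⟩ := ih hc.1 _ _ h
      refine ⟨a1, ?_⟩
      simp only [Prog.cost, Config.tick] at t1 ⊢; omega
    · obtain ⟨a1, t1⟩ := ih' hc.2 _ _ h
      refine ⟨a1, ?_⟩
      simp only [Prog.cost, Config.tick] at t1 ⊢; omega
  | loop b e c ih =>
    simp only [Prog.wellBounded, Bool.and_eq_true, decide_eq_true_eq] at hc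
    simp only [exec_loop, Prog.cost]
    induction e.eval s.mem with
    | zero => simp [loopBranches, Config.tick]
    | succ N ihN =>
      intro s' h
      simp only [loopBranches, List.mem_flatMap] at h
      obtain ⟨s1, h1, h2⟩ := h
      obtain ⟨a1, t1⟩ := ihN _ h1
      obtain ⟨a2, t2⟩ := ih hc.2 _ _ h2
      have a3 : ∀ a < k, s1.mem.set b 0 0 N a = s.mem a :=
        fun a ha => (hset _ _ _ _ _ hc.1.1 a ha).trans (a1 a ha)
      refine ⟨fun a ha => (a2 a ha).trans (a3 a ha), ?_⟩
      simp only [Config.tick] at t2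
      rw [Prog.cost_congr a3 c hc.2] at t2
      rw [Nat.succ_mul]; omega
  | measure d q b i j =>
    simp only [Prog.wellBounded, decide_eq_true_eq] at hc
    simp only [Prog.exec, Config.measure, Prog.cost, Config.tick]
    split_ifs <;> simp +contextual [hset, hc]
  | coin b i j =>
    simp only [Prog.wellBounded, decide_eq_true_eq] at hc
    simp +contextual [Prog.exec, Prog.cost, Config.tick, hset, hc]
  | assign b i j e =>
    simp only [Prog.wellBounded, decide_eq_true_eq] at hc
    simp +contextual [Prog.exec, Prog.cost, Config.tick, hset, hc]
  | _ => simp [Prog.exec, Prog.cost, Config.tick]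

/-- No real register is written. -/
def Prog.noReal : Prog → Bool
  | .seq c c' => c.noReal && c'.noReal
  | .ite _ c c' => c.noReal && c'.noReal
  | .loop _ _ c => c.noReal
  | .realOfNat _ _ | .realAdd _ _ _ | .realSub _ _ _ | .realHalf _ _ | .query _ _ => false
  | _ => true

lemma exec_reg (E : Env n p) (c : Prog) (hc : c.noReal) (s : Config m) :
    ∀ s' ∈ c.exec E s, s'.reg = s.reg := by
  induction c generalizing s with
  | seq c c' ih ih' =>
    intro s' h
    simp only [Prog.noReal, Bool.and_eq_true] at hc
    simp only [Prog.exec, List.mem_flatMap] at h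
    obtain ⟨s1, h1, h2⟩ := h
    exact (ih' hc.2 _ _ h2).trans (ih hc.1 _ _ h1)
  | ite e c c' ih ih' =>
    simp only [Prog.noReal, Bool.and_eq_true] at hc
    simp only [Prog.exec]
    split_ifs
    · exact ih hc.1 _
    · exact ih' hc.2 _
  | loop a e c ih =>
    simp only [Prog.noReal] at hc
    simp only [exec_loop]
    induction e.eval s.mem with
    | zero => simp [loopBranches, Config.tick]
    | succ N ihN =>
      intro s' h
      simp only [loopBranches, List.mem_flatMap] at h
      obtain ⟨s1, h1, h2⟩ := h
      have h3 := ih hc _ _ h2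
      exact h3.trans (ihN s1 h1)
  | measure d q a i j =>
    simp only [Prog.exec, Config.measure]
    split_ifs <;> simp [Config.tick]
  | realOfNat | realAdd | realSub | realHalf | query => simp [Prog.noReal] at hc
  | _ => simp [Prog.exec, Config.tick]

/-! ## Deterministic programs -/

/-- Only assignments, branchings and loops. -/
def Prog.classical : Prog → Bool
  | .skip => true
  | .seq c c' => c.classical && c'.classical
  | .assign _ _ _ _ => true
  | .ite _ c c' => c.classical && c'.classical
  | .loop _ _ c => c.classical
  | _ => false

/-- The memory after `N` iterations of a loop with body `B`. -/
def loopRun (a : ℕ) (B : Memory → Memory) (M : Memory) : ℕ → Memory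
  | 0 => M
  | k + 1 => B ((loopRun a B M k).set a 0 0 k)

/-- The memory after running a classical program. -/
def Prog.run : Prog → Memory → Memory
  | .seq c c', M => c'.run (c.run M)
  | .assign a i j e, M => M.set a (i.eval M) (j.eval M) (e.eval M)
  | .ite e c c', M => if e.eval M ≠ 0 then c.run M else c'.run M
  | .loop a e c, M => loopRun a c.run M (e.eval M)
  | _, M => M

lemma loopRun_induct {a : ℕ} {B : Memory → Memory} {M : Memory} (Q : ℕ → Memory → Prop) (N : ℕ)
    (h0 : Q 0 M) (h : ∀ k < N, ∀ M', Q k M' → Q (k + 1) (B (M'.set a 0 0 k))) :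
    Q N (loopRun a B M N) := by
  induction N with
  | zero => exact h0
  | succ N ih => exact h N (by omega) _ (ih fun k hk => h k (by omega))

/-- Without coins and measurements there is a single branch, which reduces the classical part to the
memory transformer `Prog.run`. The time stays unspecified here because `exec_time_le` bounds it. -/
theorem exec_classical (E : Env n p) (c : Prog) (hc : c.classical) (s : Config m) :
    ∃ t, c.exec E s = [{ s with mem := c.run s.mem, time := t }] := by
  induction c generalizing s with
  | skip => exact ⟨s.time, rfl⟩
  | seq c c' ih ih' =>
    simp only [Prog.classical, Bool.and_eq_true] at hc
    obtain ⟨t, h⟩ := ih hc.1 s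
    obtain ⟨t', h'⟩ := ih' hc.2 { s with mem := c.run s.mem, time := t }
    exact ⟨t', by simp [Prog.exec, h, h', Prog.run]⟩
  | assign a i j e => exact ⟨_, rfl⟩
  | ite e c c' ih ih' =>
    simp only [Prog.classical, Bool.and_eq_true] at hc
    simp only [Prog.exec, Prog.run]
    split_ifs with h
    · exact ih hc.1 s.tick
    · exact ih' hc.2 s.tick
  | loop a e c ih =>
    simp only [exec_loop, Prog.run]
    induction e.eval s.mem with
    | zero => exact ⟨_, rfl⟩
    | succ N ihN =>
      obtain ⟨t, h⟩ := ihN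
      simp only [loopBranches, h, List.flatMap_cons, List.flatMap_nil, List.append_nil,
        Config.tick]
      exact ih hc _
  | _ => simp [Prog.classical] at hc

end

/-! ## The quantum part of the program

Arrays: `4`, `5`, `6` hold the qubits of the vertices on device `0`, of the vertices on device `1`,
and of the copies of the separator on device `1`; a value that is no qubit means absence.
Arrays `11`, `12`, `13` are loop counters, array `14` holds the sign bit and the discard bit of the
current sample, `15` outcomes, `16` a flag, `17` the measured bit string. -/

/-- The entry `(i, 0)` of array `a`. -/
def cell (a i : ℕ) : Expr := .get a (.const i) (.const 0)

/-- The qubit of the vertex `u`, according to array `a`. -/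
def qubitOf (a u : ℕ) : Expr := .get a (cell u 0) (.const 0)

/-- The Pauli gate `Z`. -/
def zGate (d : Bool) (q : Expr) : Prog := .seq (.gate d (.sGate q)) (.gate d (.sGate q))

/-- The Pauli gate `X`. -/
def xGate (d : Bool) (q : Expr) : Prog :=
  .seq (.gate d (.had q)) (.seq (zGate d q) (.gate d (.had q)))

/-- Put a qubit into the state `|0⟩`. -/
def resetQubit (d : Bool) (q : Expr) : Prog :=
  .seq (.measure d q 15 (.const 0) (.const 0)) (.ite (cell 15 0) (xGate d q) .skip)

/-- Put all qubits into the state `|0⟩`. -/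
def resetAll : Prog :=
  .loop 12 (cell 0 0) (.seq (resetQubit false (cell 12 0)) (resetQubit true (cell 12 0)))

/-- Prepare the uniform superposition. -/
def prepare : Prog :=
  .loop 12 (cell 0 0)
    (.seq (.gate false (.had (qubitOf 4 12))) (.gate true (.had (qubitOf 5 12))))

/-- Prepare the uniform superposition of the copies. -/
def openCopies : Prog := .loop 12 (cell 0 0) (.gate true (.had (qubitOf 6 12)))

/-- Random linear phases on the separator, and the opposite ones on the copies. -/
def linearPhases : Prog :=
  .loop 12 (cell 0 0) (.ite (qubitOf 2 12)
    (.seq (.coin 15 (.const 0) (.const 0))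
      (.ite (cell 15 0)
        (.seq (.gate false (.sGate (qubitOf 4 12)))
          (.seq (.gate true (.sGate (qubitOf 6 12))) (zGate true (qubitOf 6 12))))
        .skip))
    .skip)

/-- Random quadratic phases on the separator and on the copies. -/
def quadraticPhases : Prog :=
  .loop 12 (cell 0 0) (.loop 13 (cell 0 0)
    (.ite (.lt (.const 1) (.add (qubitOf 2 12) (qubitOf 2 13)))
      (.seq (.coin 15 (.const 0) (.const 0))
        (.ite (cell 15 0)
          (.seq (.gate false (.cz (qubitOf 4 12) (qubitOf 4 13)))
            (.gate true (.cz (qubitOf 6 12) (qubitOf 6 13))))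
          .skip))
      .skip))

/-- Measure the separator and the copies; change the sign of the sample, and discard it if the
outcomes agree. -/
def dephase : Prog :=
  .seq (.assign 16 (.const 0) (.const 0) (.const 0))
    (.seq
      (.loop 12 (cell 0 0) (.ite (qubitOf 2 12)
        (.seq (.measure false (qubitOf 4 12) 15 (.const 0) (.const 0))
          (.seq (.measure true (qubitOf 6 12) 15 (.const 1) (.const 0))
            (.assign 16 (.const 0) (.const 0)
              (.add (cell 16 0)
                (.add (.lt (cell 15 0) (cell 15 1)) (.lt (cell 15 1) (cell 15 0)))))))
        .skip))
      (.seq (.ite (cell 16 0) .skip (.assign 14 (.const 1) (.const 0) (.const 1)))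
        (.assign 14 (.const 0) (.const 0) (.sub (.const 1) (cell 14 0)))))

/-- Copy the separator to device `1`, by quasiprobability sampling. -/
def copySeparator : Prog :=
  .seq openCopies
    (.seq (.coin 15 (.const 0) (.const 0))
      (.ite (cell 15 0) dephase (.seq linearPhases quadraticPhases)))

/-- The rotations `exp (-i γ Z Z)` of a layer. -/
def costGates : Prog :=
  .loop 12 (cell 0 0) (.loop 13 (cell 0 0)
    (.ite (.get 1 (cell 12 0) (cell 13 0))
      (.seq
        (.ite (.lt (cell 12 0) (cell 13 0))
          (.seq (.gate false (.rzz (qubitOf 4 12) (qubitOf 4 13) (cell 11 0)))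
            (.gate true (.rzz (qubitOf 5 12) (qubitOf 5 13) (cell 11 0))))
          .skip)
        (.gate true (.rzz (qubitOf 5 12) (qubitOf 6 13) (cell 11 0))))
      .skip))

/-- Measure the copies in the Hadamard basis, correct the separator, and reset the copies. -/
def closeCopies : Prog :=
  .loop 12 (cell 0 0) (.ite (qubitOf 2 12)
    (.seq (.gate true (.had (qubitOf 6 12)))
      (.seq (.measure true (qubitOf 6 12) 15 (.const 0) (.const 0))
        (.ite (cell 15 0)
          (.seq (zGate false (qubitOf 4 12)) (xGate true (qubitOf 6 12)))
          .skip)))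
    .skip)

/-- The rotations `exp (-i β X)` of a layer. -/
def mixingGates : Prog :=
  .loop 12 (cell 0 0)
    (.seq (.gate false (.rx (qubitOf 4 12) (cell 11 0)))
      (.gate true (.rx (qubitOf 5 12) (cell 11 0))))

/-- A layer of the QAOA circuit. -/
def layer : Prog := .seq copySeparator (.seq costGates (.seq closeCopies mixingGates))

/-- Measure all vertices. -/
def readOut : Prog :=
  .loop 12 (cell 0 0)
    (.seq (.measure false (qubitOf 4 12) 15 (.const 0) (.const 0))
      (.seq (.measure true (qubitOf 5 12) 15 (.const 1) (.const 0))
        (.assign 17 (cell 12 0) (.const 0) (.add (cell 15 0) (cell 15 1)))))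

/-- One run of the circuit. -/
def circuit : Prog :=
  .seq resetAll
    (.seq (.assign 14 (.const 0) (.const 0) (.const 0))
      (.seq (.assign 14 (.const 1) (.const 0) (.const 0))
        (.seq prepare (.seq (.loop 11 (cell 0 1) layer) readOut))))

/-- Add the signed value of `f` to the output. -/
def accumulate : Prog :=
  .seq (.query 1 17)
    (.ite (cell 14 1) .skip (.ite (cell 14 0) (.realSub 0 0 1) (.realAdd 0 0 1)))

/-- One run of the circuit, with the signed value of `f` added to the output. -/
def sample : Prog := .seq circuit accumulate

/-- Sum up the samples, and scale. -/
def estimate : Prog :=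
  .seq (.loop 10 (cell 3 0) sample) (.loop 10 (cell 3 1) (.realHalf 0 0))

/-- The sign of a sample, or `0` if the sample is discarded. -/
def sampleSign (A : ℕ → ℕ → ℕ) : ℝ := if A 1 0 ≠ 0 then 0 else if A 0 0 ≠ 0 then -1 else 1

/-! ## Layouts -/

/-- The memory `M` describes a placement of the vertices, and of copies of the separator `S`, on the
qubits of the two devices. -/
structure Layout {n : ℕ} (p m : ℕ) (G : SimpleGraph (Fin n)) (S : Finset (Fin n)) (M : Memory) where
  loc : Fin n → Qubit m
  cop : Fin n → Qubit m
  size : M 0 0 0 = n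
  depth : M 0 1 0 = p
  adj : ∀ u v : Fin n, M 1 u v ≠ 0 ↔ G.Adj u v
  sep : ∀ u : Fin n, u ∈ S → M 2 u 0 = 1
  not_sep : ∀ u : Fin n, u ∉ S → M 2 u 0 = 0
  posA : ∀ u : Fin n, (loc u).1 = false → M 4 u 0 = (loc u).2
  posA' : ∀ u : Fin n, (loc u).1 = true → m ≤ M 4 u 0
  posB : ∀ u : Fin n, (loc u).1 = true → M 5 u 0 = (loc u).2
  posB' : ∀ u : Fin n, (loc u).1 = false → m ≤ M 5 u 0
  posC : ∀ u ∈ S, M 6 (u : Fin n) 0 = (cop u).2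
  posC' : ∀ u : Fin n, u ∉ S → m ≤ M 6 u 0
  sep_loc : ∀ u ∈ S, (loc u).1 = false
  cop_dev : ∀ u ∈ S, (cop u).1 = true
  loc_inj : Function.Injective loc
  cop_inj : ∀ u ∈ S, ∀ v ∈ S, cop u = cop v → u = v
  cop_ne_loc : ∀ u ∈ S, ∀ v, cop u ≠ loc v
  no_edge : ∀ u v, (loc u).1 = true → (loc v).1 = false → v ∉ S → ¬ G.Adj u v

section

/-! ## Elementary operations on kernels -/

section Elementary

variable {ι : Type} [DecidableEq ι]

lemma Kernel.one_one (U V : Matrix Bool Bool ℂ) (i : ι) (K : Kernel ι) :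
    Kernel.one U i (Kernel.one V i K) = Kernel.one (V * U) i K := by
  funext z z'
  simp only [Kernel.one, Matrix.mul_apply, Function.update_self, Function.update_idem,
    Fintype.sum_bool, star_add, star_mul']
  ring

/-- The Pauli matrix `X`. -/
def pauliX : Matrix Bool Bool ℂ := fun a b => if a = b then 0 else 1

/-- The diagonal of the phase gate `S`. -/
def sPhase (b : Bool) : ℂ := if b then Complex.I else 1

lemma phaseGate_pi_div_two : phaseGate (Real.pi / 2) = Matrix.diagonal sPhase := by
  have h : Complex.exp (Complex.I * ((Real.pi / 2 : ℝ) : ℂ)) = Complex.I := by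
    rw [mul_comm]; push_cast; exact Complex.exp_pi_div_two_mul_I
  simp only [phaseGate, h]
  rfl

lemma inv_sqrt_two_mul_self :
    (((Real.sqrt 2)⁻¹ : ℝ) : ℂ) * (((Real.sqrt 2)⁻¹ : ℝ) : ℂ) = 1 / 2 := by
  rw [← Complex.ofReal_mul, ← mul_inv, Real.mul_self_sqrt (by norm_num)]; simp

lemma hadamard_mul_z_mul_hadamard :
    hadamardGate * (Matrix.diagonal sPhase * Matrix.diagonal sPhase) * hadamardGate = pauliX := by
  have h := inv_sqrt_two_mul_self
  have hI : ∀ r : ℂ, r * Complex.I * Complex.I = -r := fun r => by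
    rw [mul_assoc, Complex.I_mul_I]; ring
  rw [Matrix.diagonal_mul_diagonal]
  ext a b
  simp only [Matrix.mul_apply, hadamardGate, Fintype.sum_bool, Matrix.diagonal_apply, pauliX,
    sPhase]
  generalize (((Real.sqrt 2)⁻¹ : ℝ) : ℂ) = r at h
  cases a <;> cases b <;> simp [Complex.I_mul_I] <;> linear_combination 2 * h

lemma Kernel.one_pauliX (i : ι) (K : Kernel ι) (z z' : ι → Bool) :
    Kernel.one pauliX i K z z' =
      K (Function.update z i !z i) (Function.update z' i !z' i) := by
  simp only [Kernel.one, pauliX, Fintype.sum_bool]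
  cases z i <;> cases z' i <;> simp

end Elementary

variable {m n p : ℕ}

lemma Kernel.atQubit_qubit (U : Matrix Bool Bool ℂ) (i : Qubit m) {d : Bool} {q : ℕ}
    (hd : i.1 = d) (hq : q = i.2) (K : Kernel (Qubit m)) : K.atQubit U d q = K.one U i := by
  subst hd hq
  simp [Kernel.atQubit]

lemma Kernel.atQubit_of_le (U : Matrix Bool Bool ℂ) {d : Bool} {q : ℕ} (hq : m ≤ q)
    (K : Kernel (Qubit m)) : K.atQubit U d q = K := by
  simp [Kernel.atQubit, not_lt.mpr hq]

lemma back_zGate (E : Env n p) (d : Bool) (q : Expr) (O : Memory → Kernel (Qubit m)) (M : Memory)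
    (i : Qubit m) (hd : i.1 = d) (hq : q.eval M = i.2) :
    (zGate d q).back E O M =
      Kernel.one (Matrix.diagonal sPhase * Matrix.diagonal sPhase) i (O M) := by
  simp only [zGate, Prog.back, Gate.pull, Kernel.atQubit_qubit _ i hd hq, Kernel.one_one,
    phaseGate_pi_div_two]

lemma back_xGate (E : Env n p) (d : Bool) (q : Expr) (O : Memory → Kernel (Qubit m)) (M : Memory)
    (i : Qubit m) (hd : i.1 = d) (hq : q.eval M = i.2) (z z' : Qubit m → Bool) :
    (xGate d q).back E O M z z' =
      O M (Function.update z i !z i) (Function.update z' i !z' i) := by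
  rw [← Kernel.one_pauliX i (O M), ← hadamard_mul_z_mul_hadamard]
  simp only [xGate, Prog.back, Gate.pull, Kernel.atQubit_qubit _ i hd hq,
    back_zGate E d q _ M i hd hq, Kernel.one_one]

lemma sPhase_mul_star (a b : Bool) :
    sPhase a * sPhase a * star (sPhase b * sPhase b) = zSign a * zSign b := by
  cases a <;> cases b <;> simp [sPhase, zSign]

lemma measureSem_qubit (i : Qubit m) {d : Bool} {q : ℕ} (hd : i.1 = d) (hq : q = i.2) (a k j : ℕ)
    (O : Memory → Kernel (Qubit m)) (M : Memory) (z z' : Qubit m → Bool) :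
    measureSem d q a k j O M z z' = if z i = z' i then O (M.set a k j (z i).toNat) z z' else 0 := by
  subst hd hq
  simp [measureSem]

lemma measureSem_of_le {d : Bool} {q : ℕ} (hq : m ≤ q) (a k j : ℕ)
    (O : Memory → Kernel (Qubit m)) (M : Memory) :
    measureSem d q a k j O M = O (M.set a k j 0) := by
  simp [measureSem, not_lt.mpr hq]

lemma Memory.set_self (M : Memory) (a i j v : ℕ) : M.set a i j v a i j = v := by
  simp [Memory.set]

lemma cell_eval (M : Memory) (a i : ℕ) : (cell a i).eval M = M a i 0 := rfl

lemma qubitOf_eval (M : Memory) (a u : ℕ) : (qubitOf a u).eval M = M a (M u 0 0) 0 := rfl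

lemma back_ite_pos (E : Env n p) {e : Expr} {c c' : Prog} {M : Memory} (h : e.eval M ≠ 0)
    (O : Memory → Kernel (Qubit m)) : (Prog.ite e c c').back E O M = c.back E O M := by
  simp only [Prog.back, if_pos h]

lemma back_ite_neg (E : Env n p) {e : Expr} {c c' : Prog} {M : Memory} (h : e.eval M = 0)
    (O : Memory → Kernel (Qubit m)) : (Prog.ite e c c').back E O M = c'.back E O M := by
  simp only [Prog.back, if_neg (not_not.mpr h)]

/-- Branching on a coin. -/
lemma back_coin_ite (E : Env n p) (c c' : Prog) (O : Memory → Kernel (Qubit m)) (M : Memory)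
    (z z' : Qubit m → Bool) :
    (Prog.seq (.coin 15 (.const 0) (.const 0)) (.ite (cell 15 0) c c')).back E O M z z' =
      (c'.back E O (M.set 15 0 0 0) z z' + c.back E O (M.set 15 0 0 1) z z') / 2 := by
  have h0 : (cell 15 0).eval (M.set 15 0 0 0) = 0 := Memory.set_self _ _ _ _ _
  have h1 : (cell 15 0).eval (M.set 15 0 0 1) ≠ 0 := by
    rw [cell_eval, Memory.set_self]; exact one_ne_zero
  rw [← back_ite_neg E (c := c) h0, ← back_ite_pos E (c' := c') h1]
  rfl

/-- Branching on the outcome of a measurement. -/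
lemma back_measure_ite (E : Env n p) (c c' : Prog) (O : Memory → Kernel (Qubit m)) (M : Memory)
    (i : Qubit m) {d : Bool} {q : Expr} (hd : i.1 = d) (hq : q.eval M = i.2)
    (z z' : Qubit m → Bool) :
    (Prog.seq (.measure d q 15 (.const 0) (.const 0)) (.ite (cell 15 0) c c')).back E O M z z' =
      if z i = z' i then
        if z i = true then c.back E O (M.set 15 0 0 1) z z'
        else c'.back E O (M.set 15 0 0 0) z z'
      else 0 := by
  have h0 : (cell 15 0).eval (M.set 15 0 0 0) = 0 := Memory.set_self _ _ _ _ _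
  have h1 : (cell 15 0).eval (M.set 15 0 0 1) ≠ 0 := by
    rw [cell_eval, Memory.set_self]; exact one_ne_zero
  rw [← back_ite_neg E (c := c) h0, ← back_ite_pos E (c' := c') h1]
  rw [show (Prog.seq (.measure d q 15 (.const 0) (.const 0)) (.ite (cell 15 0) c c')).back E O M =
    measureSem d (q.eval M) 15 0 0 ((Prog.ite (cell 15 0) c c').back E O) M from rfl,
    measureSem_qubit i hd hq]
  cases z i <;> rfl

/-! ## Memory invariants -/

/-- `I` fixes the arrays below `10` and says nothing about the arrays from `k` on. -/
structure Stable (M₀ : Memory) (k : ℕ) (I : Memory → Prop) : Prop where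
  static : ∀ M, I M → ∀ a < 10, M a = M₀ a
  set : ∀ M a i j v, k ≤ a → I M → I (M.set a i j v)

/-- `I`, and the counter `a` has the value `u`. -/
def withCounter (I : Memory → Prop) (a u : ℕ) : Memory → Prop := fun M => I M ∧ M a 0 0 = u

lemma Stable.counter {M₀ : Memory} {k a u : ℕ} {I : Memory → Prop} (hI : Stable M₀ k I)
    (ha : k ≤ a) : Stable M₀ (a + 1) (withCounter I a u) where
  static M hM := hI.static M hM.1
  set M b i j v hb hM := ⟨hI.set M b i j v (by omega) hM.1, by
    rw [Memory.set_ne M (by omega)]; exact hM.2⟩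

lemma Stable.set_counter {M₀ : Memory} {k a u : ℕ} {I : Memory → Prop} (hI : Stable M₀ k I)
    (ha : k ≤ a) {M : Memory} (hM : I M) : withCounter I a u (M.set a 0 0 u) :=
  ⟨hI.set M a 0 0 u ha hM, Memory.set_self _ _ _ _ _⟩

lemma Stable.mono {M₀ : Memory} {k k' : ℕ} {I : Memory → Prop} (hI : Stable M₀ k I) (h : k ≤ k') :
    Stable M₀ k' I :=
  ⟨hI.static, fun M a i j v ha => hI.set M a i j v (h.trans ha)⟩

/-! ## Logical basis states -/

/-- The product over vertices from `k` on is the multiplier collected by iterations `k, …, n - 1` of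
a vertex loop; pulling back one more iteration adds one factor. -/
lemma prod_from_succ (k : ℕ) (hk : k < n) (φ : Fin n → ℂ) :
    (∏ u : Fin n, if k ≤ (u : ℕ) then φ u else 1) =
      φ ⟨k, hk⟩ * ∏ u : Fin n, if k + 1 ≤ (u : ℕ) then φ u else 1 := by
  rw [← Finset.mul_prod_erase Finset.univ (fun u : Fin n => if k ≤ (u : ℕ) then φ u else 1)
    (Finset.mem_univ ⟨k, hk⟩),
    ← Finset.mul_prod_erase Finset.univ (fun u : Fin n => if k + 1 ≤ (u : ℕ) then _ else _)
    (Finset.mem_univ ⟨k, hk⟩)]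
  simp only [le_refl, if_true, Nat.not_succ_le_self, if_false, one_mul]
  congr 1
  refine Finset.prod_congr rfl fun u hu => ?_
  have : (u : ℕ) ≠ k := fun h => (Finset.ne_of_mem_erase hu) (Fin.ext h)
  exact if_congr (by omega) rfl rfl

lemma prod_from_last (φ : Fin n → ℂ) : (∏ u : Fin n, if n ≤ (u : ℕ) then φ u else 1) = 1 :=
  Finset.prod_eq_one fun u _ => if_neg (by omega)

section Logical

variable {G : SimpleGraph (Fin n)} {S : Finset (Fin n)} {M₀ : Memory}

/-- The values of the vertices and of the copies of the separator. -/
abbrev Logical (n : ℕ) := (Fin n → Bool) × (Fin n → Bool)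

open Classical in
/-- The basis state of the two devices for given values of the vertices and of the copies. -/
def Layout.emb (L : Layout p m G S M₀) (w : Logical n) : Qubit m → Bool :=
  fun i => decide ((∃ v, L.loc v = i ∧ w.1 v = true) ∨ ∃ u ∈ S, L.cop u = i ∧ w.2 u = true)

variable (L : Layout p m G S M₀)

lemma Layout.emb_loc (w : Logical n) (v : Fin n) : L.emb w (L.loc v) = w.1 v := by
  rw [Bool.eq_iff_iff]
  simp only [Layout.emb, decide_eq_true_eq]
  constructor
  · rintro (⟨u, h, hu⟩ | ⟨u, hu, h, _⟩)
    · rwa [← L.loc_inj h]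
    · exact absurd h (L.cop_ne_loc u hu v)
  · exact fun h => Or.inl ⟨v, rfl, h⟩

lemma Layout.emb_cop (w : Logical n) {u : Fin n} (hu : u ∈ S) : L.emb w (L.cop u) = w.2 u := by
  rw [Bool.eq_iff_iff]
  simp only [Layout.emb, decide_eq_true_eq]
  constructor
  · rintro (⟨v, h, _⟩ | ⟨v, hv, h, h'⟩)
    · exact absurd h.symm (L.cop_ne_loc u hu v)
    · rwa [← L.cop_inj v hv u hu h]
  · exact fun h => Or.inr ⟨u, hu, rfl, h⟩

lemma Layout.emb_of_ne (w : Logical n) {i : Qubit m} (h : ∀ v, L.loc v ≠ i)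
    (h' : ∀ u ∈ S, L.cop u ≠ i) : L.emb w i = false := by
  simp only [Layout.emb, decide_eq_false_iff_not, not_or, not_exists, not_and]
  exact ⟨fun v hv => absurd hv (h v), fun u hu huv => absurd huv (h' u hu)⟩

lemma Layout.emb_ext {z z' : Qubit m → Bool} (h : ∀ v, z (L.loc v) = z' (L.loc v))
    (h' : ∀ u ∈ S, z (L.cop u) = z' (L.cop u))
    (h'' : ∀ i, (∀ v, L.loc v ≠ i) → (∀ u ∈ S, L.cop u ≠ i) → z i = z' i) : z = z' := by
  funext i
  by_cases h1 : ∃ v, L.loc v = i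
  · obtain ⟨v, rfl⟩ := h1; exact h v
  by_cases h2 : ∃ u ∈ S, L.cop u = i
  · obtain ⟨u, hu, rfl⟩ := h2; exact h' u hu
  push Not at h1 h2
  exact h'' i h1 h2

lemma Layout.update_loc (w : Logical n) (v : Fin n) (b : Bool) :
    Function.update (L.emb w) (L.loc v) b = L.emb (Function.update w.1 v b, w.2) := by
  refine L.emb_ext (fun u => ?_) (fun u hu => ?_) fun i hi hi' => ?_
  · rw [L.emb_loc]
    by_cases h : u = v
    · subst h; simp
    · rw [Function.update_of_ne (fun h' => h (L.loc_inj h')), L.emb_loc]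
      exact (Function.update_of_ne h _ _).symm
  · rw [Function.update_of_ne (L.cop_ne_loc u hu v), L.emb_cop _ hu, L.emb_cop _ hu]
  · rw [Function.update_of_ne (hi v).symm, L.emb_of_ne _ hi hi', L.emb_of_ne _ hi hi']

lemma Layout.update_cop (w : Logical n) {v : Fin n} (hv : v ∈ S) (b : Bool) :
    Function.update (L.emb w) (L.cop v) b = L.emb (w.1, Function.update w.2 v b) := by
  refine L.emb_ext (fun u => ?_) (fun u hu => ?_) fun i hi hi' => ?_
  · rw [Function.update_of_ne (L.cop_ne_loc v hv u).symm, L.emb_loc, L.emb_loc]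
  · rw [L.emb_cop _ hu]
    by_cases h : u = v
    · subst h; simp
    · rw [Function.update_of_ne (fun h' => h (L.cop_inj u hu v hv h')), L.emb_cop _ hu]
      exact (Function.update_of_ne h _ _).symm
  · rw [Function.update_of_ne (hi' v hv).symm, L.emb_of_ne _ hi hi', L.emb_of_ne _ hi hi']

/-- A gate addressed to a vertex on whichever device it lives. -/
lemma Layout.atQubit_loc (U : Matrix Bool Bool ℂ) (u : Fin n) (K : Kernel (Qubit m)) :
    (K.atQubit U true (M₀ 5 u 0)).atQubit U false (M₀ 4 u 0) = K.one U (L.loc u) := by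
  cases h : (L.loc u).1
  · rw [Kernel.atQubit_of_le U (L.posB' u h), Kernel.atQubit_qubit U _ h (L.posA u h)]
  · rw [Kernel.atQubit_of_le U (L.posA' u h), Kernel.atQubit_qubit U _ h (L.posB u h)]

/-- On logical basis states, and for memories satisfying `I`, the family of kernels `O` is `F`,
which depends on the memory only through array `14`. -/
def Layout.Has (L : Layout p m G S M₀) (I : Memory → Prop) (O : Memory → Kernel (Qubit m))
    (F : (ℕ → ℕ → ℕ) → Logical n → Logical n → ℂ) : Prop :=
  ∀ M, I M → ∀ w w', O M (L.emb w) (L.emb w') = F (M 14) w w'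

variable {L}

lemma Layout.Has.loop {I : Memory → Prop} {k : ℕ} (hI : Stable M₀ k I) {E : Env n p} {a : ℕ}
    {c : Prog} {O : Memory → Kernel (Qubit m)} {F : (ℕ → ℕ → ℕ) → Logical n → Logical n → ℂ}
    (h : L.Has I (loopSem a (c.back E) n O) F) :
    L.Has I ((Prog.loop a (cell 0 0) c).back E O) F := by
  intro M hM w w'
  have : (cell 0 0).eval M = n := by
    rw [cell_eval, hI.static M hM 0 (by norm_num), L.size]
  simp only [Prog.back, this]
  exact h M hM w w'

/-- The loop rule for diagonal operations: if each iteration multiplies the kernel by a factor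
independent of array `14`, then the whole loop multiplies it by the product of these factors. -/
lemma Layout.Has.loop_mul {I : Memory → Prop} {k : ℕ} (hI : Stable M₀ k I) {E : Env n p} {a : ℕ}
    {c : Prog} (φ : Fin n → Logical n → Logical n → ℂ)
    (h : ∀ (u : Fin n) O F, L.Has I O F →
      L.Has I (fun M => c.back E O (M.set a 0 0 u)) fun A w w' => φ u w w' * F A w w')
    {O : Memory → Kernel (Qubit m)} {F : (ℕ → ℕ → ℕ) → Logical n → Logical n → ℂ}
    (hO : L.Has I O F) :
    L.Has I ((Prog.loop a (cell 0 0) c).back E O) fun A w w' => (∏ u, φ u w w') * F A w w' := by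
  refine Layout.Has.loop hI ?_
  have key := loopSem_desc a (c.back E) (fun k O => L.Has I O fun A w w' =>
    (∏ u : Fin n, if k ≤ (u : ℕ) then φ u w w' else 1) * F A w w') n ?_ O ?_
  · simpa using key
  · intro k hk O hO
    have := h ⟨k, hk⟩ O _ hO
    intro M hM w w'
    rw [this M hM w w']
    beta_reduce
    rw [← mul_assoc, prod_from_succ k hk fun u => φ u w w']
  · intro M hM w w'
    rw [hO M hM w w']
    beta_reduce
    rw [prod_from_last fun u => φ u w w', one_mul]

end Logical

end

/-! ### Random phases and cost rotations as multipliers of kernels -/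

section

variable {m n p : ℕ} {G : SimpleGraph (Fin n)} {S : Finset (Fin n)} {M₀ : Memory}

lemma Stable.qubitOf_eval {I : Memory → Prop} {k a u : ℕ} (hI : Stable M₀ k I) {M : Memory}
    (hM : withCounter I a u M) {b : ℕ} (hb : b < 10) : (qubitOf b a).eval M = M₀ b u 0 := by
  rw [Hybrid.qubitOf_eval, hM.2, hI.static M hM.1 b hb]

lemma Kernel.atPair_qubit (D : Bool → Bool → ℂ) {i i' : Qubit m} (hne : i ≠ i') {d : Bool}
    {q q' : ℕ} (hd : i.1 = d) (hd' : i'.1 = d) (hq : q = i.2) (hq' : q' = i'.2)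
    (K : Kernel (Qubit m)) : K.atPair D d q q' = K.diag fun z => D (z i) (z i') := by
  obtain ⟨d₁, q₁⟩ := i
  obtain ⟨d₂, q₂⟩ := i'
  simp only at hd hd' hq hq'
  subst hd hd' hq hq'
  have : (q₁ : ℕ) ≠ q₂ := fun h => hne (by rw [Fin.ext h])
  simp [Kernel.atPair, this]

/-- The loops over ordered pairs include the pair `(u, u)`; there the two-qubit gate is void. -/
lemma Kernel.atPair_self (D : Bool → Bool → ℂ) (d : Bool) (q : ℕ) (K : Kernel (Qubit m)) :
    K.atPair D d q q = K := by
  simp [Kernel.atPair]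

lemma Kernel.atPair_of_le (D : Bool → Bool → ℂ) (d : Bool) {q q' : ℕ} (h : m ≤ q ∨ m ≤ q')
    (K : Kernel (Qubit m)) : K.atPair D d q q' = K := by
  have : ¬ (q < m ∧ q' < m ∧ q ≠ q') := by omega
  simp [Kernel.atPair, this]

variable {L : Layout p m G S M₀} {E : Env n p}

/-- The multiplier of a random linear phase. -/
def linearFactor (S : Finset (Fin n)) (u : Fin n) (w w' : Logical n) : ℂ :=
  if u ∈ S then
    (1 + sPhase (w.1 u) * star (sPhase (w'.1 u)) * (sPhase (w.2 u) * star (sPhase (w'.2 u)) *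
      (zSign (w.2 u) * zSign (w'.2 u)))) / 2
  else 1

/-- Averaging over the coin gives `(1 + phase) / 2`. The additional `Z` turns the `S` on the copy
into its inverse, so that the phase is a power of `i` with exponent `(x - x') - (y - y')`. -/
lemma Layout.Has.linearPhases {I : Memory → Prop} (hI : Stable M₀ 12 I)
    {O : Memory → Kernel (Qubit m)} {F : (ℕ → ℕ → ℕ) → Logical n → Logical n → ℂ}
    (hO : L.Has I O F) :
    L.Has I (linearPhases.back E O) fun A w w' => (∏ u, linearFactor S u w w') * F A w w' := by
  refine Layout.Has.loop_mul hI _ (fun u O F hO M hM w w' => ?_) hO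
  beta_reduce
  have hM' := hI.set_counter (u := u) le_rfl hM
  have hI' := hI.counter (u := u) le_rfl
  set M' := M.set 12 0 0 u with hM'def
  have h14 : M' 14 = M 14 := Memory.set_ne _ (by norm_num) _ _ _
  have h0 := hI'.set M' 15 0 0 0 (by norm_num) hM'
  have h1 := hI'.set M' 15 0 0 1 (by norm_num) hM'
  have e2 := hI.qubitOf_eval hM' (show 2 < 10 by norm_num)
  by_cases hu : u ∈ S
  · rw [back_ite_pos E (by rw [e2, L.sep u hu]; exact one_ne_zero), back_coin_ite]
    have e4 := hI.qubitOf_eval h1 (show 4 < 10 by norm_num)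
    have e6 := hI.qubitOf_eval h1 (show 6 < 10 by norm_num)
    simp only [Prog.back, Gate.pull,
      Kernel.atQubit_qubit _ _ (L.sep_loc u hu) (e4.trans (L.posA u (L.sep_loc u hu))),
      Kernel.atQubit_qubit _ _ (L.cop_dev u hu) (e6.trans (L.posC u hu)),
      back_zGate E true _ _ _ _ (L.cop_dev u hu) (e6.trans (L.posC u hu)),
      phaseGate_pi_div_two, Matrix.diagonal_mul_diagonal, Kernel.one_diagonal, Kernel.diag,
      L.emb_loc, L.emb_cop _ hu, sPhase_mul_star]
    rw [hO _ h0.1, hO _ h1.1, Memory.set_ne M' (by norm_num), Memory.set_ne M' (by norm_num), h14,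
      linearFactor, if_pos hu]
    ring
  · rw [back_ite_neg E (by rw [e2, L.not_sep u hu]), Prog.back, hO _ hM'.1, h14,
      linearFactor, if_neg hu, one_mul]

/-- The multiplier of a random quadratic phase. -/
def quadraticFactor (S : Finset (Fin n)) (u v : Fin n) (w w' : Logical n) : ℂ :=
  if u ∈ S ∧ v ∈ S ∧ u ≠ v then
    (1 + czPhase (w.1 u) (w.1 v) * star (czPhase (w'.1 u) (w'.1 v)) *
      (czPhase (w.2 u) (w.2 v) * star (czPhase (w'.2 u) (w'.2 v)))) / 2
  else 1

/-- Each unordered pair is visited twice with independent coins. This is harmless, because a factor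
`(1 + phase) / 2` with phase `±1` is `0` or `1`. -/
lemma Layout.Has.quadraticPhases {I : Memory → Prop} (hI : Stable M₀ 12 I)
    {O : Memory → Kernel (Qubit m)} {F : (ℕ → ℕ → ℕ) → Logical n → Logical n → ℂ}
    (hO : L.Has I O F) :
    L.Has I (quadraticPhases.back E O) fun A w w' =>
      (∏ u, ∏ v, quadraticFactor S u v w w') * F A w w' := by
  refine Layout.Has.loop_mul hI _ (fun u O F hO M hM w w' => ?_) hO
  have hI' := hI.counter (u := u) le_rfl
  have hO' : L.Has (withCounter I 12 u) O F := fun M hM => hO M hM.1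
  have h14 : (M.set 12 0 0 u) 14 = M 14 := Memory.set_ne _ (by norm_num) _ _ _
  rw [← h14]
  refine Layout.Has.loop_mul hI' _ (fun v O F hO M hM w w' => ?_) hO' _
    (hI.set_counter le_rfl hM) w w'
  beta_reduce
  have hM' := hI'.set_counter (u := v) le_rfl hM
  have hI'' := hI'.counter (u := v) le_rfl
  set M' := M.set 13 0 0 v with hM'def
  have h14 : M' 14 = M 14 := Memory.set_ne _ (by norm_num) _ _ _
  have h0 := hI''.set M' 15 0 0 0 (by norm_num) hM'
  have h1 := hI''.set M' 15 0 0 1 (by norm_num) hM'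
  have e2 := hI.qubitOf_eval hM'.1 (show 2 < 10 by norm_num)
  have f2 := hI'.qubitOf_eval hM' (show 2 < 10 by norm_num)
  by_cases hu : u ∈ S
  · by_cases hv : v ∈ S
    · rw [back_ite_pos E (by simp [Expr.eval, e2, f2, L.sep u hu, L.sep v hv]), back_coin_ite]
      have e4 := (hI.qubitOf_eval h1.1 (show 4 < 10 by norm_num)).trans (L.posA u (L.sep_loc u hu))
      have e6 := (hI.qubitOf_eval h1.1 (show 6 < 10 by norm_num)).trans (L.posC u hu)
      have f4 := (hI'.qubitOf_eval h1 (show 4 < 10 by norm_num)).trans (L.posA v (L.sep_loc v hv))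
      have f6 := (hI'.qubitOf_eval h1 (show 6 < 10 by norm_num)).trans (L.posC v hv)
      simp only [Prog.back, Gate.pull]
      -- For equal vertices the `CZ` gates do nothing, and both outcomes of the coin give the same
      -- form.
      by_cases huv : u = v
      · subst huv
        simp only [e4, f4, e6, f6, Kernel.atPair_self]
        rw [hO _ h0.1, hO _ h1.1, Memory.set_ne M' (by norm_num), Memory.set_ne M' (by norm_num),
          h14, quadraticFactor, if_neg (by simp)]
        ring
      · simp only [Kernel.atPair_qubit czPhase (L.loc_inj.ne huv) (L.sep_loc u hu) (L.sep_loc v hv)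
          e4 f4, Kernel.atPair_qubit czPhase (fun h => huv (L.cop_inj u hu v hv h)) (L.cop_dev u hu)
          (L.cop_dev v hv) e6 f6, Kernel.diag, L.emb_loc, L.emb_cop _ hu, L.emb_cop _ hv]
        rw [hO _ h0.1, hO _ h1.1, Memory.set_ne M' (by norm_num), Memory.set_ne M' (by norm_num),
          h14, quadraticFactor, if_pos ⟨hu, hv, huv⟩]
        ring
    · rw [back_ite_neg E (by simp [Expr.eval, e2, f2, L.sep u hu, L.not_sep v hv]), Prog.back,
        hO _ hM'.1, h14, quadraticFactor, if_neg (by tauto), one_mul]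
  · rw [back_ite_neg E (by
      by_cases hv : v ∈ S
      · simp [Expr.eval, e2, f2, L.not_sep u hu, L.sep v hv]
      · simp [Expr.eval, e2, f2, L.not_sep u hu, L.not_sep v hv]), Prog.back, hO _ hM'.1,
      h14, quadraticFactor, if_neg (by tauto), one_mul]

open Classical in
/-- The phase of the rotations for the ordered pair of vertices `(u, v)`. -/
def Layout.costFactor (L : Layout p m G S M₀) (γ : ℝ) (u v : Fin n) (w : Logical n) : ℂ :=
  if G.Adj u v then
    (if u < v ∧ (L.loc u).1 = (L.loc v).1 then zzPhase γ (w.1 u) (w.1 v) else 1) *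
      (if (L.loc u).1 = true ∧ v ∈ S then zzPhase γ (w.1 u) (w.2 v) else 1)
  else 1

/-- The program never asks where a vertex lives: a rotation addressed to an absent qubit is void, so
in every case exactly the rotations whose two ends share a device survive. Rotations with copies are
attempted for both orders of an edge, since either end may be the one in the separator. -/
lemma Layout.Has.costGates {I : Memory → Prop} (hI : Stable M₀ 12 I) (l : Fin p)
    (hl : ∀ M, I M → M 11 0 0 = l) {O : Memory → Kernel (Qubit m)}
    {F : (ℕ → ℕ → ℕ) → Logical n → Logical n → ℂ} (hO : L.Has I O F) :
    L.Has I (costGates.back E O) fun A w w' =>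
      (∏ u, ∏ v, L.costFactor (E.γ l) u v w * star (L.costFactor (E.γ l) u v w')) *
        F A w w' := by
  refine Layout.Has.loop_mul hI
    (fun u w w' => ∏ v, L.costFactor (E.γ l) u v w * star (L.costFactor (E.γ l) u v w'))
    (fun u O F hO M hM w w' => ?_) hO
  have hI' := hI.counter (u := u) le_rfl
  have hO' : L.Has (withCounter I 12 u) O F := fun M hM => hO M hM.1
  have h14 : (M.set 12 0 0 u) 14 = M 14 := Memory.set_ne _ (by norm_num) _ _ _
  rw [← h14]
  refine Layout.Has.loop_mul hI'
    (fun v w w' => L.costFactor (E.γ l) u v w * star (L.costFactor (E.γ l) u v w'))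
    (fun v O F hO M hM w w' => ?_) hO' _
    (hI.set_counter le_rfl hM) w w'
  beta_reduce
  have hM' := hI'.set_counter (u := v) le_rfl hM
  set M' := M.set 13 0 0 v with hM'def
  have h14 : M' 14 = M 14 := Memory.set_ne _ (by norm_num) _ _ _
  have hu0 : M' 12 0 0 = u := hM'.1.2
  have hv0 : M' 13 0 0 = v := hM'.2
  have h1 : M' 1 = M₀ 1 := hI.static M' hM'.1.1 1 (by norm_num)
  have hl0 : M' 11 0 0 = l := hl _ hM'.1.1
  have hpull : ∀ d q q' (K : Kernel (Qubit m)), Gate.pull E M' d (.rzz q q' (cell 11 0)) K =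
      K.atPair (zzPhase (E.γ l)) d (q.eval M') (q'.eval M') := by
    intro d q q' K
    simp only [Gate.pull, cell_eval, hl0, dif_pos l.2, Fin.eta]
  have e1 : (Expr.get 1 (cell 12 0) (cell 13 0)).eval M' = M₀ 1 u v := by
    simp only [Expr.eval, cell_eval, hu0, hv0, h1]
  by_cases hadj : G.Adj u v
  · have huv : u ≠ v := hadj.ne
    rw [back_ite_pos E (by rw [e1]; exact (L.adj u v).mpr hadj), Prog.back, Layout.costFactor,
      Layout.costFactor, if_pos hadj, if_pos hadj]
    set K₁ := (O M').atPair (zzPhase (E.γ l)) true (M₀ 5 u 0) (M₀ 6 v 0) with hK₁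
    have hC : K₁ (L.emb w) (L.emb w') =
        (if (L.loc u).1 = true ∧ v ∈ S then zzPhase (E.γ l) (w.1 u) (w.2 v) else 1) *
        star (if (L.loc u).1 = true ∧ v ∈ S then zzPhase (E.γ l) (w'.1 u) (w'.2 v) else 1) *
        F (M 14) w w' := by
      rw [← h14, ← hO M' hM'.1]
      by_cases h : (L.loc u).1 = true ∧ v ∈ S
      · rw [hK₁, Kernel.atPair_qubit _ (L.cop_ne_loc v h.2 u).symm h.1 (L.cop_dev v h.2)
          (L.posB u h.1) (L.posC v h.2)]
        simp only [Kernel.diag, L.emb_loc, L.emb_cop _ h.2, if_pos h]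
      · rw [hK₁, Kernel.atPair_of_le]
        · simp [h]
        · by_cases hv : v ∈ S
          · exact Or.inl (L.posB' u (by simpa [hv] using h))
          · exact Or.inr (L.posC' v hv)
    have hK : (Prog.gate true (.rzz (qubitOf 5 12) (qubitOf 6 13) (cell 11 0))).back E O M' =
        K₁ := by
      simp only [Prog.back, hpull, hI.qubitOf_eval hM'.1 (show 5 < 10 by norm_num),
        hI'.qubitOf_eval hM' (show 6 < 10 by norm_num), hK₁]
    have e0 : (Expr.lt (cell 12 0) (cell 13 0)).eval M' = if u < v then 1 else 0 := by
      simp only [Expr.eval, cell_eval, hu0, hv0, Fin.val_fin_lt]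
    by_cases hlt : u < v
    · rw [back_ite_pos E (by simp [e0, hlt]), Prog.back, Prog.back, Prog.back]
      beta_reduce
      rw [hpull, hpull, hK,
        hI.qubitOf_eval hM'.1 (show 4 < 10 by norm_num),
        hI.qubitOf_eval hM'.1 (show 5 < 10 by norm_num),
        hI'.qubitOf_eval hM' (show 4 < 10 by norm_num),
        hI'.qubitOf_eval hM' (show 5 < 10 by norm_num)]
      -- If the ends are on different devices, neither of the two direct rotations acts, and only
      -- the one with the copy can remain.
      cases hu : (L.loc u).1 <;> cases hv : (L.loc v).1
      · rw [Kernel.atPair_of_le _ true (Or.inl (L.posB' u hu)),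
          Kernel.atPair_qubit _ (L.loc_inj.ne huv) hu hv (L.posA u hu) (L.posA v hv)]
        simp only [Kernel.diag, L.emb_loc, hC, hu, hlt]
        simp
      · rw [Kernel.atPair_of_le _ true (Or.inl (L.posB' u hu)),
          Kernel.atPair_of_le _ false (Or.inr (L.posA' v hv)), hC]
        simp [hu]
      · rw [Kernel.atPair_of_le _ true (Or.inr (L.posB' v hv)),
          Kernel.atPair_of_le _ false (Or.inl (L.posA' u hu)), hC]
        simp [hu]
      · rw [Kernel.atPair_of_le _ false (Or.inl (L.posA' u hu)),
          Kernel.atPair_qubit _ (L.loc_inj.ne huv) hu hv (L.posB u hu) (L.posB v hv)]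
        have hvS : v ∉ S := fun h => by simpa [hv] using L.sep_loc v h
        simp only [Kernel.diag, L.emb_loc, hC, hu, hlt]
        simp [hvS]
    · rw [back_ite_neg E (by simp [e0, hlt]), Prog.back, hK, hC]
      simp [hlt]
  · rw [back_ite_neg E (by rw [e1]; exact not_not.mp fun h => hadj ((L.adj u v).mp h)), Prog.back,
      hO _ hM'.1, h14, Layout.costFactor, Layout.costFactor, if_neg hadj, if_neg hadj]
    simp

end

/-! ### Closing the copies -/

section

variable {m n p : ℕ} {G : SimpleGraph (Fin n)} {S : Finset (Fin n)} {M₀ : Memory}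
  {L : Layout p m G S M₀} {E : Env n p}

lemma Layout.emb_congr (L : Layout p m G S M₀) {w w' : Logical n} (h : w.1 = w'.1)
    (h' : ∀ u ∈ S, w.2 u = w'.2 u) : L.emb w = L.emb w' :=
  L.emb_ext (fun v => by rw [L.emb_loc, L.emb_loc, h])
    (fun u hu => by rw [L.emb_cop _ hu, L.emb_cop _ hu, h' u hu])
    fun i hi hi' => by rw [L.emb_of_ne _ hi hi', L.emb_of_ne _ hi hi']

/-- The basis state with all copies in the state `0`. -/
def Logical.ofBits (x : Fin n → Bool) : Logical n := (x, fun _ => false)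

/-- Backward reasoning about a loop over the vertices. -/
lemma Layout.loop_rule (L : Layout p m G S M₀) {I : Memory → Prop} {k : ℕ} (hI : Stable M₀ k I)
    {a : ℕ} {c : Prog} (Q : ℕ → (Memory → Kernel (Qubit m)) → Prop)
    (R : Memory → Kernel (Qubit m) → Prop) {O : Memory → Kernel (Qubit m)}
    (fin : ∀ O', Q 0 O' → ∀ M, I M → R M (O' M))
    (step : ∀ k < n, ∀ O, Q (k + 1) O → Q k fun M => c.back E O (M.set a 0 0 k)) (hO : Q n O) :
    ∀ M, I M → R M ((Prog.loop a (cell 0 0) c).back E O M) := by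
  intro M hM
  have : (cell 0 0).eval M = n := by
    rw [cell_eval, hI.static M hM 0 (by norm_num), L.size]
  simp only [Prog.back, this]
  exact fin _ (loopSem_desc a (c.back E) Q n step O hO) M hM

lemma back_had_seq (d : Bool) (q : Expr) (c : Prog) (O : Memory → Kernel (Qubit m)) (M : Memory) :
    (Prog.seq (.gate d (.had q)) c).back E O M =
      (c.back E O M).atQubit hadamardGate d (q.eval M) := rfl

/-- The multiplier of closing a copy. -/
def evenFactor (S : Finset (Fin n)) (u : Fin n) (w w' : Logical n) : ℂ :=
  if u ∈ S then (1 + zSign (w.2 u) * zSign (w'.2 u) * (zSign (w.1 u) * zSign (w'.1 u))) / 2 else 1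

/-- Summing over the outcome `b` of the Hadamard-basis measurement gives `(1/2) ∑_b (-1)^(b (y +
y'))`, and the correction by `Z` inserts `(-1)^(b (x + x'))`. The result is the indicator of even
parity at every vertex of `S`. Afterwards the copies are `0`, so the form is needed only on states
of the shape `Logical.ofBits`. -/
lemma Layout.back_closeCopies {I : Memory → Prop} (hI : Stable M₀ 12 I)
    {O : Memory → Kernel (Qubit m)} {F : (ℕ → ℕ → ℕ) → Kernel (Fin n)}
    (hO : ∀ M, I M → ∀ x x', O M (L.emb (.ofBits x)) (L.emb (.ofBits x')) = F (M 14) x x') :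
    L.Has I (closeCopies.back E O) fun A w w' => (∏ u, evenFactor S u w w') * F A w.1 w'.1 := by
  -- The invariant for iteration `k` is restricted to states whose copies below `k` are `0`, since
  -- earlier iterations have reset them. At `k = 0` this restriction is empty, and at `k = n` it
  -- reduces to the hypothesis on `O`.
  refine L.loop_rule hI (fun k O => ∀ M, I M → ∀ w w' : Logical n,
    (∀ v ∈ S, (v : ℕ) < k → w.2 v = false ∧ w'.2 v = false) → O M (L.emb w) (L.emb w') =
    (∏ u : Fin n, if k ≤ (u : ℕ) then evenFactor S u w w' else 1) * F (M 14) w.1 w'.1)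
    (fun M K => ∀ w w', K (L.emb w) (L.emb w') =
      (∏ u, evenFactor S u w w') * F (M 14) w.1 w'.1) ?_ ?_ ?_
  · intro O key M hM w w'
    rw [key M hM w w' (fun v _ hv => absurd hv (Nat.not_lt_zero _))]
    simp
  · intro k hk O hO M hM w w' hw
    beta_reduce
    have hM' := hI.set_counter (u := k) le_rfl hM
    have hI' := hI.counter (u := k) le_rfl
    set M' := M.set 12 0 0 k with hM'def
    have h14 : M' 14 = M 14 := Memory.set_ne _ (by norm_num) _ _ _
    have h0 := hI'.set M' 15 0 0 0 (by norm_num) hM'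
    have h1 := hI'.set M' 15 0 0 1 (by norm_num) hM'
    have e2 := hI.qubitOf_eval hM' (show 2 < 10 by norm_num)
    rw [prod_from_succ k hk]
    by_cases hu : (⟨k, hk⟩ : Fin n) ∈ S
    · set u : Fin n := ⟨k, hk⟩ with hudef
      have e6 := (hI.qubitOf_eval hM' (show 6 < 10 by norm_num)).trans (L.posC u hu)
      have f4 := (hI.qubitOf_eval h1 (show 4 < 10 by norm_num)).trans (L.posA u (L.sep_loc u hu))
      have f6 := (hI.qubitOf_eval h1 (show 6 < 10 by norm_num)).trans (L.posC u hu)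
      rw [back_ite_pos E (by rw [e2, L.sep u hu]; exact one_ne_zero), back_had_seq,
        Kernel.atQubit_qubit _ _ (L.cop_dev u hu) e6, Kernel.one]
      set w₀ : Logical n := (w.1, Function.update w.2 u false) with hw₀
      set w₀' : Logical n := (w'.1, Function.update w'.2 u false) with hw₀'
      have hval : ∀ M, I M → O M (L.emb w₀) (L.emb w₀') =
          (∏ v : Fin n, if k + 1 ≤ (v : ℕ) then evenFactor S v w w' else 1) *
            F (M 14) w.1 w'.1 := by
        intro M hM
        rw [hO M hM]
        · congr 1
          refine Finset.prod_congr rfl fun v _ => ?_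
          split_ifs with hv
          · have : v ≠ u := fun h => by rw [h, hudef] at hv; simp at hv
            simp only [evenFactor, hw₀, hw₀', Function.update_of_ne this]
          · rfl
        · intro v hv hvk
          by_cases h : v = u
          · subst h; simp [hw₀, hw₀']
          · have : (v : ℕ) ≠ k := fun h' => h (Fin.ext h')
            simpa [hw₀, hw₀', Function.update_of_ne h] using hw v hv (by omega)
      have hterm : ∀ b b' : Bool, (Prog.seq (.measure true (qubitOf 6 12) 15 (.const 0) (.const 0))
          (.ite (cell 15 0) (.seq (zGate false (qubitOf 4 12)) (xGate true (qubitOf 6 12)))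
            .skip)).back E O M' (L.emb (w.1, Function.update w.2 u b))
              (L.emb (w'.1, Function.update w'.2 u b')) =
          if b = b' then (if b = true then zSign (w.1 u) * zSign (w'.1 u) else 1) *
            ((∏ v : Fin n, if k + 1 ≤ (v : ℕ) then evenFactor S v w w' else 1) *
            F (M 14) w.1 w'.1) else 0 := by
        intro b b'
        rw [back_measure_ite E _ _ _ _ _ (L.cop_dev u hu) e6, L.emb_cop _ hu, L.emb_cop _ hu]
        simp only [Function.update_self]
        by_cases hb : b = b'
        · subst hb
          cases b
          · simp only [if_true, Bool.false_eq_true, if_false, one_mul, Prog.back]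
            rw [hval _ h0.1, Memory.set_ne M' (by norm_num), h14]
          · simp only [if_true, Prog.back]
            rw [back_zGate E false _ _ _ _ (L.sep_loc u hu) f4, Matrix.diagonal_mul_diagonal,
              Kernel.one_diagonal, Kernel.diag, L.emb_loc, L.emb_loc, sPhase_mul_star,
              back_xGate E true _ _ _ _ (L.cop_dev u hu) f6, L.emb_cop _ hu, L.emb_cop _ hu,
              L.update_cop _ hu, L.update_cop _ hu]
            simp only [Function.update_self, Function.update_idem, Bool.not_true]
            rw [hval _ h1.1, Memory.set_ne M' (by norm_num), h14]
        · simp [hb]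
      rw [mul_assoc, show evenFactor S u w w' = _ from if_pos hu]
      generalize (∏ v : Fin n, if k + 1 ≤ (v : ℕ) then evenFactor S v w w' else 1) *
            F (M 14) w.1 w'.1 = R at hterm ⊢
      simp only [L.emb_cop _ hu, L.update_cop _ hu, hterm, Fintype.sum_bool, hadamardGate]
      have hs := inv_sqrt_two_mul_self
      have hstar : star (((Real.sqrt 2)⁻¹ : ℝ) : ℂ) = (((Real.sqrt 2)⁻¹ : ℝ) : ℂ) :=
        Complex.conj_ofReal _
      simp only [star_mul', hstar]
      generalize (((Real.sqrt 2)⁻¹ : ℝ) : ℂ) = r at hs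
      generalize zSign (w.1 u) * zSign (w'.1 u) = g
      cases w.2 u <;> cases w'.2 u <;> simp [zSign]
      · linear_combination (R + g * R) * hs
      · linear_combination (R - g * R) * hs
      · linear_combination (R - g * R) * hs
      · linear_combination (R + g * R) * hs
    · rw [back_ite_neg E (by rw [e2]; exact L.not_sep _ hu), Prog.back, hO _ hM'.1, h14, evenFactor,
        if_neg hu, one_mul]
      intro v hv hvk
      refine hw v hv ?_
      have : (v : ℕ) ≠ k := fun h' => hu (by rwa [← show v = ⟨k, hk⟩ from Fin.ext h'])
      omega
  · intro M hM w w' hw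
    rw [prod_from_last, one_mul, ← hO M hM,
      L.emb_congr (w := w) (w' := .ofBits w.1) rfl fun u hu => (hw u hu u.2).1,
      L.emb_congr (w := w') (w' := .ofBits w'.1) rfl fun u hu => (hw u hu u.2).2]

end

/-! ### Measuring the separator, and opening the copies -/

section

variable {m n p : ℕ} {G : SimpleGraph (Fin n)} {S : Finset (Fin n)} {M₀ : Memory}
  {L : Layout p m G S M₀} {E : Env n p}

/-- The multiplier of measuring a separator vertex and its copy. -/
def measuredFactor (S : Finset (Fin n)) (u : Fin n) (w w' : Logical n) : ℂ :=
  if u ∈ S then if w.1 u = w'.1 u ∧ w.2 u = w'.2 u then 1 else 0 else 1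

/-- The same, when the outcomes agree. -/
def agreeFactor (S : Finset (Fin n)) (u : Fin n) (w w' : Logical n) : ℂ :=
  if u ∈ S then if (w.1 u = w'.1 u ∧ w.2 u = w'.2 u) ∧ w.1 u = w.2 u then 1 else 0 else 1

lemma sampleSign_flip (A : ℕ → ℕ → ℕ) (A' : ℕ → ℕ → ℕ) (h : A' 1 0 = A 1 0)
    (h' : A' 0 0 = 1 - A 0 0) : sampleSign A' = -sampleSign A := by
  simp only [sampleSign, h, h']
  by_cases h1 : A 1 0 = 0 <;> by_cases h2 : A 0 0 = 0 <;> simp [h1, h2]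
  omega

/-- The sign flip contributes minus the fully dephased form. Discarding the samples with equal
outcomes removes their share, which amounts to adding the form of equal outcomes back. -/
lemma Layout.Has.dephase {I : Memory → Prop} (hI : Stable M₀ 12 I)
    {O : Memory → Kernel (Qubit m)} {g : Logical n → Logical n → ℂ}
    (hO : L.Has I O fun A w w' => sampleSign A * g w w') :
    L.Has I (dephase.back E O) fun A w w' =>
      sampleSign A * ((-(∏ u, measuredFactor S u w w') + ∏ u, agreeFactor S u w w') * g w w') := by
  have hend : ∀ M, I M → ∀ w w',
      (Prog.seq (.ite (cell 16 0) .skip (.assign 14 (.const 1) (.const 0) (.const 1)))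
        (.assign 14 (.const 0) (.const 0) (.sub (.const 1) (cell 14 0)))).back E O M
          (L.emb w) (L.emb w') =
      sampleSign (M 14) * ((-1 + if M 16 0 0 = 0 then 1 else 0) * g w w') := by
    intro M hM w w'
    rw [Prog.back]
    by_cases hf : M 16 0 0 = 0
    · rw [back_ite_neg E (e := cell 16 0) (M := M) hf]
      simp only [Prog.back, Expr.eval]
      rw [hO _ (hI.set _ _ _ _ _ (by norm_num) (hI.set _ _ _ _ _ (by norm_num) hM))]
      simp [hf, sampleSign, Memory.set]
    · rw [back_ite_pos E (e := cell 16 0) (M := M) hf]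
      simp only [Prog.back, Expr.eval, cell_eval]
      rw [hO _ (hI.set _ _ _ _ _ (by norm_num) hM)]
      beta_reduce
      rw [sampleSign_flip (M 14) (Memory.set M 14 0 0 (1 - M 14 0 0) 14) (by simp [Memory.set])
        (by simp [Memory.set])]
      simp [hf]
  have hloop : ∀ M, I M → ∀ w w', Prog.back E (.loop 12 (cell 0 0) (.ite (qubitOf 2 12)
        (.seq (.measure false (qubitOf 4 12) 15 (.const 0) (.const 0))
          (.seq (.measure true (qubitOf 6 12) 15 (.const 1) (.const 0))
            (.assign 16 (.const 0) (.const 0)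
              (.add (cell 16 0)
                (.add (.lt (cell 15 0) (cell 15 1)) (.lt (cell 15 1) (cell 15 0)))))))
        .skip))
        (Prog.back E (Prog.seq
        (.ite (cell 16 0) .skip (.assign 14 (.const 1) (.const 0) (.const 1)))
        (.assign 14 (.const 0) (.const 0) (.sub (.const 1) (cell 14 0)))) O) M
          (L.emb w) (L.emb w') =
      sampleSign (M 14) * ((-(∏ u, measuredFactor S u w w') +
        if M 16 0 0 = 0 then ∏ u, agreeFactor S u w w' else 0) * g w w') := by
    -- Array `16` counts disagreements. Once it is nonzero the outcomes can no longer all agree, and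
    -- the second product drops out.
    refine L.loop_rule hI (fun k O => ∀ M, I M → ∀ w w' : Logical n, O M (L.emb w) (L.emb w') =
      sampleSign (M 14) * ((-(∏ u : Fin n, if k ≤ (u : ℕ) then measuredFactor S u w w' else 1) +
        if M 16 0 0 = 0 then ∏ u : Fin n, if k ≤ (u : ℕ) then agreeFactor S u w w' else 1 else 0) *
        g w w'))
      (fun M K => ∀ w w', K (L.emb w) (L.emb w') =
      sampleSign (M 14) * ((-(∏ u, measuredFactor S u w w') +
        if M 16 0 0 = 0 then ∏ u, agreeFactor S u w w' else 0) * g w w')) ?_ ?_ ?_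
    · intro O key M hM w w'
      rw [key M hM w w']
      simp
    · intro k hk O hO M hM w w'
      beta_reduce
      have hM' := hI.set_counter (u := k) le_rfl hM
      have hI' := hI.counter (u := k) le_rfl
      set M' := M.set 12 0 0 k with hM'def
      have h14 : M' 14 = M 14 := Memory.set_ne _ (by norm_num) _ _ _
      have h16 : M' 16 = M 16 := Memory.set_ne _ (by norm_num) _ _ _
      have e2 := hI.qubitOf_eval hM' (show 2 < 10 by norm_num)
      rw [prod_from_succ k hk, prod_from_succ k hk]
      by_cases hu : (⟨k, hk⟩ : Fin n) ∈ S
      · set u : Fin n := ⟨k, hk⟩ with hudef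
        have e4 := (hI.qubitOf_eval hM' (show 4 < 10 by norm_num)).trans
          (L.posA u (L.sep_loc u hu))
        have h1 := hI'.set M' 15 0 0 (w.1 u).toNat (by norm_num) hM'
        have f6 := (hI.qubitOf_eval h1 (show 6 < 10 by norm_num)).trans (L.posC u hu)
        rw [back_ite_pos E (by rw [e2, L.sep u hu]; exact one_ne_zero)]
        simp only [Prog.back]
        rw [measureSem_qubit _ (L.sep_loc u hu) e4, L.emb_loc, L.emb_loc]
        simp only [Expr.eval]
        rw [measureSem_qubit _ (L.cop_dev u hu) f6, L.emb_cop _ hu, L.emb_cop _ hu]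
        rw [hO _ (hI.set _ _ _ _ _ (by norm_num) (hI.set _ _ _ _ _ (by norm_num) h1.1))]
        simp only [measuredFactor, agreeFactor, if_pos hu]
        generalize (∏ u : Fin n, if k + 1 ≤ (u : ℕ) then measuredFactor S u w w' else 1) = A
        generalize (∏ u : Fin n, if k + 1 ≤ (u : ℕ) then agreeFactor S u w w' else 1) = B
        simp only [cell_eval, Memory.set_ne _ (show 14 ≠ 16 by norm_num),
          Memory.set_ne _ (show 14 ≠ 15 by norm_num), Memory.set_ne _ (show 16 ≠ 15 by norm_num),
          Memory.set_self, h14, h16]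
        have hx : ((M'.set 15 0 0 (w.1 u).toNat).set 15 1 0 (w.2 u).toNat) 15 0 0 =
            (w.1 u).toNat := by simp [Memory.set]
        rw [hx]
        by_cases hf : M 16 0 0 = 0 <;> cases w.1 u <;> cases w'.1 u <;> cases w.2 u <;>
          cases w'.2 u <;> simp [hf]
      · rw [back_ite_neg E (by rw [e2]; exact L.not_sep _ hu), Prog.back, hO _ hM'.1, h14, h16,
          measuredFactor, if_neg hu, agreeFactor, if_neg hu, one_mul, one_mul]
    · intro M hM w w'
      rw [prod_from_last, prod_from_last]
      exact hend M hM w w'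
  intro M hM w w'
  have := hloop (M.set 16 0 0 0) (hI.set _ _ _ _ _ (by norm_num) hM) w w'
  rw [Memory.set_self, if_pos rfl, Memory.set_ne M (show 14 ≠ 16 by norm_num)] at this
  exact this

/-- The multiplier that forces a copy to agree with the original. -/
def copyFactor (S : Finset (Fin n)) (u : Fin n) (w w' : Logical n) : ℂ :=
  if u ∈ S then if w.1 u = w.2 u ∧ w'.1 u = w'.2 u then 1 else 0 else 1

/-- From copies in `0`, the Hadamards reach each pair of values `y`, `y'` with amplitude `2^(-1/2)`
in the ket and in the bra for every vertex of `S`. Since `copyFactor` selects the single pair `y =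
x`, `y' = x'`, only the weight `2^(-|S|)` remains. -/
lemma Layout.back_openCopies {I : Memory → Prop} (hI : Stable M₀ 12 I)
    {O : Memory → Kernel (Qubit m)} {F : (ℕ → ℕ → ℕ) → Kernel (Fin n)}
    (hO : L.Has I O fun A w w' => (∏ u, copyFactor S u w w') * F A w.1 w'.1) :
    ∀ M, I M → ∀ x x', openCopies.back E O M (L.emb (.ofBits x)) (L.emb (.ofBits x')) =
      (1 / 2) ^ S.card * F (M 14) x x' := by
  set had : Fin n → Logical n → Logical n → ℂ := fun u w w' =>
    if u ∈ S then hadamardGate (w.1 u) (w.2 u) * star (hadamardGate (w'.1 u) (w'.2 u)) else 1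
    with hhad
  refine L.loop_rule hI (fun k O => ∀ M, I M → ∀ w w' : Logical n, O M (L.emb w) (L.emb w') =
      (∏ u : Fin n, if k ≤ (u : ℕ) then had u w w' else copyFactor S u w w') * F (M 14) w.1 w'.1)
    (fun M K => ∀ x x', K (L.emb (.ofBits x)) (L.emb (.ofBits x')) =
      (1 / 2) ^ S.card * F (M 14) x x') ?_ ?_ ?_
  · intro O key M hM x x'
    rw [key M hM]
    congr 1
    have : ∀ u : Fin n, (if 0 ≤ (u : ℕ) then had u (.ofBits x) (.ofBits x') else
        copyFactor S u (.ofBits x) (.ofBits x')) = if u ∈ S then 1 / 2 else 1 := by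
      intro u
      rw [if_pos (Nat.zero_le _)]
      by_cases hu : u ∈ S
      · have hstar : star (((Real.sqrt 2)⁻¹ : ℝ) : ℂ) = (((Real.sqrt 2)⁻¹ : ℝ) : ℂ) :=
          Complex.conj_ofReal _
        simp only [hhad, if_pos hu, hadamardGate, Logical.ofBits, Bool.and_false,
          Bool.false_eq_true, if_false, mul_one, hstar, inv_sqrt_two_mul_self]
      · simp [hhad, hu]
    simp only [this, Finset.prod_ite_mem, Finset.univ_inter, Finset.prod_const]
  · intro k hk O hO M hM w w'
    beta_reduce
    have hM' := hI.set_counter (u := k) le_rfl hM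
    set M' := M.set 12 0 0 k with hM'def
    have h14 : M' 14 = M 14 := Memory.set_ne _ (by norm_num) _ _ _
    have e6 := hI.qubitOf_eval hM' (show 6 < 10 by norm_num)
    set u : Fin n := ⟨k, hk⟩ with hudef
    have hne : ∀ v ∈ Finset.univ.erase u, (k ≤ (v : ℕ) ↔ k + 1 ≤ (v : ℕ)) := by
      intro v hv
      have : (v : ℕ) ≠ k := fun h => (Finset.ne_of_mem_erase hv) (Fin.ext h)
      omega
    have hsplit : ∀ w w', (∏ v : Fin n, if k + 1 ≤ (v : ℕ) then had v w w' else
        copyFactor S v w w') = copyFactor S u w w' *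
        ∏ v ∈ Finset.univ.erase u, if k + 1 ≤ (v : ℕ) then had v w w' else copyFactor S v w w' := by
      intro w w'
      rw [← Finset.mul_prod_erase _ _ (Finset.mem_univ u)]
      congr 1
      exact if_neg (by simp [hudef])
    rw [← Finset.mul_prod_erase _ _ (Finset.mem_univ u), if_pos (by simp [hudef]),
      Finset.prod_congr rfl fun v hv => if_congr (hne v hv) rfl rfl]
    simp only [Prog.back, Gate.pull]
    by_cases hu : u ∈ S
    · rw [Kernel.atQubit_qubit _ _ (L.cop_dev u hu) (e6.trans (L.posC u hu)), Kernel.one]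
      simp only [L.emb_cop _ hu, L.update_cop _ hu, hO _ hM'.1, h14, hsplit]
      have hrest : ∀ b b', (∏ v ∈ Finset.univ.erase u, if k + 1 ≤ (v : ℕ) then
          had v (w.1, Function.update w.2 u b) (w'.1, Function.update w'.2 u b') else
          copyFactor S v (w.1, Function.update w.2 u b) (w'.1, Function.update w'.2 u b')) =
          ∏ v ∈ Finset.univ.erase u, if k + 1 ≤ (v : ℕ) then had v w w' else
            copyFactor S v w w' := by
        intro b b'
        refine Finset.prod_congr rfl fun v hv => ?_
        have := Finset.ne_of_mem_erase hv
        simp only [hhad, copyFactor, Function.update_of_ne this]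
      simp only [hrest]
      have h1 : had u w w' = hadamardGate (w.1 u) (w.2 u) * star (hadamardGate (w'.1 u) (w'.2 u)) :=
        if_pos hu
      rw [h1]
      generalize (∏ v ∈ Finset.univ.erase u, if k + 1 ≤ (v : ℕ) then had v w w' else
            copyFactor S v w w') = R
      simp only [copyFactor, if_pos hu, Function.update_self, Fintype.sum_bool]
      cases w.1 u <;> cases w'.1 u <;> simp <;> ring
    · rw [Kernel.atQubit_of_le _ (by rw [e6]; exact L.posC' u hu), hO _ hM'.1, h14, hsplit]
      simp [hhad, copyFactor, hu]
  · intro M hM w w'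
    rw [hO M hM w w']
    beta_reduce
    congr 1
    refine Finset.prod_congr rfl fun u _ => (if_neg ?_).symm
    exact not_le.mpr u.2

end

/-! ### The copying identity -/

section

variable {m n p : ℕ} {G : SimpleGraph (Fin n)} {S : Finset (Fin n)} {M₀ : Memory}
  {L : Layout p m G S M₀} {E : Env n p}

/-- The phases, the measurements and the closing of the copies together copy the separator. -/
lemma copy_identity (S : Finset (Fin n)) (w w' : Logical n) :
    (∏ u, evenFactor S u w w') *
      ((∏ u, linearFactor S u w w') * (∏ u, ∏ v, quadraticFactor S u v w w') +
        (-(∏ u, measuredFactor S u w w') + ∏ u, agreeFactor S u w w')) =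
      ∏ u, copyFactor S u w w' := by
  -- Diagonal entries: all phases and the full measurement give `1` and cancel, and for such entries
  -- agreement of the outcomes is the copy condition.
  by_cases h1 : ∀ u ∈ S, w.1 u = w'.1 u ∧ w.2 u = w'.2 u
  · have hE : ∏ u, evenFactor S u w w' = 1 := Finset.prod_eq_one fun u _ => by
      unfold evenFactor
      split_ifs with hu
      · rw [(h1 u hu).1, (h1 u hu).2]
        cases w'.1 u <;> cases w'.2 u <;> simp [zSign]
      · rfl
    have hl : ∏ u, linearFactor S u w w' = 1 := Finset.prod_eq_one fun u _ => by
      unfold linearFactor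
      split_ifs with hu
      · rw [(h1 u hu).1, (h1 u hu).2]
        cases w'.1 u <;> cases w'.2 u <;> simp [zSign, sPhase]
      · rfl
    have hq : ∏ u, ∏ v, quadraticFactor S u v w w' = 1 :=
      Finset.prod_eq_one fun u _ => Finset.prod_eq_one fun v _ => by
        unfold quadraticFactor
        split_ifs with hu
        · rw [(h1 u hu.1).1, (h1 u hu.1).2, (h1 v hu.2.1).1, (h1 v hu.2.1).2]
          cases w'.1 u <;> cases w'.2 u <;> cases w'.1 v <;> cases w'.2 v <;> simp [czPhase]
        · rfl
    have hm : ∏ u, measuredFactor S u w w' = 1 := Finset.prod_eq_one fun u _ => by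
      unfold measuredFactor
      split_ifs with hu h
      · rfl
      · exact absurd (h1 u hu) h
      · rfl
    have ha : ∏ u, agreeFactor S u w w' = ∏ u, copyFactor S u w w' :=
      Finset.prod_congr rfl fun u _ => by
        unfold agreeFactor copyFactor
        split_ifs with hu h h' h'
        · rfl
        · exact absurd ⟨h.2, (h1 u hu).1 ▸ (h1 u hu).2 ▸ h.2⟩ h'
        · exact absurd ⟨h1 u hu, h'.1⟩ h
        · rfl
        · rfl
    rw [hE, hl, hq, hm, ha]
    ring
  · push Not at h1
    obtain ⟨u, hu, h1⟩ := h1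
    have hm : ∏ u, measuredFactor S u w w' = 0 := Finset.prod_eq_zero (Finset.mem_univ u) (by
      rw [measuredFactor, if_pos hu, if_neg (fun h => h1 h.1 h.2)])
    have ha : ∏ u, agreeFactor S u w w' = 0 := Finset.prod_eq_zero (Finset.mem_univ u) (by
      rw [agreeFactor, if_pos hu, if_neg (fun h => h1 h.1.1 h.1.2)])
    rw [hm, ha, neg_zero, add_zero, add_zero]
    -- Copy entries: every phase on the originals is cancelled by the one on the copies, so all
    -- multipliers are `1`.
    by_cases h2 : ∀ u ∈ S, w.1 u = w.2 u ∧ w'.1 u = w'.2 u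
    · have hE : ∏ u, evenFactor S u w w' = 1 := Finset.prod_eq_one fun u _ => by
        unfold evenFactor
        split_ifs with hu
        · rw [(h2 u hu).1, (h2 u hu).2]
          cases w.2 u <;> cases w'.2 u <;> simp [zSign]
        · rfl
      have hl : ∏ u, linearFactor S u w w' = 1 := Finset.prod_eq_one fun u _ => by
        unfold linearFactor
        split_ifs with hu
        · rw [(h2 u hu).1, (h2 u hu).2]
          cases w.2 u <;> cases w'.2 u <;> simp [zSign, sPhase]
        · rfl
      have hq : ∏ u, ∏ v, quadraticFactor S u v w w' = 1 :=
        Finset.prod_eq_one fun u _ => Finset.prod_eq_one fun v _ => by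
          unfold quadraticFactor
          split_ifs with hu
          · rw [(h2 u hu.1).1, (h2 u hu.1).2, (h2 v hu.2.1).1, (h2 v hu.2.1).2]
            cases w'.2 u <;> cases w.2 u <;> cases w'.2 v <;> cases w.2 v <;> simp [czPhase]
          · rfl
      have hc : ∏ u, copyFactor S u w w' = 1 := Finset.prod_eq_one fun u _ => by
        unfold copyFactor
        split_ifs with hu h
        · rfl
        · exact absurd (h2 u hu) h
        · rfl
      rw [hE, hl, hq, hc]
      ring
    · push Not at h2
      obtain ⟨v, hv, h2⟩ := h2
      have hc : ∏ u, copyFactor S u w w' = 0 := Finset.prod_eq_zero (Finset.mem_univ v) (by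
        rw [copyFactor, if_pos hv, if_neg (fun h => h2 h.1 h.2)])
      rw [hc, ← mul_assoc]
      -- At one vertex, even parity leaves the diagonal, copy and swap patterns. In a proper swap
      -- `(x - x') - (y - y') = ±2`, so the linear phase is `-1` and its factor vanishes.
      have hlocal : ∀ u ∈ S, evenFactor S u w w' * linearFactor S u w w' ≠ 0 →
          (w.1 u = w'.1 u ∧ w.2 u = w'.2 u) ∨ (w.1 u = w.2 u ∧ w'.1 u = w'.2 u) := by
        intro u hu
        rw [evenFactor, linearFactor, if_pos hu, if_pos hu]
        cases w.1 u <;> cases w'.1 u <;> cases w.2 u <;> cases w'.2 u <;> simp [zSign, sPhase]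
      by_cases hz : evenFactor S u w w' * linearFactor S u w w' = 0 ∨
          evenFactor S v w w' * linearFactor S v w w' = 0
      · rw [← Finset.prod_mul_distrib]
        rcases hz with hz | hz
        · rw [Finset.prod_eq_zero (Finset.mem_univ u) hz, zero_mul]
        · rw [Finset.prod_eq_zero (Finset.mem_univ v) hz, zero_mul]
      · push Not at hz
        have hu' := hlocal u hu hz.1
        have hv' := hlocal v hv hz.2
        rw [show ∏ u, ∏ v, quadraticFactor S u v w w' = 0 from
          Finset.prod_eq_zero (Finset.mem_univ u) (Finset.prod_eq_zero (Finset.mem_univ v) ?_),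
          mul_zero]
        have huv : u ≠ v := by
          rintro rfl
          rcases hu' with h | h
          · exact h1 h.1 h.2
          · exact h2 h.1 h.2
        -- Here `u` is a copy vertex that is not diagonal and `v` a diagonal vertex that is not
        -- copy. The exponent of the `CZ` phases is `(x_u - x'_u)(x_v + y_v)`, which is odd because
        -- `x_u ≠ x'_u` and `x_v ≠ y_v`, so the factor vanishes.
        rw [quadraticFactor, if_pos ⟨hu, hv, huv⟩]
        revert h1 h2 hu' hv'
        cases w.1 u <;> cases w'.1 u <;> cases w.2 u <;> cases w'.2 u <;>
        cases w.1 v <;> cases w'.1 v <;> cases w.2 v <;> cases w'.2 v <;> simp [czPhase]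

/-- The parity factor is produced by closing the copies, after the cost gates, and is already
present in `O` because those gates are diagonal. Since `copy_identity` kills all other entries, `h`
has to equal `g` only where the copies agree with the originals. The coin adds one factor `1/2` to
the `2^(-|S|)` of the opening. -/
lemma Layout.back_copySeparator {I : Memory → Prop} (hI : Stable M₀ 12 I)
    {O : Memory → Kernel (Qubit m)} {h : Logical n → Logical n → ℂ} {g : Kernel (Fin n)}
    (hh : ∀ w w', (∀ u ∈ S, w.1 u = w.2 u) → (∀ u ∈ S, w'.1 u = w'.2 u) → h w w' = g w.1 w'.1)
    (hO : L.Has I O fun A w w' => sampleSign A * ((∏ u, evenFactor S u w w') * h w w')) :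
    ∀ M, I M → ∀ x x', copySeparator.back E O M (L.emb (.ofBits x)) (L.emb (.ofBits x')) =
      sampleSign (M 14) * ((1 / 2) ^ (S.card + 1) * g x x') := by
  have key : L.Has I (Prog.back E (.seq (.coin 15 (.const 0) (.const 0))
      (.ite (cell 15 0) dephase (.seq linearPhases quadraticPhases))) O) fun A w w' =>
      (∏ u, copyFactor S u w w') * (sampleSign A * (1 / 2 * g w.1 w'.1)) := by
    intro M hM w w'
    rw [back_coin_ite, Prog.back,
      (hO.quadraticPhases hI).linearPhases hI _ (hI.set _ _ _ _ _ (by norm_num) hM),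
      hO.dephase hI _ (hI.set _ _ _ _ _ (by norm_num) hM)]
    simp only [Memory.set_ne _ (show 14 ≠ 15 by norm_num)]
    have hc := copy_identity S w w'
    -- Where the copies disagree, the identity makes both sides zero whatever `h` is; elsewhere `h`
    -- may be replaced by `g`.
    by_cases hz : ∏ u, copyFactor S u w w' = 0
    · rw [hz] at hc ⊢
      linear_combination (sampleSign (M 14) * h w w' / 2) * hc
    · have hz' : ∀ u ∈ S, w.1 u = w.2 u ∧ w'.1 u = w'.2 u := by
        intro u hu
        by_contra hne
        exact hz (Finset.prod_eq_zero (Finset.mem_univ u) (by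
          rw [copyFactor, if_pos hu, if_neg hne]))
      rw [hh w w' (fun u hu => (hz' u hu).1) fun u hu => (hz' u hu).2]
      linear_combination (sampleSign (M 14) * g w.1 w'.1 / 2) * hc
  intro M hM x x'
  rw [show copySeparator.back E O M = openCopies.back E _ M from rfl,
    Layout.back_openCopies (F := fun A x x' => sampleSign A * (1 / 2 * g x x')) hI key M hM x x']
  ring

/-! ## The layers of the circuit -/

open Classical in
/-- The diagonal of the cost unitary. -/
def costPhase (G : SimpleGraph (Fin n)) (γ : ℝ) (x : Fin n → Bool) : ℂ :=
  ∏ i : Fin n, ∏ j : Fin n, if i < j ∧ G.Adj i j then zzPhase γ (x i) (x j) else 1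

/-- The cost operator is diagonal, so its exponential is entrywise, and the exponential of the sum
over edges is a product of two-qubit phases. -/
lemma costUnitary_mulVec (G : SimpleGraph (Fin n)) (γ : ℝ) (ψ : QVec n) :
    costUnitary G γ *ᵥ ψ = fun x => costPhase G γ x * ψ x := by
  classical
  have h1 : (-(Complex.I * γ)) • costOperator G = Matrix.diagonal fun x =>
      ∑ i : Fin n, ∑ j : Fin n, if i < j ∧ G.Adj i j then
        -(Complex.I * γ) * (zSign (x i) * zSign (x j)) else 0 := by
    ext x y
    simp only [costOperator, Matrix.smul_apply, Matrix.sum_apply, pauliZ,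
      Matrix.diagonal_mul_diagonal, smul_eq_mul, Finset.mul_sum, Matrix.diagonal_apply]
    by_cases h : x = y
    · rw [if_pos h]
      refine Finset.sum_congr rfl fun i _ => Finset.sum_congr rfl fun j _ => ?_
      split_ifs <;> simp [h]
    · rw [if_neg h]
      refine Finset.sum_eq_zero fun i _ => Finset.sum_eq_zero fun j _ => ?_
      split_ifs <;> simp [h]
  rw [costUnitary, h1, Matrix.exp_diagonal]
  funext x
  rw [Matrix.mulVec_diagonal, Pi.coe_exp, ← Complex.exp_eq_exp_ℂ, Complex.exp_sum, costPhase]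
  congr 1
  refine Finset.prod_congr rfl fun i _ => ?_
  rw [Complex.exp_sum]
  refine Finset.prod_congr rfl fun j _ => ?_
  split_ifs
  · rfl
  · exact Complex.exp_zero

/-- Pairing the two orders of each pair. -/
lemma prod_prod_eq_prod_lt (h : Fin n → Fin n → ℂ) (h0 : ∀ u, h u u = 1) :
    ∏ u, ∏ v, h u v = ∏ u, ∏ v, if u < v then h u v * h v u else 1 := by
  have h1 : ∀ u v, h u v = (if u < v then h u v else 1) * (if v < u then h u v else 1) := by
    intro u v
    rcases lt_trichotomy u v with hlt | rfl | hlt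
    · simp [hlt, hlt.not_gt]
    · simp [h0]
    · simp [hlt, hlt.not_gt]
  have h2 : ∀ u v, (if u < v then h u v * h v u else 1) =
      (if u < v then h u v else 1) * (if u < v then h v u else 1) := by
    intro u v; split_ifs <;> simp
  simp only [h2, Finset.prod_mul_distrib]
  rw [Finset.prod_congr rfl fun u _ => Finset.prod_congr rfl fun v _ => h1 u v]
  simp only [Finset.prod_mul_distrib]
  congr 1
  rw [Finset.prod_comm]

lemma zzPhase_comm (γ : ℝ) (a b : Bool) : zzPhase γ a b = zzPhase γ b a := by
  rw [zzPhase, zzPhase, mul_comm (zSign a)]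

/-- An edge inside one device is rotated once, for its increasing order. An edge across the devices
has its end on device 0 in `S` by `no_edge`, so it is rotated once through the copy, for the order
that starts on device 1. No other rotation with a copy occurs, because `S` lives on device 0. -/
lemma Layout.prod_costFactor (L : Layout p m G S M₀) (γ : ℝ) (w : Logical n)
    (hw : ∀ u ∈ S, w.1 u = w.2 u) : ∏ u, ∏ v, L.costFactor γ u v w = costPhase G γ w.1 := by
  classical
  rw [prod_prod_eq_prod_lt _ fun u => by simp [Layout.costFactor], costPhase]
  refine Finset.prod_congr rfl fun u _ => Finset.prod_congr rfl fun v _ => ?_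
  by_cases hlt : u < v
  · by_cases hadj : G.Adj u v
    · have hadj' := hadj.symm
      simp only [Layout.costFactor, hlt, hadj, hadj', hlt.not_gt, true_and, if_true, false_and,
        if_false, one_mul]
      cases hu : (L.loc u).1 <;> cases hv : (L.loc v).1
      · simp
      · have huS : u ∈ S := by
          by_contra h
          exact L.no_edge v u hv hu h hadj'
        simp [huS, ← hw u huS, zzPhase_comm]
      · have hvS : v ∈ S := by
          by_contra h
          exact L.no_edge u v hu hv h hadj
        simp [hvS, ← hw v hvS]
      · have huS : u ∉ S := fun h => by simpa [hu] using L.sep_loc u h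
        have hvS : v ∉ S := fun h => by simpa [hv] using L.sep_loc v h
        simp [huS, hvS]
    · have hadj' : ¬ G.Adj v u := fun h => hadj h.symm
      simp [Layout.costFactor, hadj, hadj']
  · simp [hlt]

/-- `U` applied to the first `k` qubits. -/
def tensorUpTo (U : Matrix Bool Bool ℂ) (k : ℕ) (ψ : QVec n) : QVec n :=
  fun x => ∑ y, (∏ v : Fin n, if (v : ℕ) < k then U (x v) (y v) else
    if x v = y v then 1 else 0) * ψ y

lemma tensorUpTo_zero (U : Matrix Bool Bool ℂ) (ψ : QVec n) : tensorUpTo U 0 ψ = ψ := by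
  funext x
  simp only [tensorUpTo, Nat.not_lt_zero, if_false]
  rw [Finset.sum_eq_single x]
  · simp
  · intro y _ hy
    obtain ⟨v, hv⟩ := Function.ne_iff.mp hy
    rw [Finset.prod_eq_zero (Finset.mem_univ v) (if_neg (Ne.symm hv)), zero_mul]
  · simp

/-- This splits the tensor power into single-qubit gates, matching the iterations of a loop over the
vertices. -/
lemma tensorUpTo_succ (U : Matrix Bool Bool ℂ) (u : Fin n) (ψ : QVec n) :
    tensorUpTo U (u + 1) ψ = opOne U u (tensorUpTo U u ψ) := by
  funext x
  simp only [tensorUpTo, opOne, Finset.mul_sum]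
  rw [Finset.sum_comm]
  refine Finset.sum_congr rfl fun y _ => ?_
  have hrest : ∀ b, (∏ v : Fin n, if (v : ℕ) < u then U (Function.update x u b v) (y v) else
      if Function.update x u b v = y v then 1 else 0) = (if b = y u then 1 else 0) *
      ∏ v ∈ Finset.univ.erase u, if (v : ℕ) < u + 1 then U (x v) (y v) else
        if x v = y v then 1 else 0 := by
    intro b
    rw [← Finset.mul_prod_erase _ _ (Finset.mem_univ u)]
    congr 1
    · simp
    · refine Finset.prod_congr rfl fun v hv => ?_
      have hne := Finset.ne_of_mem_erase hv
      have : (v : ℕ) ≠ u := fun h => hne (Fin.ext h)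
      simp only [Function.update_of_ne hne]
      exact if_congr (by omega) rfl rfl
  simp only [hrest]
  rw [← Finset.mul_prod_erase _ _ (Finset.mem_univ u)]
  simp
  ring

lemma tensorUpTo_mixing (β : ℝ) (ψ : QVec n) :
    tensorUpTo (xRotation β) n ψ = mixingUnitary n β *ᵥ ψ := by
  funext x
  simp [tensorUpTo, Matrix.mulVec, dotProduct, mixingUnitary]

lemma tensorUpTo_hadamard :
    tensorUpTo hadamardGate n (fun y : Fin n → Bool => if y = fun _ => false then 1 else 0) =
      fun _ => ((((Real.sqrt 2)⁻¹ : ℝ) : ℂ)) ^ n := by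
  funext x
  simp [tensorUpTo, hadamardGate]

/-- A gate that is not diagonal mixes entries of the kernel, so the new form has no simple closed
expression. It suffices to know that some form exists on the logical states and what its pairing
with a given state is. -/
lemma Layout.loop_one {I : Memory → Prop} (hI : Stable M₀ 12 I) {c : Prog}
    (U : Matrix Bool Bool ℂ)
    (hc : ∀ (u : Fin n) (O : Memory → Kernel (Qubit m)) M, withCounter I 12 u M →
      c.back E O M = (O M).one U (L.loc u))
    {O : Memory → Kernel (Qubit m)} {o : Kernel (Fin n)}
    (hO : ∀ M, I M → ∀ x x', O M (L.emb (.ofBits x)) (L.emb (.ofBits x')) =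
      sampleSign (M 14) * o x x') (ψ : QVec n) :
    ∃ o' : Kernel (Fin n), (∀ M, I M → ∀ x x',
      (Prog.loop 12 (cell 0 0) c).back E O M (L.emb (.ofBits x)) (L.emb (.ofBits x')) =
        sampleSign (M 14) * o' x x') ∧ pairing o' ψ = pairing o (tensorUpTo U n ψ) := by
  have key := loopSem_desc 12 (c.back E) (fun k O => ∃ o' : Kernel (Fin n), (∀ M, I M → ∀ x x',
    O M (L.emb (.ofBits x)) (L.emb (.ofBits x')) = sampleSign (M 14) * o' x x') ∧
    pairing o' (tensorUpTo U k ψ) = pairing o (tensorUpTo U n ψ)) n ?_ O ⟨o, hO, rfl⟩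
  · obtain ⟨o', h1, h2⟩ := key
    rw [tensorUpTo_zero] at h2
    refine ⟨o', fun M hM => ?_, h2⟩
    have : (cell 0 0).eval M = n := by
      rw [cell_eval, hI.static M hM 0 (by norm_num), L.size]
    simp only [Prog.back, this]
    exact h1 M hM
  · rintro k hk O ⟨o', h1, h2⟩
    refine ⟨o'.one U ⟨k, hk⟩, fun M hM x x' => ?_, ?_⟩
    · have hM' := hI.set_counter (u := k) le_rfl hM
      beta_reduce
      rw [hc ⟨k, hk⟩ O _ hM', Kernel.one, Kernel.one]
      simp only [L.emb_loc, L.update_loc]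
      have h3 : ∀ x b, (Function.update (Logical.ofBits x).1 (⟨k, hk⟩ : Fin n) b,
          (Logical.ofBits x).2) = Logical.ofBits (Function.update x ⟨k, hk⟩ b) := fun _ _ => rfl
      simp only [h3, h1 _ hM'.1, Memory.set_ne _ (show 14 ≠ 12 by norm_num), Finset.mul_sum]
      refine Finset.sum_congr rfl fun b _ => Finset.sum_congr rfl fun b' _ => ?_
      simp only [Logical.ofBits]
      ring
    · rw [← h2, ← pairing_opOne, ← tensorUpTo_succ]

/-- Read backwards: mixing, closing, cost rotations, copying. All traces of the copies collapse into
the scalar `2^(-(|S|+1))`, and what is left is the exact QAOA layer on `n` qubits. -/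
lemma Layout.back_layer {I : Memory → Prop} (hI : Stable M₀ 12 I) (l : Fin p)
    (hl : ∀ M, I M → M 11 0 0 = l) {O : Memory → Kernel (Qubit m)} {o : Kernel (Fin n)}
    (hO : ∀ M, I M → ∀ x x', O M (L.emb (.ofBits x)) (L.emb (.ofBits x')) =
      sampleSign (M 14) * o x x') (ψ : QVec n) :
    ∃ o' : Kernel (Fin n), (∀ M, I M → ∀ x x',
      layer.back E O M (L.emb (.ofBits x)) (L.emb (.ofBits x')) = sampleSign (M 14) * o' x x') ∧
      pairing o' ψ = (1 / 2) ^ (S.card + 1) *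
        pairing o (mixingUnitary n (E.β l) *ᵥ (costUnitary G (E.γ l) *ᵥ ψ)) := by
  obtain ⟨o₁, h1, h1'⟩ := Layout.loop_one (E := E) hI (c := .seq
    (.gate false (.rx (qubitOf 4 12) (cell 11 0))) (.gate true (.rx (qubitOf 5 12) (cell 11 0))))
    (xRotation (E.β l)) (fun u O M hM => by
      simp only [Prog.back, Gate.pull, cell_eval, hl M hM.1, dif_pos l.2, Fin.eta,
        hI.qubitOf_eval hM (show 4 < 10 by norm_num), hI.qubitOf_eval hM (show 5 < 10 by norm_num)]
      exact L.atQubit_loc _ u _) hO (costUnitary G (E.γ l) *ᵥ ψ)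
  have h2 := Layout.back_closeCopies (E := E) (F := fun A x x' => sampleSign A * o₁ x x') hI h1
  have h3 := Layout.Has.costGates (E := E) hI l hl h2
  refine ⟨_, Layout.back_copySeparator (E := E) hI (h := fun w w' =>
    (∏ u, ∏ v, L.costFactor (E.γ l) u v w * star (L.costFactor (E.γ l) u v w')) * o₁ w.1 w'.1)
    (g := fun x x' =>
    costPhase G (E.γ l) x * star (costPhase G (E.γ l) x') * o₁ x x') ?_ ?_, ?_⟩
  · intro w w' hw hw'
    simp only [Finset.prod_mul_distrib, ← L.prod_costFactor _ w hw, ← L.prod_costFactor _ w' hw',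
      star_prod]
  · intro M hM w w'
    refine (h3 M hM w w').trans ?_
    ring
  · rw [pairing_smul, ← tensorUpTo_mixing, ← h1', costUnitary_mulVec, pairing_diag]
    rfl

end

/-! ### Read-out, reset, and the form of a whole run -/

section

variable {m n p : ℕ} {G : SimpleGraph (Fin n)} {S : Finset (Fin n)} {M₀ : Memory}
  {L : Layout p m G S M₀} {E : Env n p}

/-- The memory agrees with `M₀` on the arrays below `10`. -/
def Static (M₀ M : Memory) : Prop := ∀ a < 10, M a = M₀ a

lemma stable_static (M₀ : Memory) : Stable M₀ 10 (Static M₀) where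
  static _ hM := hM
  set M b i j v hb hM a ha := by rw [Memory.set_ne M (by omega), hM a ha]

/-- The bit string in column `0` of array `17`. -/
def outcome (n : ℕ) (M : Memory) : Fin n → Bool := fun i => decide (M 17 i 0 ≠ 0)

/-- The form that gives the expected signed value of `f`. -/
def signedValue (f : (Fin n → Bool) → ℝ) (M : Memory) : Kernel (Qubit m) :=
  fun z z' => if z = z' then ((sampleSign (M 14) * f (outcome n M) : ℝ) : ℂ) else 0

lemma back_measure_seq (d : Bool) (q : Expr) (a i j : ℕ) (c : Prog)
    (O : Memory → Kernel (Qubit m)) (M : Memory) :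
    (Prog.seq (.measure d q a (.const i) (.const j)) c).back E O M =
      measureSem d (q.eval M) a i j (c.back E O) M := rfl

/-- Each vertex is addressed on both devices. The device without it reports `0`, so the sum of the
two outcomes is the measured bit. -/
lemma Layout.back_readOut_body {I : Memory → Prop} {k : ℕ} (hI : Stable M₀ k I) (hk : k ≤ 12)
    (u : Fin n) (O : Memory → Kernel (Qubit m)) {M : Memory} (hM : withCounter I 12 u M)
    (z z' : Qubit m → Bool) :
    ∃ a b : ℕ, Prog.back E (.seq (.measure false (qubitOf 4 12) 15 (.const 0) (.const 0))
      (.seq (.measure true (qubitOf 5 12) 15 (.const 1) (.const 0))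
        (.assign 17 (cell 12 0) (.const 0) (.add (cell 15 0) (cell 15 1))))) O M z z' =
      if z (L.loc u) = z' (L.loc u) then
        O (((M.set 15 0 0 a).set 15 1 0 b).set 17 u 0 (z (L.loc u)).toNat) z z' else 0 := by
  have hI' := hI.counter (u := u) hk
  have e4 := hI.qubitOf_eval hM (show 4 < 10 by norm_num)
  have h5 : ∀ a, (qubitOf 5 12).eval (M.set 15 0 0 a) = M₀ 5 u 0 := fun a =>
    hI.qubitOf_eval (hI'.set M 15 0 0 a (by norm_num) hM) (show 5 < 10 by norm_num)
  have h17 : ∀ a b, Prog.back E (.assign 17 (cell 12 0) (.const 0) (.add (cell 15 0) (cell 15 1))) O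
      ((M.set 15 0 0 a).set 15 1 0 b) = O (((M.set 15 0 0 a).set 15 1 0 b).set 17 u 0 (a + b)) := by
    intro a b
    have h12 : M 12 0 0 = u := hM.2
    have h1 : ((M.set 15 0 0 a).set 15 1 0 b) 12 0 0 = u := by simp [Memory.set, h12]
    have h2 : ((M.set 15 0 0 a).set 15 1 0 b) 15 0 0 = a := by simp [Memory.set]
    have h3 : ((M.set 15 0 0 a).set 15 1 0 b) 15 1 0 = b := by simp [Memory.set]
    simp only [Prog.back, Expr.eval, cell_eval, h1, h2, h3]
  cases h : (L.loc u).1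
  · refine ⟨(z (L.loc u)).toNat, 0, ?_⟩
    rw [back_measure_seq, e4, measureSem_qubit _ h (L.posA u h)]
    congr 1
    rw [back_measure_seq, h5, measureSem_of_le (L.posB' u h), h17, add_zero]
  · refine ⟨0, (z (L.loc u)).toNat, ?_⟩
    rw [back_measure_seq, e4, measureSem_of_le (L.posA' u h), back_measure_seq, h5,
      measureSem_qubit _ h (L.posB u h)]
    congr 1
    rw [h17, zero_add]

lemma Layout.back_readOut (L : Layout p m G S M₀) {I : Memory → Prop} (hI : Stable M₀ 12 I)
    (f : (Fin n → Bool) → ℝ) :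
    ∀ M, I M → ∀ x x', readOut.back E (signedValue f) M (L.emb (.ofBits x)) (L.emb (.ofBits x')) =
      sampleSign (M 14) * (if x = x' then ((f x : ℝ) : ℂ) else 0) := by
  -- Before iteration `k`, the bits below `k` are already recorded in memory, and the others are
  -- still those of the basis state.
  refine L.loop_rule hI (fun k O => ∀ M, I M → ∀ x x',
      O M (L.emb (.ofBits x)) (L.emb (.ofBits x')) = sampleSign (M 14) * (if x = x' then
        ((f fun i => if (i : ℕ) < k then outcome n M i else x i : ℝ) : ℂ) else 0))
    (fun M K => ∀ x x', K (L.emb (.ofBits x)) (L.emb (.ofBits x')) =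
      sampleSign (M 14) * (if x = x' then ((f x : ℝ) : ℂ) else 0)) ?_ ?_ ?_
  · intro O h M hM x x'
    simpa using h M hM x x'
  · intro k hk O hO M hM x x'
    beta_reduce
    have hM' := hI.set_counter (u := k) le_rfl hM
    obtain ⟨a, b, hab⟩ := L.back_readOut_body (E := E) hI le_rfl ⟨k, hk⟩ O hM'
      (L.emb (.ofBits x)) (L.emb (.ofBits x'))
    rw [hab, L.emb_loc, L.emb_loc]
    set M' := (((M.set 12 0 0 k).set 15 0 0 a).set 15 1 0 b).set 17 k 0 (x ⟨k, hk⟩).toNat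
    have hM'' : I M' := hI.set _ _ _ _ _ (by norm_num) (hI.set _ _ _ _ _ (by norm_num)
      (hI.set _ _ _ _ _ (by norm_num) hM'.1))
    have h14 : M' 14 = M 14 := by
      simp only [M']
      rw [Memory.set_ne _ (by norm_num), Memory.set_ne _ (by norm_num),
        Memory.set_ne _ (by norm_num), Memory.set_ne _ (by norm_num)]
    have hout : (fun i : Fin n => if (i : ℕ) < k + 1 then outcome n M' i else x i) =
        fun i : Fin n => if (i : ℕ) < k then outcome n M i else x i := by
      funext i
      by_cases hi : (i : ℕ) = k
      · have : i = ⟨k, hk⟩ := Fin.ext hi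
        subst this
        simp only [Nat.lt_succ_self, if_true, lt_irrefl, if_false, outcome, M', Memory.set_self]
        cases x ⟨k, hk⟩ <;> rfl
      · have h1 : outcome n M' i = outcome n M i := by
          simp [outcome, M', Memory.set, hi]
        rw [h1]
        exact if_congr (by omega) rfl rfl
    have := hO M' hM'' x x'
    rw [h14, hout] at this
    by_cases hx : x = x'
    · rw [if_pos (show (Logical.ofBits x).1 _ = (Logical.ofBits x').1 _ by rw [hx])]
      exact this
    · rw [if_neg hx, mul_zero] at this ⊢
      split_ifs
      · exact this
      · rfl
  · intro M hM x x'
    have hiff : L.emb (.ofBits x) = L.emb (.ofBits x') ↔ x = x' := by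
      constructor
      · intro h
        funext v
        have := congrFun h (L.loc v)
        rwa [L.emb_loc, L.emb_loc] at this
      · rintro rfl; rfl
    simp only [signedValue, hiff, Fin.is_lt, if_true]
    split_ifs
    · push_cast; rfl
    · simp

/-- The state after the first `k` layers. -/
def partialState (G : SimpleGraph (Fin n)) (γ β : Fin p → ℝ) : ℕ → QVec n
  | 0 => fun _ => ((((Real.sqrt 2)⁻¹ : ℝ) : ℂ)) ^ n
  | k + 1 => if h : k < p then
      mixingUnitary n (β ⟨k, h⟩) *ᵥ (costUnitary G (γ ⟨k, h⟩) *ᵥ partialState G γ β k)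
    else partialState G γ β k

lemma partialState_last (G : SimpleGraph (Fin n)) (γ β : Fin p → ℝ) :
    partialState G γ β p = qaoaState G γ β := by
  have : ∀ k (hk : k ≤ p), Fin.foldl k (fun ψ l => mixingUnitary n (β (l.castLE hk)) *ᵥ
      (costUnitary G (γ (l.castLE hk)) *ᵥ ψ)) (fun _ => ((((Real.sqrt 2)⁻¹ : ℝ) : ℂ)) ^ n) =
      partialState G γ β k := by
    intro k
    induction k with
    | zero => intro hk; simp [partialState]
    | succ k ih =>
      intro hk
      rw [Fin.foldl_succ_last, partialState, dif_pos (by omega), ← ih (by omega)]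
      rfl
  exact (this p le_rfl).symm

lemma pairing_diagonal (f : (Fin n → Bool) → ℝ) (ψ : QVec n) :
    pairing (fun x x' => if x = x' then ((f x : ℝ) : ℂ) else 0) ψ = (expectation f ψ : ℂ) := by
  simp only [pairing, ite_mul, zero_mul, Finset.sum_ite_eq, Finset.mem_univ, if_true, expectation]
  push_cast
  refine Finset.sum_congr rfl fun x _ => ?_
  rw [← starRingEnd_apply, Complex.mul_conj, Complex.normSq_eq_norm_sq]
  push_cast; rfl

lemma pairing_single {ι : Type} [DecidableEq ι] [Fintype ι] (K : Kernel ι) (y : ι → Bool) :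
    pairing K (fun x => if x = y then 1 else 0) = K y y := by
  simp [pairing]

lemma Layout.emb_zero (L : Layout p m G S M₀) :
    L.emb (.ofBits fun _ => false) = fun _ => false := by
  funext i
  simp [Layout.emb, Logical.ofBits]

/-- The circuit after the reset, from the state `|0…0⟩`. -/
lemma Layout.back_layers (L : Layout p m G S M₀) (f : (Fin n → Bool) → ℝ) :
    ∀ M, Static M₀ M →
      Prog.back (m := m) E (.seq prepare (.seq (.loop 11 (cell 0 1) layer) readOut))
        (signedValue f) M (fun _ => false) (fun _ => false) = sampleSign (M 14) *
          ((1 / 2) ^ ((S.card + 1) * p) * (expectation f (qaoaState G E.γ E.β) : ℂ)) := by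
  have hS := stable_static M₀
  have hS12 := hS.mono (show 10 ≤ 12 by norm_num)
  -- Before layer `k` the form is paired with the exact state after `k` layers; the `p - k` layers
  -- still to come account for the scalar.
  have key := loopSem_desc 11 (layer.back E) (fun k O => ∃ o : Kernel (Fin n),
    (∀ M, Static M₀ M → ∀ x x', O M (L.emb (.ofBits x)) (L.emb (.ofBits x')) =
      sampleSign (M 14) * o x x') ∧ pairing o (partialState G E.γ E.β k) =
      (1 / 2) ^ ((S.card + 1) * (p - k)) * (expectation f (qaoaState G E.γ E.β) : ℂ)) p ?_
    (readOut.back E (signedValue f)) ⟨_, L.back_readOut hS12 f, ?_⟩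
  · obtain ⟨o, h1, h2⟩ := key
    have h1' : ∀ M, Static M₀ M → ∀ x x',
        Prog.back E (.seq (.loop 11 (cell 0 1) layer) readOut) (signedValue f) M
          (L.emb (.ofBits x)) (L.emb (.ofBits x')) = sampleSign (M 14) * o x x' := by
      intro M hM x x'
      have hp : (cell 0 1).eval M = p := by
        rw [cell_eval, hM 0 (by norm_num), L.depth]
      rw [← h1 M hM, Prog.back, Prog.back]
      beta_reduce
      rw [hp]
    obtain ⟨o', h3, h4⟩ := Layout.loop_one (E := E) hS12 hadamardGate
      (c := .seq (.gate false (.had (qubitOf 4 12))) (.gate true (.had (qubitOf 5 12))))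
      (fun u O M hM => by
        simp only [Prog.back, Gate.pull, hS12.qubitOf_eval hM (show 4 < 10 by norm_num),
          hS12.qubitOf_eval hM (show 5 < 10 by norm_num)]
        exact L.atQubit_loc _ u _) h1' (fun y => if y = fun _ => false then 1 else 0)
    intro M hM
    rw [tensorUpTo_hadamard, pairing_single] at h4
    have h5 := h3 M hM (fun _ => false) (fun _ => false)
    rw [L.emb_zero, h4, show (fun _ => ((((Real.sqrt 2)⁻¹ : ℝ) : ℂ)) ^ n) =
      partialState G E.γ E.β 0 from rfl, h2, Nat.sub_zero] at h5
    exact h5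
  · rintro k hk O ⟨o, h1, h2⟩
    have hI := hS.counter (a := 11) (u := k) (by norm_num)
    obtain ⟨o', h3, h4⟩ := Layout.back_layer (E := E) (o := o) hI ⟨k, hk⟩ (fun M hM => hM.2)
      (fun M hM => h1 M hM.1) (partialState G E.γ E.β k)
    refine ⟨o', fun M hM x x' => ?_, ?_⟩
    · have := h3 _ (hS.set_counter (by norm_num) hM) x x'
      rwa [Memory.set_ne _ (show 14 ≠ 11 by norm_num)] at this
    · rw [partialState, dif_pos hk] at h2
      rw [h4, h2, ← mul_assoc, ← pow_add]
      congr 2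
      have : p - k = (p - (k + 1)) + 1 := by omega
      rw [this]; ring
  · rw [partialState_last, pairing_diagonal]
    simp

lemma back_resetQubit (d : Bool) (q : Expr) (O : Memory → Kernel (Qubit m)) (M : Memory)
    (i : Qubit m) (hd : i.1 = d) (hq : q.eval M = i.2) (hq' : ∀ v, q.eval (M.set 15 0 0 v) = i.2)
    (z z' : Qubit m → Bool) :
    ∃ v, (resetQubit d q).back E O M z z' = if z i = z' i then
      O (M.set 15 0 0 v) (Function.update z i false) (Function.update z' i false) else 0 := by
  refine ⟨(z i).toNat, ?_⟩
  rw [resetQubit, back_measure_ite E _ _ _ _ i hd hq]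
  by_cases h : z i = z' i
  · rw [if_pos h, if_pos h]
    cases hz : z i
    · rw [if_neg (by simp), Prog.back, ← hz, Function.update_eq_self, h, Function.update_eq_self]
      simp [← h, hz]
    · rw [if_pos rfl, back_xGate E d q O _ i hd (hq' 1), ← h, hz]
      rfl
  · rw [if_neg h, if_neg h]

lemma back_resetQubit_of_le (d : Bool) (q : Expr) (O : Memory → Kernel (Qubit m)) (M : Memory)
    (hq : m ≤ q.eval M) (z z' : Qubit m → Bool) :
    (resetQubit d q).back E O M z z' = O (M.set 15 0 0 0) z z' := by
  have h0 : (cell 15 0).eval (M.set 15 0 0 0) = 0 := Memory.set_self _ _ _ _ _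
  rw [show (resetQubit d q).back E O M = measureSem d (q.eval M) 15 0 0
    ((Prog.ite (cell 15 0) (xGate d q) .skip).back E O) M from rfl, measureSem_of_le hq,
    back_ite_neg E h0, Prog.back]

/-- Resetting all qubits. -/
lemma Layout.back_resetAll (L : Layout p m G S M₀) (hmn : m ≤ n) {O : Memory → Kernel (Qubit m)}
    {c : ℂ} (hO : ∀ M, Static M₀ M → O M (fun _ => false) (fun _ => false) = c) :
    ∀ M, Static M₀ M → ∀ z z', resetAll.back E O M z z' = if z = z' then c else 0 := by
  have hS := stable_static M₀
  -- Before iteration `k`, the qubits below `k` of both devices are `0`. The loop has `n ≥ m`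
  -- iterations, so at its end all qubits are; the surplus iterations address no qubit. In the other
  -- direction, each measurement removes the entries that are off-diagonal in its qubit.
  refine L.loop_rule hS (fun k O => ∀ M, Static M₀ M → ∀ z z' : Qubit m → Bool,
      (∀ i : Qubit m, (i.2 : ℕ) < k → z i = false ∧ z' i = false) →
      O M z z' = if z = z' then c else 0)
    (fun M K => ∀ z z', K z z' = if z = z' then c else 0) ?_ ?_ ?_
  · exact fun O h M hM z z' => h M hM z z' fun i hi => absurd hi (Nat.not_lt_zero _)
  · intro k hk O hO M hM z z' hz
    have hM' := hS.set_counter (a := 12) (u := k) (by norm_num) hM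
    have hev : ∀ M, withCounter (Static M₀) 12 k M → (cell 12 0).eval M = k := fun M hM => hM.2
    have hset : ∀ M v, withCounter (Static M₀) 12 k M →
        withCounter (Static M₀) 12 k (M.set 15 0 0 v) := fun M v hM =>
      (hS.counter (a := 12) (u := k) (by norm_num)).set M 15 0 0 v (by norm_num) hM
    beta_reduce
    set M' := M.set 12 0 0 k
    rw [Prog.back]
    by_cases hkm : k < m
    · obtain ⟨v, hv⟩ := back_resetQubit (E := E) false (cell 12 0)
        ((resetQubit true (cell 12 0)).back E O) M' (false, ⟨k, hkm⟩) rfl (hev _ hM')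
        (fun v => hev _ (hset _ v hM')) z z'
      obtain ⟨v', hv'⟩ := back_resetQubit (E := E) true (cell 12 0) O (M'.set 15 0 0 v)
        (true, ⟨k, hkm⟩) rfl (hev _ (hset _ v hM')) (fun v' => hev _ (hset _ v' (hset _ v hM')))
        (Function.update z (false, ⟨k, hkm⟩) false) (Function.update z' (false, ⟨k, hkm⟩) false)
      rw [hv, hv', hO _ (hset _ _ (hset _ _ hM')).1]
      · by_cases hzz : z = z'
        · subst hzz; simp
        · rw [if_neg hzz]
          split_ifs with h1 h2 h3
          · refine absurd ?_ hzz
            funext i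
            by_cases hi : i = (false, ⟨k, hkm⟩)
            · rw [hi, h1]
            by_cases hi' : i = (true, ⟨k, hkm⟩)
            · rw [hi']
              simpa using h2
            · have := congrFun h3 i
              simpa [hi, hi'] using this
          · rfl
          · rfl
          · rfl
      · intro i hi
        by_cases h1 : i = (true, ⟨k, hkm⟩)
        · subst h1; simp
        rw [Function.update_of_ne h1, Function.update_of_ne h1]
        by_cases h2 : i = (false, ⟨k, hkm⟩)
        · subst h2; simp
        rw [Function.update_of_ne h2, Function.update_of_ne h2]
        refine hz i ?_
        have : (i.2 : ℕ) ≠ k := by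
          intro h
          have h3 : i.2 = ⟨k, hkm⟩ := Fin.ext h
          rcases i with ⟨d, q⟩
          cases d
          · exact h2 (by simp at h3; rw [h3])
          · exact h1 (by simp at h3; rw [h3])
        omega
    · rw [back_resetQubit_of_le _ _ _ _ (by rw [hev _ hM']; omega),
        back_resetQubit_of_le _ _ _ _ (by rw [hev _ (hset _ _ hM')]; omega),
        hO _ (hset _ _ (hset _ _ hM')).1]
      intro i _
      exact hz i (by have := i.2.2; omega)
  · intro M hM z z' hz
    have h1 : z = fun _ => false := funext fun i => (hz i (by have := i.2.2; omega)).1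
    have h2 : z' = fun _ => false := funext fun i => (hz i (by have := i.2.2; omega)).2
    rw [h1, h2, hO M hM, if_pos rfl]

/-- The initial reset makes the form a multiple of the squared norm. Hence the conditional mean of a
run does not depend on what earlier runs left on the devices or in the scratch arrays, which
replaces independence of the samples. -/
theorem Layout.back_circuit (L : Layout p m G S M₀) (hmn : m ≤ n) (f : (Fin n → Bool) → ℝ)
    {M : Memory} (hM : Static M₀ M) :
    circuit.back (m := m) E (signedValue f) M = fun z z' => if z = z' then
      (((1 / 2) ^ ((S.card + 1) * p) * expectation f (qaoaState G E.γ E.β) : ℝ) : ℂ) else 0 := by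
  funext z z'
  refine L.back_resetAll hmn (fun M hM => ?_) M hM z z'
  have hS := stable_static M₀
  have h := L.back_layers (E := E) f ((M.set 14 0 0 0).set 14 1 0 0)
    (hS.set _ _ _ _ _ (by norm_num) (hS.set _ _ _ _ _ (by norm_num) hM))
  have h1 : sampleSign (((M.set 14 0 0 0).set 14 1 0 0) 14) = 1 := by
    simp [sampleSign, Memory.set]
  rw [h1, Complex.ofReal_one, one_mul] at h
  push_cast
  exact h

end

/-! ### Moments of the samples, and Chebyshev's inequality -/

section

variable {m n p : ℕ} {G : SimpleGraph (Fin n)} {S : Finset (Fin n)} {M₀ : Memory} {E : Env n p}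

lemma abs_sampleSign_le (A : ℕ → ℕ → ℕ) : |sampleSign A| ≤ 1 := by
  unfold sampleSign
  split_ifs <;> simp

lemma exec_accumulate (E : Env n p) (s : Config m) :
    ∃ s', accumulate.exec E s = [s'] ∧ s'.mem = s.mem ∧ s'.prob = s.prob ∧
      s'.reg 0 = s.reg 0 + sampleSign (s.mem 14) * E.f (outcome n s.mem) := by
  simp only [accumulate, Prog.exec, cell_eval, Config.tick, List.flatMap_cons, List.flatMap_nil,
    List.append_nil, sampleSign,
    show (fun i : Fin n => decide (s.mem 17 i 0 ≠ 0)) = outcome n s.mem from rfl]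
  by_cases h1 : s.mem 14 1 0 = 0
  · by_cases h2 : s.mem 14 0 0 = 0
    · simp only [h1, h2, ne_eq, not_true_eq_false, if_false]
      exact ⟨_, rfl, rfl, rfl, by simp⟩
    · simp only [h1, h2, ne_eq, not_true_eq_false, not_false_eq_true, if_false, if_true]
      exact ⟨_, rfl, rfl, rfl, by simp [sub_eq_add_neg]⟩
  · simp only [h1, ne_eq, not_false_eq_true, if_true]
    exact ⟨_, rfl, rfl, rfl, by simp⟩

lemma sum_sample (g : Config m → ℝ) (h : ℝ → ℝ)
    (hg : ∀ s : Config m, g s = s.prob * h (s.reg 0)) (s : Config m) :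
    ((sample.exec E s).map g).sum = ((circuit.exec E s).map fun s' => s'.prob *
      h (s.reg 0 + sampleSign (s'.mem 14) * E.f (outcome n s'.mem))).sum := by
  rw [sample, Prog.exec, sum_flatMap]
  congr 1
  refine List.map_congr_left fun s' hs' => ?_
  obtain ⟨t, h1, -, h3, h4⟩ := exec_accumulate E s'
  rw [h1, List.map_singleton, List.sum_singleton, hg, h3, h4,
    exec_reg E circuit (by decide) s s' hs']

lemma list_sum_map_mul {α : Type} (L : List α) (P Y : α → ℝ) (a b : ℝ) :
    (L.map fun s => P s * (a + b * Y s)).sum =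
      a * (L.map P).sum + b * (L.map fun s => Y s * P s).sum := by
  induction L with
  | nil => simp
  | cons x L ih => simp only [List.map_cons, List.sum_cons, ih]; ring

/-- One sample has the mean `μ`, and it increases the second moment about the mean by at most
`1`. -/
lemma sum_sample_le (L : Layout p m G S M₀) (hmn : m ≤ n) (hf : ∀ x, |E.f x| ≤ 1)
    {s : Config m} (hM : Static M₀ s.mem) (hs : 0 ≤ s.weight) (c μ : ℝ)
    (hμ : μ = (1 / 2) ^ ((S.card + 1) * p) * expectation E.f (qaoaState G E.γ E.β)) :
    ((sample.exec E s).map fun s' => s'.prob * (s'.reg 0 - (c + μ)) ^ 2).sum ≤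
      s.prob * ((s.reg 0 - c) ^ 2 + 1) := by
  rw [sum_sample _ (fun r => (r - (c + μ)) ^ 2) (fun _ => rfl)]
  set Y : Config m → ℝ := fun s' => sampleSign (s'.mem 14) * E.f (outcome n s'.mem) with hY
  have hmean : ((circuit.exec E s).map fun s' => Y s' * s'.prob).sum = μ * s.prob := by
    have h := sum_exec_value E circuit (signedValue (m := m) E.f) s
    rw [show s.value (circuit.back E (signedValue E.f)) =
      s.value (fun M z z' => if z = z' then ((μ : ℝ) : ℂ) else 0) by
        rw [Config.value, Config.value, L.back_circuit hmn E.f hM, hμ],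
      s.value_id (fun _ => μ)] at h
    apply Complex.ofReal_injective
    rw [← h, ofReal_list_sum, List.map_map]
    congr 1
    refine List.map_congr_left fun s' _ => ?_
    exact (s'.value_id fun M => sampleSign (M 14) * E.f (outcome n M)).symm
  have hb : ∀ s', Y s' ^ 2 ≤ 1 := fun s' => by
    rw [← sq_abs, hY, abs_mul]
    have := mul_le_one₀ (abs_sampleSign_le (s'.mem 14)) (abs_nonneg _) (hf (outcome n s'.mem))
    exact pow_le_one₀ (by positivity) this
  -- With `d = s.reg 0 - c`, the square `(d - μ + Y)²` is bounded using `Y² ≤ 1` by an expression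
  -- linear in `Y`. Its mean is `(d - μ)² + 1 + 2 (d - μ) μ = d² - μ² + 1`, at most `d² + 1`.
  calc _ ≤ ((circuit.exec E s).map fun s' => s'.prob *
        (((s.reg 0 - c - μ) ^ 2 + 1) + 2 * (s.reg 0 - c - μ) * Y s')).sum := by
        refine List.sum_le_sum fun s' hs' => ?_
        refine mul_le_mul_of_nonneg_left ?_ (s'.prob_nonneg (weight_nonneg E circuit s hs s' hs'))
        nlinarith [hb s']
    _ ≤ _ := by
        rw [list_sum_map_mul, hmean, sum_exec_prob]
        nlinarith [mul_nonneg (sq_nonneg μ) (s.prob_nonneg hs)]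

lemma sample_wellBounded : sample.wellBounded 10 := by decide

/-- The second moment of the sum of the samples about its mean. -/
lemma sum_samples_le (L : Layout p m G S M₀) (hmn : m ≤ n) (hf : ∀ x, |E.f x| ≤ 1)
    {s : Config m} (hM : Static M₀ s.mem) (hs : 0 ≤ s.weight) (h0 : s.reg 0 = 0) (μ : ℝ)
    (hμ : μ = (1 / 2) ^ ((S.card + 1) * p) * expectation E.f (qaoaState G E.γ E.β)) (k : ℕ) :
    (∀ s' ∈ loopBranches E 10 sample s k, Static M₀ s'.mem ∧ 0 ≤ s'.weight) ∧
    ((loopBranches E 10 sample s k).map Config.prob).sum = s.prob ∧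
    ((loopBranches E 10 sample s k).map fun s' => s'.prob * (s'.reg 0 - k * μ) ^ 2).sum ≤
      k * s.prob := by
  induction k with
  | zero => simp [loopBranches, Config.tick, hM, hs, h0, Config.prob]
  | succ k ih =>
    obtain ⟨h1, h2, h3⟩ := ih
    have hst : ∀ s' ∈ loopBranches E 10 sample s k, Static M₀ (s'.mem.set 10 0 0 k) :=
      fun s' hs' => (stable_static M₀).set _ _ _ _ _ le_rfl (h1 s' hs').1
    refine ⟨fun s' hs' => ?_, ?_, ?_⟩
    · simp only [loopBranches, List.mem_flatMap] at hs'
      obtain ⟨t, ht, hs'⟩ := hs'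
      refine ⟨fun a ha => ?_, weight_nonneg E sample _ ?_ s' hs'⟩
      · rw [(exec_time_le E sample sample_wellBounded _ s' hs').1 a ha]
        exact hst t ht a ha
      · exact (h1 t ht).2
    · rw [loopBranches, sum_flatMap, ← h2]
      congr 1
      refine List.map_congr_left fun t _ => ?_
      rw [sum_exec_prob]; rfl
    · rw [loopBranches, sum_flatMap]
      have : (((k + 1 : ℕ) : ℝ)) * μ = k * μ + μ := by push_cast; ring
      simp only [this]
      calc _ ≤ ((loopBranches E 10 sample s k).map fun t => t.prob *
              ((t.reg 0 - k * μ) ^ 2 + 1)).sum := by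
            refine List.sum_le_sum fun t ht => ?_
            exact sum_sample_le L hmn hf (s := { t.tick with mem := t.mem.set 10 0 0 k })
              (hst t ht) (h1 t ht).2 _ μ hμ
        _ = ((loopBranches E 10 sample s k).map fun t => t.prob * (t.reg 0 - k * μ) ^ 2).sum +
              ((loopBranches E 10 sample s k).map Config.prob).sum := by
            rw [← List.sum_map_add]
            simp only [mul_add, mul_one]
        _ ≤ _ := by
            rw [h2]; push_cast; linarith

lemma exec_halve (E : Env n p) (s : Config m) (e : Expr) :
    ∃ s', (Prog.loop 10 e (.realHalf 0 0)).exec E s = [s'] ∧ s'.prob = s.prob ∧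
      s'.reg 0 = s.reg 0 / 2 ^ e.eval s.mem := by
  rw [exec_loop]
  induction e.eval s.mem with
  | zero => exact ⟨_, rfl, rfl, by simp [Config.tick]⟩
  | succ k ih =>
    obtain ⟨t, h1, h2, h3⟩ := ih
    refine ⟨_, by rw [loopBranches, h1, List.flatMap_singleton, Prog.exec], ?_, ?_⟩
    · rw [← h2]; rfl
    · simp [Config.tick, h3, pow_succ, div_div]

/-- Chebyshev's inequality. -/
lemma le_successProb (B : List (Config m)) (hB : ∀ s ∈ B, 0 ≤ s.prob) (μ : ℝ) {ε : ℝ}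
    (hε : 0 < ε) :
    (B.map Config.prob).sum - (B.map fun s => s.prob * (s.reg 0 - μ) ^ 2).sum / ε ^ 2 ≤
      successProb B μ ε := by
  unfold successProb
  induction B with
  | nil => simp
  | cons s B ih =>
    have ih := ih fun t ht => hB t (List.mem_cons_of_mem _ ht)
    have hs := hB s List.mem_cons_self
    simp only [List.map_cons, List.sum_cons, List.filter_cons, add_div]
    by_cases h : |s.reg 0 - μ| ≤ ε
    · have : 0 ≤ s.prob * (s.reg 0 - μ) ^ 2 / ε ^ 2 := by positivity
      simp only [h, decide_true, if_true, List.map_cons, List.sum_cons]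
      linarith
    · have : s.prob ≤ s.prob * (s.reg 0 - μ) ^ 2 / ε ^ 2 := by
        rw [le_div_iff₀ (by positivity)]
        refine mul_le_mul_of_nonneg_left ?_ hs
        rw [← sq_abs (s.reg 0 - μ)]
        exact pow_le_pow_left₀ hε.le (not_le.mp h).le 2
      simp only [h, decide_false, Bool.false_eq_true, if_false]
      linarith

/-- The success probability of the sampling procedure. -/
theorem successProb_estimate {s : Config m} (L : Layout p m G S s.mem) (hmn : m ≤ n)
    (hf : ∀ x, |E.f x| ≤ 1) (hs : 0 ≤ s.weight) (hs1 : s.prob = 1) (h0 : s.reg 0 = 0)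
    {N h : ℕ} (hN : s.mem 3 0 0 = N) (hh : s.mem 3 1 0 = h)
    (hNh : (N : ℝ) * (1 / 2) ^ ((S.card + 1) * p) = 2 ^ h) {ε δ : ℝ} (hε : 0 < ε)
    (hδ : (N : ℝ) ≤ δ * (ε * 2 ^ h) ^ 2) :
    1 - δ ≤ successProb (estimate.exec E s) (expectation E.f (qaoaState G E.γ E.β)) ε := by
  set μ := expectation E.f (qaoaState G E.γ E.β) with hμ
  obtain ⟨h1, h2, h3⟩ := sum_samples_le L hmn hf (fun _ _ => rfl) hs h0
    ((1 / 2) ^ ((S.card + 1) * p) * μ) rfl N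
  have hmul : (N : ℝ) * ((1 / 2) ^ ((S.card + 1) * p) * μ) = 2 ^ h * μ := by
    rw [← mul_assoc, hNh]
  rw [hmul, hs1, mul_one] at h3
  have hexec : estimate.exec E s = (loopBranches E 10 sample s N).flatMap fun t =>
      (Prog.loop 10 (cell 3 1) (.realHalf 0 0)).exec E t := by
    rw [estimate, Prog.exec, exec_loop, cell_eval, hN]
  have hev : ∀ t ∈ loopBranches E 10 sample s N, (cell 3 1).eval t.mem = h := fun t ht => by
    rw [cell_eval, (h1 t ht).1 3 (by norm_num), hh]
  have hp : ((estimate.exec E s).map Config.prob).sum = 1 := by rw [sum_exec_prob, hs1]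
  -- The `h` halvings divide the sum by `2^h`, hence its second moment by `4^h`; before them it is
  -- at most `N`.
  have hm : ((estimate.exec E s).map fun t => t.prob * (t.reg 0 - μ) ^ 2).sum ≤
      (N : ℝ) / (2 ^ h) ^ 2 := by
    rw [hexec, sum_flatMap, le_div_iff₀ (by positivity), mul_comm, ← List.sum_map_mul_left]
    refine le_trans (le_of_eq ?_) h3
    congr 1
    refine List.map_congr_left fun t ht => ?_
    obtain ⟨t', e1, e2, e3⟩ := exec_halve E t (cell 3 1)
    rw [e1, List.map_singleton, List.sum_singleton, e2, e3, hev t ht]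
    field_simp
  have := le_successProb (estimate.exec E s)
    (fun t ht => t.prob_nonneg (weight_nonneg E estimate s hs t ht)) μ hε
  refine le_trans ?_ this
  rw [hp]
  have : ((estimate.exec E s).map fun t => t.prob * (t.reg 0 - μ) ^ 2).sum / ε ^ 2 ≤ δ := by
    rw [div_le_iff₀ (by positivity)]
    refine hm.trans ?_
    rw [div_le_iff₀ (by positivity)]
    linarith [hδ, mul_pow ε (2 ^ h : ℝ) 2]
  linarith

end

/-! ## The classical part of the program

Array `3` holds the number of samples and the number of halvings, array `7` labels of the vertices,
array `8` auxiliary values. -/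

/-- The program contains an assignment to array `a`. -/
def Prog.writes (a : ℕ) : Prog → Bool
  | .seq c c' => c.writes a || c'.writes a
  | .assign b _ _ _ => decide (b = a)
  | .ite _ c c' => c.writes a || c'.writes a
  | .loop b _ c => decide (b = a) || c.writes a
  | _ => false

lemma run_of_not_writes {a : ℕ} (c : Prog) (hc : c.writes a = false) (M : Memory) :
    c.run M a = M a := by
  induction c generalizing M with
  | seq c c' ih ih' =>
    simp only [Prog.writes, Bool.or_eq_false_iff] at hc
    simp only [Prog.run, ih' hc.2, ih hc.1]
  | assign b i j e =>
    simp only [Prog.writes, decide_eq_false_iff_not] at hc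
    exact Memory.set_ne M (Ne.symm hc) _ _ _
  | ite e c c' ih ih' =>
    simp only [Prog.writes, Bool.or_eq_false_iff] at hc
    simp only [Prog.run]
    split_ifs
    · exact ih hc.1 M
    · exact ih' hc.2 M
  | loop b e c ih =>
    simp only [Prog.writes, Bool.or_eq_false_iff, decide_eq_false_iff_not] at hc
    simp only [Prog.run]
    refine loopRun_induct (fun _ M' => M' a = M a) _ rfl fun k _ M' h => ?_
    rw [ih hc.2, Memory.set_ne _ (Ne.symm hc.1), h]
  | _ => rfl

lemma run_below {k : ℕ} (c : Prog) (hc : ∀ a < k, c.writes a = false) (M : Memory) :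
    ∀ a < k, c.run M a = M a := fun a ha => run_of_not_writes c (hc a ha) M

lemma run_loop_induct {a : ℕ} {e : Expr} {c : Prog} {M : Memory} (Q : ℕ → Memory → Prop)
    (h0 : Q 0 M) (h : ∀ k < e.eval M, ∀ M', Q k M' → Q (k + 1) (c.run (M'.set a 0 0 k))) :
    Q (e.eval M) ((Prog.loop a e c).run M) := loopRun_induct Q _ h0 h

lemma card_filter_eq_count {n : ℕ} (P : ℕ → Prop) [DecidablePred P] :
    (Finset.univ.filter fun u : Fin n => P u).card = Nat.count P n := by
  rw [Nat.count_eq_card_filter_range, ← Finset.card_map Fin.valEmbedding]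
  congr 1
  ext v
  simp only [Finset.mem_map, Finset.mem_filter, Finset.mem_univ, true_and, Fin.valEmbedding_apply,
    Finset.mem_range]
  constructor
  · rintro ⟨u, hu, rfl⟩
    exact ⟨u.2, hu⟩
  · rintro ⟨hv, h⟩
    exact ⟨⟨v, hv⟩, h, rfl⟩

/-! ### The number of samples -/

/-- Four times as many samples, and one more halving. -/
def quadruple : Prog :=
  .seq (.assign 3 (.const 0) (.const 0)
      (.add (.add (cell 3 0) (cell 3 0)) (.add (cell 3 0) (cell 3 0))))
    (.assign 3 (.const 1) (.const 0) (.add (cell 3 1) (.const 1)))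

/-- Quadruple the number of samples for every vertex of the separator. -/
def quadrupleVertices : Prog := .loop 12 (cell 0 0) (.ite (qubitOf 2 12) quadruple .skip)

/-- Quadruple the number of samples for every layer, and for the separator in every layer. -/
def quadrupleLayers : Prog := .loop 11 (cell 0 1) (.seq quadruple quadrupleVertices)

/-- Quadruple the number of samples until the accuracy is reached. -/
def quadrupleAccuracy : Prog :=
  .seq (.assign 3 (.const 2) (.const 0) (.const 1))
    (.loop 11 (cell 0 2) (.ite (.lt (cell 3 2) (cell 0 2))
      (.seq (.assign 3 (.const 2) (.const 0) (.add (cell 3 2) (cell 3 2)))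
        (.seq quadruple (.assign 3 (.const 1) (.const 0) (.add (cell 3 1) (.const 1)))))
      .skip))

/-- The number of samples and the number of halvings, for the failure probability `2⁻ᶜ`. -/
def budget (c : ℕ) : Prog :=
  .seq (.assign 3 (.const 0) (.const 0) (.const (2 ^ c)))
    (.seq (.assign 3 (.const 1) (.const 0) (.const c))
      (.seq quadrupleLayers quadrupleAccuracy))

/-- `N` samples and `h` halvings. -/
def HasBudget (M : Memory) (N h : ℕ) : Prop := M 3 0 0 = N ∧ M 3 1 0 = h

lemma HasBudget.of_eq {M M' : Memory} {N h : ℕ} (hM : HasBudget M N h) (h3 : M' 3 = M 3) :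
    HasBudget M' N h := by
  rw [HasBudget, h3]; exact hM

/-- When the mean of a sample is halved, four times as many samples double the mean of the sum, and
one more halving restores the normalization `N · 2^(-(|S|+1)p) = 2^h`. -/
lemma quadruple_run {M : Memory} {N h : ℕ} (hM : HasBudget M N h) :
    HasBudget (quadruple.run M) (N * 4) (h + 1) ∧ quadruple.run M 3 2 0 = M 3 2 0 := by
  obtain ⟨rfl, rfl⟩ := hM
  refine ⟨⟨?_, ?_⟩, ?_⟩
  · simp [quadruple, Prog.run, cell_eval, Expr.eval, Memory.set]; ring
  · simp [quadruple, Prog.run, cell_eval, Expr.eval, Memory.set]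
  · simp [quadruple, Prog.run, Expr.eval, Memory.set]

lemma quadrupleVertices_run {M : Memory} {N h : ℕ} (hM : HasBudget M N h) :
    HasBudget (quadrupleVertices.run M)
      (N * 4 ^ Nat.count (fun v => M 2 v 0 ≠ 0) (M 0 0 0))
      (h + Nat.count (fun v => M 2 v 0 ≠ 0) (M 0 0 0)) := by
  refine (run_loop_induct (fun k M' => M' 2 = M 2 ∧
    HasBudget M' (N * 4 ^ Nat.count (fun v => M 2 v 0 ≠ 0) k)
      (h + Nat.count (fun v => M 2 v 0 ≠ 0) k)) ⟨rfl, by simpa using hM⟩ ?_).2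
  rintro k - M₁ ⟨h2, hb⟩
  have h2' : M₁.set 12 0 0 k 2 = M 2 := by rw [Memory.set_ne _ (by norm_num), h2]
  have hb' := hb.of_eq (M' := M₁.set 12 0 0 k) (Memory.set_ne _ (by norm_num) _ _ _)
  refine ⟨(run_of_not_writes _ (by decide) _).trans h2', ?_⟩
  have he : (qubitOf 2 12).eval (M₁.set 12 0 0 k) = M 2 k 0 := by
    rw [qubitOf_eval, h2', Memory.set_self]
  rw [Prog.run, he]
  by_cases hk : M 2 k 0 ≠ 0
  · rw [if_pos hk, Nat.count_succ, if_pos hk, pow_succ, ← mul_assoc, ← add_assoc]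
    exact (quadruple_run hb').1
  · rw [if_neg hk, Nat.count_succ, if_neg hk]
    exact hb'

lemma quadrupleLayers_run {M : Memory} {N h : ℕ} (hM : HasBudget M N h) :
    HasBudget (quadrupleLayers.run M)
      (N * 4 ^ (M 0 1 0 * (Nat.count (fun v => M 2 v 0 ≠ 0) (M 0 0 0) + 1)))
      (h + M 0 1 0 * (Nat.count (fun v => M 2 v 0 ≠ 0) (M 0 0 0) + 1)) := by
  refine (run_loop_induct (fun k M' => (∀ a < 3, M' a = M a) ∧
    HasBudget M' (N * 4 ^ (k * (Nat.count (fun v => M 2 v 0 ≠ 0) (M 0 0 0) + 1)))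
      (h + k * (Nat.count (fun v => M 2 v 0 ≠ 0) (M 0 0 0) + 1)))
    ⟨fun _ _ => rfl, by simpa using hM⟩ ?_).2
  rintro k - M₁ ⟨hf, hb⟩
  have hf' : ∀ a < 3, M₁.set 11 0 0 k a = M a := fun a ha => by
    rw [Memory.set_ne _ (by omega), hf a ha]
  have hb' := (quadruple_run
    (hb.of_eq (M' := M₁.set 11 0 0 k) (Memory.set_ne _ (by norm_num) _ _ _))).1
  have hf₂ : ∀ a < 3, quadruple.run (M₁.set 11 0 0 k) a = M a := fun a ha =>
    (run_below quadruple (k := 3) (by decide) _ a ha).trans (hf' a ha)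
  have := quadrupleVertices_run hb'
  rw [hf₂ 0 (by norm_num), hf₂ 2 (by norm_num)] at this
  refine ⟨fun a ha => ?_, ?_⟩
  · rw [Prog.run, run_below quadrupleVertices (k := 3) (by decide) _ a ha, hf₂ a ha]
  · rw [Prog.run]
    convert this using 1
    · rw [Nat.succ_mul, pow_add]; ring
    · ring

/-- Here the mean of a sample is unchanged, so four times as many samples call for two more
halvings. The loop imitates a search for the least power of two above `K`, with `K` iterations as a
safe bound. -/
lemma quadrupleAccuracy_run {M : Memory} {N h : ℕ} (hM : HasBudget M N h) (hK : 1 ≤ M 0 2 0) :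
    ∃ j, HasBudget (quadrupleAccuracy.run M) (N * 4 ^ j) (h + 2 * j) ∧
      M 0 2 0 ≤ 2 ^ j ∧ 2 ^ j ≤ 2 * M 0 2 0 := by
  have h0 : HasBudget (M.set 3 2 0 1) N h := ⟨by simpa [Memory.set] using hM.1,
    by simpa [Memory.set] using hM.2⟩
  have key := run_loop_induct (a := 11) (e := cell 0 2) (M := M.set 3 2 0 1)
    (c := .ite (.lt (cell 3 2) (cell 0 2))
      (.seq (.assign 3 (.const 2) (.const 0) (.add (cell 3 2) (cell 3 2)))
        (.seq quadruple (.assign 3 (.const 1) (.const 0) (.add (cell 3 1) (.const 1))))) .skip)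
    -- As long as the target is not reached, every iteration doubles, so `2^j ≥ k + 1` after `k`
    -- iterations. Doubling only below `K` keeps `2^j ≤ 2K`.
    (fun k M' => M' 0 = M 0 ∧ ∃ j, HasBudget M' (N * 4 ^ j) (h + 2 * j) ∧ M' 3 2 0 = 2 ^ j ∧
      2 ^ j ≤ 2 * M 0 2 0 ∧ (M 0 2 0 ≤ 2 ^ j ∨ k + 1 ≤ 2 ^ j))
    ⟨Memory.set_ne _ (by norm_num) _ _ _, 0, by simpa using h0, Memory.set_self _ _ _ _ _,
      by omega, by simp⟩ ?_
  · obtain ⟨-, j, h1, -, h3, h4⟩ := key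
    have hev : (cell 0 2).eval (M.set 3 2 0 1) = M 0 2 0 := by simp [cell_eval, Memory.set]
    rw [hev] at h4
    exact ⟨j, h1, by omega, h3⟩
  rintro k - M₁ ⟨hf, j, hb, h2, hj, hj'⟩
  have hf' : M₁.set 11 0 0 k 0 = M 0 := by rw [Memory.set_ne _ (by norm_num), hf]
  have h3' : M₁.set 11 0 0 k 3 = M₁ 3 := Memory.set_ne _ (by norm_num) _ _ _
  refine ⟨(run_of_not_writes _ (by decide) _).trans hf', ?_⟩
  set M₂ := M₁.set 11 0 0 k
  have hev : (Expr.lt (cell 3 2) (cell 0 2)).eval M₂ = if 2 ^ j < M 0 2 0 then 1 else 0 := by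
    simp only [Expr.eval, cell_eval, hf', h3', h2]
  rw [Prog.run, hev]
  by_cases hlt : 2 ^ j < M 0 2 0
  · rw [if_pos hlt, if_pos one_ne_zero]
    have hbs : HasBudget (M₂.set 3 2 0 (2 ^ j + 2 ^ j)) (N * 4 ^ j) (h + 2 * j) :=
      ⟨by simpa [Memory.set, h3'] using hb.1, by simpa [Memory.set, h3'] using hb.2⟩
    obtain ⟨⟨q0, q1⟩, q2⟩ := quadruple_run hbs
    rw [Memory.set_self] at q2
    have hrun : Prog.run (.seq (.assign 3 (.const 2) (.const 0) (.add (cell 3 2) (cell 3 2)))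
        (.seq quadruple (.assign 3 (.const 1) (.const 0) (.add (cell 3 1) (.const 1))))) M₂ =
        (quadruple.run (M₂.set 3 2 0 (2 ^ j + 2 ^ j))).set 3 1 0 (h + 2 * j + 1 + 1) := by
      simp only [Prog.run, Expr.eval, cell_eval, h3', h2, q1]
    refine ⟨j + 1, ?_, ?_, ?_, ?_⟩
    · rw [hrun]
      refine ⟨?_, ?_⟩
      · rw [pow_succ, ← mul_assoc, ← q0]; simp [Memory.set]
      · rw [Memory.set_self]; ring
    · rw [hrun, pow_succ, mul_two]
      refine Eq.trans ?_ q2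
      simp [Memory.set]
    · rw [pow_succ]; omega
    · right; rw [pow_succ]; omega
  · rw [if_neg hlt, if_neg (by simp)]
    exact ⟨j, hb.of_eq h3', (congrFun (congrFun h3' 2) 0).trans h2, hj,
      Or.inl (by omega)⟩

lemma budget_run (c : ℕ) {M : Memory} (hK : 1 ≤ M 0 2 0) :
    ∃ e j, e = M 0 1 0 * (Nat.count (fun v => M 2 v 0 ≠ 0) (M 0 0 0) + 1) ∧
      HasBudget ((budget c).run M) (2 ^ c * 4 ^ e * 4 ^ j) (c + e + 2 * j) ∧
      M 0 2 0 ≤ 2 ^ j ∧ 2 ^ j ≤ 2 * M 0 2 0 := by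
  have h0 : HasBudget ((M.set 3 0 0 (2 ^ c)).set 3 1 0 c) (2 ^ c) c :=
    ⟨by simp [Memory.set], by simp [Memory.set]⟩
  have h1 := quadrupleLayers_run h0
  have hf : ∀ a < 3, (M.set 3 0 0 (2 ^ c)).set 3 1 0 c a = M a := fun a ha => by
    rw [Memory.set_ne _ (by omega), Memory.set_ne _ (by omega)]
  have hf' := run_of_not_writes (a := 0) quadrupleLayers (by decide)
    ((M.set 3 0 0 (2 ^ c)).set 3 1 0 c)
  rw [hf 0 (by norm_num)] at hf'
  rw [hf 0 (by norm_num), hf 2 (by norm_num)] at h1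
  obtain ⟨j, h2, h3, h4⟩ := quadrupleAccuracy_run h1 (by rw [hf']; exact hK)
  rw [hf'] at h3 h4
  exact ⟨_, j, rfl, h2, h3, h4⟩

/-! ### Labels that are constant on the components of the graph without the separator -/

/-- Different labels for all vertices. -/
def initLabels : Prog := .loop 11 (cell 0 0) (.assign 7 (cell 11 0) (.const 0) (cell 11 0))

/-- Replace the label of the second vertex by the label of the first vertex everywhere. -/
def unifyLabels : Prog :=
  .seq (.assign 8 (.const 0) (.const 0) (qubitOf 7 12))
    (.seq (.assign 8 (.const 1) (.const 0) (qubitOf 7 11))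
      (.loop 13 (cell 0 0)
        (.ite (.add (.lt (qubitOf 7 13) (cell 8 0)) (.lt (cell 8 0) (qubitOf 7 13))) .skip
          (.assign 7 (cell 13 0) (.const 0) (cell 8 1)))))

/-- Make the labels of the ends of an edge outside the separator agree. -/
def mergeEdge : Prog :=
  .ite (.get 1 (cell 11 0) (cell 12 0))
    (.ite (.add (qubitOf 2 11) (qubitOf 2 12)) .skip unifyLabels) .skip

/-- Make the labels of the ends of all edges outside the separator agree. -/
def mergeLabels : Prog := .loop 11 (cell 0 0) (.loop 12 (cell 0 0) mergeEdge)

lemma initLabels_run (M : Memory) : ∀ w < M 0 0 0, initLabels.run M 7 w 0 = w := by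
  refine run_loop_induct (e := cell 0 0) (fun k M' => ∀ w < k, M' 7 w 0 = w) (by simp) ?_
  intro k _ M' h w hw
  have e : Prog.run (.assign 7 (cell 11 0) (.const 0) (cell 11 0)) (M'.set 11 0 0 k) =
      (M'.set 11 0 0 k).set 7 k 0 k := by
    simp only [Prog.run, cell_eval, Memory.set_self, Expr.eval]
  rw [e]
  by_cases hwk : w = k
  · rw [hwk, Memory.set_self]
  · have := h w (by omega)
    simpa [Memory.set, hwk] using this

lemma unifyLabels_run {M : Memory} {u v : ℕ} (hu : M 11 0 0 = u) (hv : M 12 0 0 = v) :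
    ∀ w < M 0 0 0, unifyLabels.run M 7 w 0 = if M 7 w 0 = M 7 v 0 then M 7 u 0 else M 7 w 0 := by
  have key := run_loop_induct (a := 13) (e := cell 0 0)
    (M := (M.set 8 0 0 (M 7 v 0)).set 8 1 0 (M 7 u 0))
    (c := .ite (.add (.lt (qubitOf 7 13) (cell 8 0)) (.lt (cell 8 0) (qubitOf 7 13))) .skip
          (.assign 7 (cell 13 0) (.const 0) (cell 8 1)))
    (fun k M' => M' 8 0 0 = M 7 v 0 ∧ M' 8 1 0 = M 7 u 0 ∧ ∀ w, M' 7 w 0 =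
      if w < k ∧ M 7 w 0 = M 7 v 0 then M 7 u 0 else M 7 w 0)
    (by simp [Memory.set]) ?_
  · have e1 : (cell 0 0).eval ((M.set 8 0 0 (M 7 v 0)).set 8 1 0 (M 7 u 0)) = M 0 0 0 := by
      simp [cell_eval, Memory.set]
    rw [e1] at key
    intro w hw
    have e2 : unifyLabels.run M = Prog.run (.loop 13 (cell 0 0)
        (.ite (.add (.lt (qubitOf 7 13) (cell 8 0)) (.lt (cell 8 0) (qubitOf 7 13))) .skip
          (.assign 7 (cell 13 0) (.const 0) (cell 8 1))))
        ((M.set 8 0 0 (M 7 v 0)).set 8 1 0 (M 7 u 0)) := by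
      rw [unifyLabels, Prog.run, Prog.run, Prog.run, Prog.run]
      simp only [qubitOf_eval, Expr.eval, hu, hv, Memory.set_ne _ (show 7 ≠ 8 by norm_num),
        Memory.set_ne _ (show 11 ≠ 8 by norm_num)]
    rw [e2, key.2.2 w]
    simp [hw]
  · rintro k - M' ⟨h0, h1, h7⟩
    have e : (Expr.add (.lt (qubitOf 7 13) (cell 8 0)) (.lt (cell 8 0) (qubitOf 7 13))).eval
        (M'.set 13 0 0 k) = if M 7 k 0 = M 7 v 0 then 0 else 1 := by
      have : M' 7 k 0 = M 7 k 0 := by rw [h7]; simp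
      simp only [Expr.eval, qubitOf_eval, cell_eval, Memory.set_self,
        Memory.set_ne M' (show 7 ≠ 13 by norm_num), Memory.set_ne M' (show 8 ≠ 13 by norm_num),
        this, h0]
      split_ifs <;> omega
    rw [Prog.run, e]
    by_cases hk : M 7 k 0 = M 7 v 0
    · rw [if_pos hk, if_neg (by simp)]
      have e3 : Prog.run (.assign 7 (cell 13 0) (.const 0) (cell 8 1)) (M'.set 13 0 0 k) =
          (M'.set 13 0 0 k).set 7 k 0 (M 7 u 0) := by
        simp only [Prog.run, cell_eval, Memory.set_self, Expr.eval,
          Memory.set_ne M' (show 8 ≠ 13 by norm_num), h1]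
      rw [e3]
      refine ⟨by simpa [Memory.set] using h0, by simpa [Memory.set] using h1, fun w => ?_⟩
      by_cases hw : w = k
      · subst hw
        rw [Memory.set_self, if_pos ⟨Nat.lt_succ_self _, hk⟩]
      · have : ((M'.set 13 0 0 k).set 7 k 0 (M 7 u 0)) 7 w 0 = M' 7 w 0 := by
          simp [Memory.set, hw]
        rw [this, h7]
        exact if_congr ⟨fun h => ⟨by omega, h.2⟩, fun h => ⟨by omega, h.2⟩⟩ rfl rfl
    · rw [if_neg hk, if_pos one_ne_zero]
      refine ⟨by simpa [Memory.set, Prog.run] using h0,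
        by simpa [Memory.set, Prog.run] using h1, fun w => ?_⟩
      have : Prog.skip.run (M'.set 13 0 0 k) 7 w 0 = M' 7 w 0 := by simp [Memory.set, Prog.run]
      rw [this, h7]
      refine if_congr ⟨fun h => ⟨by omega, h.2⟩, fun h => ⟨?_, h.2⟩⟩ rfl rfl
      have : w ≠ k := fun hw => hk (hw ▸ h.2)
      omega

/-- The labels are below `n`, vertices with the same label have the same side, and vertices related
by `R` have the same label. -/
structure IsLabeling (n : ℕ) (side : ℕ → Prop) (R : ℕ → ℕ → Prop) (l : ℕ → ℕ) : Prop where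
  lt : ∀ w < n, l w < n
  side : ∀ w < n, ∀ w' < n, l w = l w' → (side w ↔ side w')
  eq : ∀ w < n, ∀ w' < n, R w w' → l w = l w'

/-- The class of `v` is absorbed into that of `u`. Both classes lie on the common side of `u` and
`v`, so the new class does too, and equal labels stay equal under relabelling. -/
lemma IsLabeling.merge {n : ℕ} {side : ℕ → Prop} {R R' : ℕ → ℕ → Prop} {l l' : ℕ → ℕ}
    (h : IsLabeling n side R l) {u v : ℕ} (hu : u < n) (hv : v < n) (huv : side u ↔ side v)
    (hl : ∀ w < n, l' w = if l w = l v then l u else l w)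
    (hR : ∀ w w', R' w w' → R w w' ∨ w = u ∧ w' = v) : IsLabeling n side R' l' where
  lt w hw := by
    rw [hl w hw]
    split_ifs
    · exact h.lt u hu
    · exact h.lt w hw
  side w hw w' hw' heq := by
    rw [hl w hw, hl w' hw'] at heq
    split_ifs at heq with h1 h2 h2
    · exact h.side w hw w' hw' (h1.trans h2.symm)
    · rw [h.side w hw v hv h1, ← huv, h.side u hu w' hw' heq]
    · rw [h.side w hw u hu heq, huv, h.side w' hw' v hv h2]
    · exact h.side w hw w' hw' heq
  eq w hw w' hw' hRw := by
    rw [hl w hw, hl w' hw']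
    rcases hR w w' hRw with hr | ⟨rfl, rfl⟩
    · rw [h.eq w hw w' hw' hr]
    · simp

/-- The edge relation outside the separator. -/
def OuterEdge (M : Memory) (u v : ℕ) : Prop := M 1 u v ≠ 0 ∧ M 2 u 0 = 0 ∧ M 2 v 0 = 0

lemma mergeEdge_run {M₀ M : Memory} (hM : ∀ a < 3, M a = M₀ a) {u v : ℕ} (hu : M 11 0 0 = u)
    (hv : M 12 0 0 = v) (hun : u < M₀ 0 0 0) (hvn : v < M₀ 0 0 0) {side : ℕ → Prop}
    (hside : OuterEdge M₀ u v → (side u ↔ side v)) {R R' : ℕ → ℕ → Prop}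
    (h : IsLabeling (M₀ 0 0 0) side R fun w => M 7 w 0)
    (hR : ∀ w w', R' w w' → R w w' ∨ w = u ∧ w' = v ∧ OuterEdge M₀ u v) :
    IsLabeling (M₀ 0 0 0) side R' fun w => mergeEdge.run M 7 w 0 := by
  have e1 : (Expr.get 1 (cell 11 0) (cell 12 0)).eval M = M₀ 1 u v := by
    simp only [Expr.eval, cell_eval, hu, hv, hM 1 (by norm_num)]
  have e2 : (Expr.add (qubitOf 2 11) (qubitOf 2 12)).eval M = M₀ 2 u 0 + M₀ 2 v 0 := by
    simp only [Expr.eval, qubitOf_eval, hu, hv, hM 2 (by norm_num)]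
  have hskip : ¬ OuterEdge M₀ u v → IsLabeling (M₀ 0 0 0) side R' fun w => M 7 w 0 := fun hn =>
    ⟨h.lt, h.side, fun w hw w' hw' hr => (hR w w' hr).elim (h.eq w hw w' hw')
      fun hh => absurd hh.2.2 hn⟩
  rw [mergeEdge, Prog.run, e1]
  by_cases h1 : M₀ 1 u v ≠ 0
  · rw [if_pos h1, Prog.run, e2]
    by_cases h2 : M₀ 2 u 0 + M₀ 2 v 0 ≠ 0
    · rw [if_pos h2]
      exact hskip fun ⟨_, h3, h4⟩ => h2 (by omega)
    · rw [if_neg h2]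
      have hedge : OuterEdge M₀ u v := ⟨h1, by omega, by omega⟩
      refine h.merge hun hvn (hside hedge) (fun w hw => ?_) fun w w' hr =>
        (hR w w' hr).imp id fun hh => ⟨hh.1, hh.2.1⟩
      exact unifyLabels_run hu hv w (by rwa [hM 0 (by norm_num)])
  · rw [if_neg h1]
    exact hskip fun hh => h1 hh.1

/-- One pass over all ordered pairs is enough, because merging acts on entire classes and an
equality of labels is never undone. -/
lemma mergeLabels_run {M : Memory} {side : ℕ → Prop}
    (hside : ∀ u < M 0 0 0, ∀ v < M 0 0 0, OuterEdge M u v → (side u ↔ side v))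
    (h : IsLabeling (M 0 0 0) side (fun _ _ => False) fun w => M 7 w 0) :
    IsLabeling (M 0 0 0) side (OuterEdge M) fun w => mergeLabels.run M 7 w 0 := by
  have key := run_loop_induct (a := 11) (e := cell 0 0) (M := M)
    (c := .loop 12 (cell 0 0) mergeEdge)
    (fun k M' => (∀ a < 3, M' a = M a) ∧
      IsLabeling (M 0 0 0) side (fun u v => u < k ∧ OuterEdge M u v) fun w => M' 7 w 0)
    ⟨fun _ _ => rfl, h.lt, h.side, by simp⟩ ?_
  · exact ⟨key.2.lt, key.2.side, fun w hw w' hw' hr => key.2.eq w hw w' hw' ⟨hw, hr⟩⟩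
  rintro k hk M₁ ⟨hf, h1⟩
  have hf' : ∀ a < 3, M₁.set 11 0 0 k a = M a := fun a ha => by
    rw [Memory.set_ne _ (by omega), hf a ha]
  have key' := run_loop_induct (a := 12) (e := cell 0 0) (M := M₁.set 11 0 0 k) (c := mergeEdge)
    (fun l M' => (∀ a < 3, M' a = M a) ∧ M' 11 0 0 = k ∧
      IsLabeling (M 0 0 0) side (fun u v => (u < k ∨ u = k ∧ v < l) ∧ OuterEdge M u v)
        fun w => M' 7 w 0) ⟨hf', Memory.set_self _ _ _ _ _, ?_⟩ ?_
  · refine ⟨key'.1, key'.2.2.lt, key'.2.2.side, fun w hw w' hw' hr => key'.2.2.eq w hw w' hw' ?_⟩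
    have e : (cell 0 0).eval (M₁.set 11 0 0 k) = M 0 0 0 := by
      rw [cell_eval, hf' 0 (by norm_num)]
    rw [e]
    exact ⟨by have := hr.1; omega, hr.2⟩
  · rw [Memory.set_ne _ (by norm_num)]
    exact ⟨h1.lt, h1.side, fun w hw w' hw' hr => h1.eq w hw w' hw'
      ⟨hr.1.elim id fun hh => absurd hh.2 (Nat.not_lt_zero _), hr.2⟩⟩
  · rintro l hl M₂ ⟨hf₂, h11, h2⟩
    have e : (cell 0 0).eval (M₁.set 11 0 0 k) = M 0 0 0 := by
      rw [cell_eval, hf' 0 (by norm_num)]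
    rw [e] at hl
    have hf₂' : ∀ a < 3, M₂.set 12 0 0 l a = M a := fun a ha => by
      rw [Memory.set_ne _ (by omega), hf₂ a ha]
    have h11' : M₂.set 12 0 0 l 11 0 0 = k := by rw [Memory.set_ne _ (by norm_num), h11]
    refine ⟨fun a ha => ?_, ?_, ?_⟩
    · rw [run_below mergeEdge (k := 3) (by decide) _ a ha, hf₂' a ha]
    · rw [run_of_not_writes mergeEdge (by decide), h11']
    · refine mergeEdge_run hf₂' h11' (Memory.set_self _ _ _ _ _) hk hl (hside k hk l hl)
        (R := fun u v => (u < k ∨ u = k ∧ v < l) ∧ OuterEdge M u v) ?_ ?_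
      · rw [Memory.set_ne _ (by norm_num)]; exact h2
      · rintro w w' ⟨hw, hr⟩
        by_cases hh : w = k ∧ w' = l
        · obtain ⟨rfl, rfl⟩ := hh
          exact Or.inr ⟨rfl, rfl, hr⟩
        · exact Or.inl ⟨by omega, hr⟩

/-! ### An interval of labels that balances the two sides -/

/-- The label `l` belongs to the interval `[lo, hi)`. -/
def Inside (l : ℕ → ℕ) (lo hi v : ℕ) : Prop := lo ≤ l v ∧ l v < hi

instance (l : ℕ → ℕ) (lo hi : ℕ) : DecidablePred (Inside l lo hi) := fun _ =>
  inferInstanceAs (Decidable (_ ∧ _))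

/-- The number of vertices outside the separator inside of the interval of labels, and the number
of those outside of it, are at most `2 n / 3`. -/
def IsBalanced (n : ℕ) (σ l : ℕ → ℕ) (lo hi : ℕ) : Prop :=
  3 * Nat.count (fun v => σ v = 0 ∧ Inside l lo hi v) n ≤ 2 * n ∧
    3 * Nat.count (fun v => σ v = 0 ∧ ¬ Inside l lo hi v) n ≤ 2 * n

lemma count_eq_add {P Q R : ℕ → Prop} [DecidablePred P] [DecidablePred Q] [DecidablePred R] (n : ℕ)
    (h : ∀ v < n, P v ↔ Q v ∨ R v) (h' : ∀ v < n, Q v → ¬ R v) :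
    Nat.count P n = Nat.count Q n + Nat.count R n := by
  induction n with
  | zero => simp
  | succ n ih =>
    have h1 := h n n.lt_succ_self
    have h2 := h' n n.lt_succ_self
    simp only [Nat.count_succ, ih (fun v hv => h v (by omega)) (fun v hv => h' v (by omega))]
    by_cases hP : P n <;> by_cases hQ : Q n <;> by_cases hR : R n <;> simp_all <;> omega

/-- If both sides are small, then there is a balancing interval of labels. -/
lemma exists_isBalanced {n : ℕ} {σ l : ℕ → ℕ} {side : ℕ → Prop} [DecidablePred side]
    {R : ℕ → ℕ → Prop} (hl : IsLabeling n side R l)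
    (hA : 3 * Nat.count (fun v => σ v = 0 ∧ side v) n ≤ 2 * n)
    (hB : 3 * Nat.count (fun v => σ v = 0 ∧ ¬ side v) n ≤ 2 * n) :
    ∃ lo ≤ n, ∃ hi ≤ n, IsBalanced n σ l lo hi := by
  set T := Nat.count (fun v => σ v = 0) n with hT
  have hTn : T ≤ n := Nat.count_le _
  set F : ℕ → ℕ := fun i => Nat.count (fun v => σ v = 0 ∧ Inside l 0 i v) n with hF
  have hsplit : ∀ lo hi, T = Nat.count (fun v => σ v = 0 ∧ Inside l lo hi v) n +
      Nat.count (fun v => σ v = 0 ∧ ¬ Inside l lo hi v) n := fun lo hi =>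
    count_eq_add n (fun v _ => by tauto) (fun v _ => by tauto)
  have hFn : F n = T := by
    rw [hsplit 0 n, hF]
    have : Nat.count (fun v => σ v = 0 ∧ ¬ Inside l 0 n v) n = 0 := by
      rw [Nat.count_eq_card_filter_range, Finset.card_eq_zero, Finset.filter_eq_empty_iff]
      rintro v hv ⟨-, hv'⟩
      exact hv' ⟨Nat.zero_le _, hl.lt v (Finset.mem_range.mp hv)⟩
    rw [this, add_zero]
  have hex : ∃ i, 3 * (T - F i) ≤ 2 * n := ⟨n, by rw [hFn]; omega⟩
  classical
  -- Grow the prefix `[0, i)` of labels until at most `2n/3` outer vertices lie beyond it.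
  set i := Nat.find hex with hi
  have h1 : 3 * (T - F i) ≤ 2 * n := Nat.find_spec hex
  have hin : i ≤ n := Nat.find_min' hex (by rw [hFn]; omega)
  by_cases hFi : 3 * F i ≤ 2 * n
  · refine ⟨0, Nat.zero_le _, i, hin, hFi, ?_⟩
    have h2 := hsplit 0 i
    change T = F i + _ at h2
    omega
  -- Otherwise the prefix jumps from below `n/3` to above `2n/3` at the last label `i'`. That label
  -- class alone has more than `n/3` vertices, so it forms one side and everything else the other.
  · obtain ⟨i', hi'⟩ : ∃ i', i = i' + 1 := by
      refine Nat.exists_eq_succ_of_ne_zero fun h0 => hFi ?_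
      rw [h0]
      have : F 0 = 0 := by
        rw [hF]
        refine (Nat.count_eq_card_filter_range _ _).trans ?_
        rw [Finset.card_eq_zero, Finset.filter_eq_empty_iff]
        rintro v - ⟨-, -, hv⟩
        exact Nat.not_lt_zero _ hv
      omega
    have h2 : ¬ 3 * (T - F i') ≤ 2 * n := Nat.find_min hex (by omega)
    set x := Nat.count (fun v => σ v = 0 ∧ Inside l i' i v) n with hx
    have h3 : F i = F i' + x := by
      refine count_eq_add n (fun v _ => ?_) (fun v _ => ?_)
      · simp only [Inside]
        constructor
        · rintro ⟨a, b, c⟩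
          by_cases l v < i'
          · left; exact ⟨a, b, by assumption⟩
          · right; exact ⟨a, by omega, c⟩
        · rintro (⟨a, b, c⟩ | ⟨a, b, c⟩)
          · exact ⟨a, b, by omega⟩
          · exact ⟨a, by omega, c⟩
      · simp only [Inside]; rintro ⟨a, b, c⟩ ⟨a', b', c'⟩; omega
    -- A label class does not meet both sides of the given separation, so the bound on its side
    -- applies to it.
    have h4 : 3 * x ≤ 2 * n := by
      have heq : ∀ w < n, ∀ w' < n, Inside l i' i w → Inside l i' i w' → (side w ↔ side w') := by
        intro w hw w' hw' h5 h6
        refine hl.side w hw w' hw' ?_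
        simp only [Inside] at h5 h6
        omega
      by_cases hw : ∃ w < n, Inside l i' i w ∧ side w
      · obtain ⟨w, hw, hw1, hw2⟩ := hw
        refine le_trans (Nat.mul_le_mul_left _ ?_) hA
        rw [hx, Nat.count_eq_card_filter_range, Nat.count_eq_card_filter_range]
        refine Finset.card_le_card fun v hv => ?_
        simp only [Finset.mem_filter, Finset.mem_range] at hv ⊢
        exact ⟨hv.1, hv.2.1, (heq w hw v hv.1 hw1 hv.2.2).mp hw2⟩
      · refine le_trans (Nat.mul_le_mul_left _ ?_) hB
        rw [hx, Nat.count_eq_card_filter_range, Nat.count_eq_card_filter_range]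
        refine Finset.card_le_card fun v hv => ?_
        simp only [Finset.mem_filter, Finset.mem_range] at hv ⊢
        exact ⟨hv.1, hv.2.1, fun hs => hw ⟨v, hv.1, hv.2.2, hs⟩⟩
    refine ⟨i', by omega, i, hin, h4, ?_⟩
    have h5 := hsplit i' i
    have h6 : F i ≤ T := by
      have h2 := hsplit 0 i
      change T = F i + _ at h2
      omega
    omega

/-- Whether the label of the vertex `u` belongs to an interval. -/
def insideExpr (u : ℕ) (lo hi : Expr) : Expr :=
  .sub (.lt (qubitOf 7 u) hi) (.lt (qubitOf 7 u) lo)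

lemma insideExpr_eval (M : Memory) (u : ℕ) (lo hi : Expr) :
    (insideExpr u lo hi).eval M ≠ 0 ↔
      Inside (fun w => M 7 w 0) (lo.eval M) (hi.eval M) (M u 0 0) := by
  simp only [insideExpr, Expr.eval, qubitOf_eval, Inside]
  by_cases h : M 7 (M u 0 0) 0 < hi.eval M <;> by_cases h' : M 7 (M u 0 0) 0 < lo.eval M <;>
    (simp [h, h']; try omega)

/-- Count the vertices inside and outside of the current interval of labels. -/
def countSides : Prog :=
  .seq (.assign 8 (.const 2) (.const 0) (.const 0))
    (.seq (.assign 8 (.const 3) (.const 0) (.const 0))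
      (.loop 13 (cell 0 0) (.ite (qubitOf 2 13) .skip
        (.ite (insideExpr 13 (cell 11 0) (cell 12 0))
          (.assign 8 (.const 2) (.const 0) (.add (cell 8 2) (.const 1)))
          (.assign 8 (.const 3) (.const 0) (.add (cell 8 3) (.const 1)))))))

/-- Record the current interval of labels if it balances the two sides. -/
def tryInterval : Prog :=
  .seq countSides
    (.ite (.add
        (.lt (.add (cell 0 0) (cell 0 0)) (.add (cell 8 2) (.add (cell 8 2) (cell 8 2))))
        (.lt (.add (cell 0 0) (cell 0 0)) (.add (cell 8 3) (.add (cell 8 3) (cell 8 3)))))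
      .skip
      (.seq (.assign 8 (.const 4) (.const 0) (cell 11 0))
        (.assign 8 (.const 5) (.const 0) (cell 12 0))))

/-- Search for a balancing interval of labels. -/
def findInterval : Prog :=
  .loop 11 (.add (cell 0 0) (.const 1)) (.loop 12 (.add (cell 0 0) (.const 1)) tryInterval)

lemma countSides_run (M : Memory) {lo hi : ℕ} (hlo : M 11 0 0 = lo) (hhi : M 12 0 0 = hi) :
    countSides.run M 8 2 0 = Nat.count (fun v => M 2 v 0 = 0 ∧
      Inside (fun w => M 7 w 0) lo hi v) (M 0 0 0) ∧
    countSides.run M 8 3 0 = Nat.count (fun v => M 2 v 0 = 0 ∧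
      ¬ Inside (fun w => M 7 w 0) lo hi v) (M 0 0 0) ∧
    countSides.run M 8 4 0 = M 8 4 0 ∧ countSides.run M 8 5 0 = M 8 5 0 := by
  have key := run_loop_induct (a := 13) (e := cell 0 0) (M := (M.set 8 2 0 0).set 8 3 0 0)
    (c := .ite (qubitOf 2 13) .skip
        (.ite (insideExpr 13 (cell 11 0) (cell 12 0))
          (.assign 8 (.const 2) (.const 0) (.add (cell 8 2) (.const 1)))
          (.assign 8 (.const 3) (.const 0) (.add (cell 8 3) (.const 1)))))
    (fun k M' => (M' 2 = M 2 ∧ M' 7 = M 7 ∧ M' 11 = M 11 ∧ M' 12 = M 12) ∧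
      M' 8 2 0 = Nat.count (fun v => M 2 v 0 = 0 ∧ Inside (fun w => M 7 w 0) lo hi v) k ∧
      M' 8 3 0 = Nat.count (fun v => M 2 v 0 = 0 ∧ ¬ Inside (fun w => M 7 w 0) lo hi v) k ∧
      M' 8 4 0 = M 8 4 0 ∧ M' 8 5 0 = M 8 5 0)
    ⟨⟨rfl, rfl, rfl, rfl⟩, by simp [Memory.set], by simp [Memory.set], by simp [Memory.set],
      by simp [Memory.set]⟩ ?_
  · exact key.2
  · rintro k - M' ⟨⟨h2, h7, h11, h12⟩, c2, c3, c4, c5⟩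
    have n2 : M'.set 13 0 0 k 2 = M 2 := by rw [Memory.set_ne _ (by norm_num), h2]
    have n7 : M'.set 13 0 0 k 7 = M 7 := by rw [Memory.set_ne _ (by norm_num), h7]
    have n11 : M'.set 13 0 0 k 11 = M 11 := by rw [Memory.set_ne _ (by norm_num), h11]
    have n12 : M'.set 13 0 0 k 12 = M 12 := by rw [Memory.set_ne _ (by norm_num), h12]
    have n8 : M'.set 13 0 0 k 8 = M' 8 := by rw [Memory.set_ne _ (by norm_num)]
    have n13 : M'.set 13 0 0 k 13 0 0 = k := Memory.set_self _ _ _ _ _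
    set M₁ := M'.set 13 0 0 k
    refine ⟨⟨?_, ?_, ?_, ?_⟩, ?_⟩
    · rw [run_of_not_writes _ (by decide), n2]
    · rw [run_of_not_writes _ (by decide), n7]
    · rw [run_of_not_writes _ (by decide), n11]
    · rw [run_of_not_writes _ (by decide), n12]
    have he : (qubitOf 2 13).eval M₁ = M 2 k 0 := by rw [qubitOf_eval, n2, n13]
    have hi' := insideExpr_eval M₁ 13 (cell 11 0) (cell 12 0)
    rw [cell_eval, cell_eval, n7, n11, n12, n13, hlo, hhi] at hi'
    rw [Prog.run, he, Nat.count_succ, Nat.count_succ]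
    by_cases hk : M 2 k 0 = 0
    · rw [if_neg (not_not.mpr hk), Prog.run]
      by_cases hin : Inside (fun w => M 7 w 0) lo hi k
      · rw [if_pos (hi'.mpr hin), if_pos ⟨hk, hin⟩, if_neg (fun h => h.2 hin)]
        simp [Prog.run, Expr.eval, cell_eval, Memory.set, n8, c2, c3, c4, c5]
      · rw [if_neg (fun h => hin (hi'.mp h)), if_neg (fun h => hin h.2), if_pos ⟨hk, hin⟩]
        simp [Prog.run, Expr.eval, cell_eval, Memory.set, n8, c2, c3, c4, c5]
    · rw [if_pos hk, if_neg (fun h => hk h.1), if_neg (fun h => hk h.1)]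
      simp [Prog.run, n8, c2, c3, c4, c5]

lemma tryInterval_run (M : Memory) {lo hi : ℕ} (hlo : M 11 0 0 = lo) (hhi : M 12 0 0 = hi) :
    (IsBalanced (M 0 0 0) (fun v => M 2 v 0) (fun v => M 7 v 0) lo hi →
      tryInterval.run M 8 4 0 = lo ∧ tryInterval.run M 8 5 0 = hi) ∧
    (¬ IsBalanced (M 0 0 0) (fun v => M 2 v 0) (fun v => M 7 v 0) lo hi →
      tryInterval.run M 8 4 0 = M 8 4 0 ∧ tryInterval.run M 8 5 0 = M 8 5 0) := by
  obtain ⟨c2, c3, c4, c5⟩ := countSides_run M hlo hhi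
  have n0 : countSides.run M 0 = M 0 := run_of_not_writes _ (by decide) _
  have n11 : countSides.run M 11 = M 11 := run_of_not_writes _ (by decide) _
  have n12 : countSides.run M 12 = M 12 := run_of_not_writes _ (by decide) _
  rw [tryInterval, Prog.run]
  set M₁ := countSides.run M
  have he : (Expr.add
        (.lt (.add (cell 0 0) (cell 0 0)) (.add (cell 8 2) (.add (cell 8 2) (cell 8 2))))
        (.lt (.add (cell 0 0) (cell 0 0)) (.add (cell 8 3) (.add (cell 8 3) (cell 8 3))))).eval M₁
      = 0 ↔ IsBalanced (M 0 0 0) (fun v => M 2 v 0) (fun v => M 7 v 0) lo hi := by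
    simp only [Expr.eval, cell_eval, n0, c2, c3, IsBalanced]
    split_ifs <;> simp <;> omega
  rw [Prog.run]
  constructor
  · intro hb
    rw [if_neg (not_not.mpr (he.mpr hb))]
    simp [Prog.run, Expr.eval, cell_eval, Memory.set, n11, n12, hlo, hhi]
  · intro hb
    rw [if_pos (fun h => hb (he.mp h))]
    exact ⟨c4, c5⟩

/-- Every balanced interval overwrites the record and unbalanced ones leave it alone, so after the
first success the record is always balanced. The loops run up to `n` inclusive, hence the bound `n +
1`. -/
lemma findInterval_run (M : Memory)
    (hex : ∃ lo ≤ M 0 0 0, ∃ hi ≤ M 0 0 0,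
      IsBalanced (M 0 0 0) (fun v => M 2 v 0) (fun v => M 7 v 0) lo hi) :
    IsBalanced (M 0 0 0) (fun v => M 2 v 0) (fun v => M 7 v 0) (findInterval.run M 8 4 0)
      (findInterval.run M 8 5 0) := by
  set B := IsBalanced (M 0 0 0) (fun v => M 2 v 0) (fun v => M 7 v 0) with hB
  have key := run_loop_induct (a := 11) (e := .add (cell 0 0) (.const 1)) (M := M)
    (c := .loop 12 (.add (cell 0 0) (.const 1)) tryInterval)
    (fun k M' => (M' 0 = M 0 ∧ M' 2 = M 2 ∧ M' 7 = M 7) ∧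
      ((∃ lo < k, ∃ hi ≤ M 0 0 0, B lo hi) → B (M' 8 4 0) (M' 8 5 0)))
    ⟨⟨rfl, rfl, rfl⟩, by simp⟩ ?_
  · obtain ⟨lo, hlo, hi, hhi, h⟩ := hex
    exact key.2 ⟨lo, Nat.lt_succ_of_le hlo, hi, hhi, h⟩
  rintro k - M₁ ⟨⟨h0, h2, h7⟩, h8⟩
  have hs : ∀ a, a ≠ 11 → M₁.set 11 0 0 k a = M₁ a := fun a ha => Memory.set_ne _ ha _ _ _
  have key' := run_loop_induct (a := 12) (e := .add (cell 0 0) (.const 1)) (M := M₁.set 11 0 0 k)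
    (c := tryInterval)
    (fun l M' => (M' 0 = M 0 ∧ M' 2 = M 2 ∧ M' 7 = M 7 ∧ M' 11 0 0 = k) ∧
      ((∃ lo hi, (lo < k ∧ hi ≤ M 0 0 0 ∨ lo = k ∧ hi < l) ∧ B lo hi) →
        B (M' 8 4 0) (M' 8 5 0))) ⟨⟨?_, ?_, ?_, ?_⟩, ?_⟩ ?_
  · have e : (Expr.add (cell 0 0) (.const 1)).eval (M₁.set 11 0 0 k) = M 0 0 0 + 1 := by
      simp only [Expr.eval, cell_eval, hs 0 (by norm_num), h0]
    rw [e] at key'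
    obtain ⟨⟨a0, a2, a7, -⟩, hb⟩ := key'
    refine ⟨⟨a0, a2, a7⟩, ?_⟩
    rintro ⟨lo, hlo, hi, hhi, h⟩
    exact hb ⟨lo, hi, by omega, h⟩
  · rw [hs 0 (by norm_num), h0]
  · rw [hs 2 (by norm_num), h2]
  · rw [hs 7 (by norm_num), h7]
  · exact Memory.set_self _ _ _ _ _
  · rintro ⟨lo, hi, h, hb⟩
    rw [hs 8 (by norm_num)]
    exact h8 ⟨lo, by omega, hi, by omega, hb⟩
  · rintro l - M₂ ⟨⟨a0, a2, a7, a11⟩, hb⟩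
    have hs : ∀ a, a ≠ 12 → M₂.set 12 0 0 l a = M₂ a := fun a ha => Memory.set_ne _ ha _ _ _
    obtain ⟨t1, t2⟩ := tryInterval_run (M₂.set 12 0 0 l) (lo := k) (hi := l)
      (by rw [hs 11 (by norm_num), a11]) (Memory.set_self _ _ _ _ _)
    rw [hs 0 (by norm_num), hs 2 (by norm_num), hs 7 (by norm_num), a0, a2, a7, ← hB] at t1 t2
    rw [hs 8 (by norm_num)] at t2
    refine ⟨⟨?_, ?_, ?_, ?_⟩, ?_⟩
    · rw [run_of_not_writes _ (by decide), hs 0 (by norm_num), a0]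
    · rw [run_of_not_writes _ (by decide), hs 2 (by norm_num), a2]
    · rw [run_of_not_writes _ (by decide), hs 7 (by norm_num), a7]
    · rw [run_of_not_writes _ (by decide), hs 11 (by norm_num), a11]
    · rintro ⟨lo, hi, h, hbal⟩
      by_cases hkl : B k l
      · rw [(t1 hkl).1, (t1 hkl).2]; exact hkl
      · rw [(t2 hkl).1, (t2 hkl).2]
        refine hb ⟨lo, hi, ?_, hbal⟩
        by_contra hcon
        have : lo = k ∧ hi = l := by omega
        exact hkl (this.1 ▸ this.2 ▸ hbal)

/-! ### The placement of the vertices -/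

/-- Number the vertices of the two sides and of the separator. -/
def placeVertices : Prog :=
  .seq (.assign 8 (.const 0) (.const 0) (.const 0))
    (.seq (.assign 8 (.const 1) (.const 0) (.const 0))
      (.loop 11 (cell 0 0)
        (.seq (.assign 4 (cell 11 0) (.const 0) (cell 0 0))
          (.seq (.assign 5 (cell 11 0) (.const 0) (cell 0 0))
            (.seq (.assign 6 (cell 11 0) (.const 0) (cell 0 0))
              (.ite (qubitOf 2 11)
                (.seq (.assign 4 (cell 11 0) (.const 0) (cell 8 0))
                  (.seq (.assign 8 (.const 0) (.const 0) (.add (cell 8 0) (.const 1)))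
                    (.seq (.assign 6 (cell 11 0) (.const 0) (cell 8 1))
                      (.assign 8 (.const 1) (.const 0) (.add (cell 8 1) (.const 1))))))
                (.ite (insideExpr 11 (cell 8 4) (cell 8 5))
                  (.seq (.assign 4 (cell 11 0) (.const 0) (cell 8 0))
                    (.assign 8 (.const 0) (.const 0) (.add (cell 8 0) (.const 1))))
                  (.seq (.assign 5 (cell 11 0) (.const 0) (cell 8 1))
                    (.assign 8 (.const 1) (.const 0) (.add (cell 8 1) (.const 1)))))))))))

/-- The vertices placed on device `0`. -/
def OnA (M : Memory) (v : ℕ) : Prop :=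
  M 2 v 0 ≠ 0 ∨ Inside (fun w => M 7 w 0) (M 8 4 0) (M 8 5 0) v

/-- The vertices placed on device `1`, copies included. -/
def OnB (M : Memory) (v : ℕ) : Prop :=
  M 2 v 0 ≠ 0 ∨ ¬ Inside (fun w => M 7 w 0) (M 8 4 0) (M 8 5 0) v

instance (M : Memory) : DecidablePred (OnA M) := fun _ => inferInstanceAs (Decidable (_ ∨ _))

instance (M : Memory) : DecidablePred (OnB M) := fun _ => inferInstanceAs (Decidable (_ ∨ _))

/-- The qubit of a vertex is the number of earlier vertices on the same device, separator copies
included on device 1. The value `n`, at least the number of qubits, stands for absence. -/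
lemma placeVertices_run (M : Memory) : ∀ v < M 0 0 0,
    placeVertices.run M 4 v 0 = (if OnA M v then Nat.count (OnA M) v else M 0 0 0) ∧
    placeVertices.run M 5 v 0 = (if OnA M v then M 0 0 0 else Nat.count (OnB M) v) ∧
    placeVertices.run M 6 v 0 = (if M 2 v 0 ≠ 0 then Nat.count (OnB M) v else M 0 0 0) := by
  refine (run_loop_induct (a := 11) (e := cell 0 0) (M := (M.set 8 0 0 0).set 8 1 0 0)
    (fun k M' => (M' 0 = M 0 ∧ M' 2 = M 2 ∧ M' 7 = M 7 ∧ M' 8 4 0 = M 8 4 0 ∧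
      M' 8 5 0 = M 8 5 0 ∧ M' 8 0 0 = Nat.count (OnA M) k ∧ M' 8 1 0 = Nat.count (OnB M) k) ∧
      ∀ v < k, M' 4 v 0 = (if OnA M v then Nat.count (OnA M) v else M 0 0 0) ∧
        M' 5 v 0 = (if OnA M v then M 0 0 0 else Nat.count (OnB M) v) ∧
        M' 6 v 0 = (if M 2 v 0 ≠ 0 then Nat.count (OnB M) v else M 0 0 0))
    (by simp [Memory.set_ne, Memory.set_self]; simp [Memory.set]) ?_).2
  rintro k - M' ⟨⟨h0, h2, h7, h4, h5, hA, hB⟩, h⟩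
  have hs : ∀ a, a ≠ 11 → M'.set 11 0 0 k a = M' a := fun a ha => Memory.set_ne _ ha _ _ _
  have n0 := (hs 0 (by norm_num)).trans h0
  have n2 := (hs 2 (by norm_num)).trans h2
  have n7 := (hs 7 (by norm_num)).trans h7
  have n8 := hs 8 (by norm_num)
  have n11 : M'.set 11 0 0 k 11 0 0 = k := Memory.set_self _ _ _ _ _
  have hs4 := hs 4 (by norm_num)
  have hs5 := hs 5 (by norm_num)
  have hs6 := hs 6 (by norm_num)
  set M₁ := M'.set 11 0 0 k
  have hrun : ∀ (c : Prog), Prog.run (.seq (.assign 4 (cell 11 0) (.const 0) (cell 0 0))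
      (.seq (.assign 5 (cell 11 0) (.const 0) (cell 0 0))
        (.seq (.assign 6 (cell 11 0) (.const 0) (cell 0 0)) c))) M₁ =
      c.run (((M₁.set 4 k 0 (M 0 0 0)).set 5 k 0 (M 0 0 0)).set 6 k 0 (M 0 0 0)) := by
    intro c
    simp [Prog.run, Expr.eval, cell_eval, Memory.set_ne, n0, n11]
  rw [hrun]
  set M₂ := ((M₁.set 4 k 0 (M 0 0 0)).set 5 k 0 (M 0 0 0)).set 6 k 0 (M 0 0 0) with hM₂
  have ht : ∀ a, a ≠ 4 → a ≠ 5 → a ≠ 6 → M₂ a = M₁ a := fun a h4 h5 h6 => by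
    rw [hM₂, Memory.set_ne _ h6, Memory.set_ne _ h5, Memory.set_ne _ h4]
  have m0 := (ht 0 (by norm_num) (by norm_num) (by norm_num)).trans n0
  have m2 := (ht 2 (by norm_num) (by norm_num) (by norm_num)).trans n2
  have m7 := (ht 7 (by norm_num) (by norm_num) (by norm_num)).trans n7
  have m8 := (ht 8 (by norm_num) (by norm_num) (by norm_num)).trans n8
  have m11 : M₂ 11 0 0 = k := by
    rw [ht 11 (by norm_num) (by norm_num) (by norm_num), n11]
  have m4 : ∀ v, M₂ 4 v 0 = if v = k then M 0 0 0 else M' 4 v 0 := fun v => by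
    rw [← hs4]; simp [M₂, Memory.set]
  have m5 : ∀ v, M₂ 5 v 0 = if v = k then M 0 0 0 else M' 5 v 0 := fun v => by
    rw [← hs5]; simp [M₂, Memory.set]
  have m6 : ∀ v, M₂ 6 v 0 = if v = k then M 0 0 0 else M' 6 v 0 := fun v => by
    rw [← hs6]; simp [M₂, Memory.set]
  clear_value M₂
  have he : (qubitOf 2 11).eval M₂ = M 2 k 0 := by rw [qubitOf_eval, m2, m11]
  have hi := insideExpr_eval M₂ 11 (cell 8 4) (cell 8 5)
  rw [cell_eval, cell_eval, m7, m8, m11, h4, h5] at hi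
  have hlt : ∀ v < k + 1, v = k ∨ v ≠ k ∧ v < k := fun v hv => by omega
  have hframe : ∀ a, a = 0 ∨ a = 2 ∨ a = 7 → ∀ c : Prog, c.writes a = false → c.run M₂ a = M a := by
    intro a ha c hc
    rw [run_of_not_writes c hc]
    rcases ha with rfl | rfl | rfl <;> assumption
  refine ⟨⟨hframe 0 (by simp) _ (by decide), hframe 2 (by simp) _ (by decide),
    hframe 7 (by simp) _ (by decide), ?_⟩, ?_⟩ <;>
    rw [Prog.run, he]
  · rw [Nat.count_succ, Nat.count_succ]
    by_cases hk : M 2 k 0 ≠ 0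
    · rw [if_pos hk, if_pos (show OnA M k from Or.inl hk), if_pos (show OnB M k from Or.inl hk)]
      simp [Prog.run, Expr.eval, cell_eval, Memory.set, m8, h4, h5, hA, hB]
    · rw [if_neg hk, Prog.run]
      by_cases hin : Inside (fun w => M 7 w 0) (M 8 4 0) (M 8 5 0) k
      · rw [if_pos (hi.mpr hin), if_pos (show OnA M k from Or.inr hin),
          if_neg (show ¬ OnB M k from fun h => h.elim hk fun h => h hin)]
        simp [Prog.run, Expr.eval, cell_eval, Memory.set, m8, h4, h5, hA, hB]
      · rw [if_neg (fun h => hin (hi.mp h)), if_neg (show ¬ OnA M k from fun h => h.elim hk hin),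
          if_pos (show OnB M k from Or.inr hin)]
        simp [Prog.run, Expr.eval, cell_eval, Memory.set, m8, h4, h5, hA, hB]
  · intro v hv
    by_cases hk : M 2 k 0 ≠ 0
    · have hOA : OnA M k := Or.inl hk
      rw [if_pos hk]
      rcases hlt v hv with rfl | ⟨hne, hv⟩
      · simp [Prog.run, Expr.eval, cell_eval, Memory.set, m5, m8, m11, hA, hB, hOA, hk]
      · simpa [Prog.run, Expr.eval, cell_eval, Memory.set, m4, m5, m6, m11, hne] using h v hv
    · rw [if_neg hk, Prog.run]
      rw [not_not] at hk
      by_cases hin : Inside (fun w => M 7 w 0) (M 8 4 0) (M 8 5 0) k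
      · have hOA : OnA M k := Or.inr hin
        rw [if_pos (hi.mpr hin)]
        rcases hlt v hv with rfl | ⟨hne, hv⟩
        · simp [Prog.run, Expr.eval, cell_eval, Memory.set, m5, m6, m8, m11, hA, hOA, hk]
        · simpa [Prog.run, Expr.eval, cell_eval, Memory.set, m4, m5, m6, m11, hne] using h v hv
      · have hOA : ¬ OnA M k := fun h => h.elim (fun h => h hk) hin
        rw [if_neg (fun h => hin (hi.mp h))]
        rcases hlt v hv with rfl | ⟨hne, hv⟩
        · simp [Prog.run, Expr.eval, cell_eval, Memory.set, m4, m6, m8, m11, hB, hOA, hk]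
        · simpa [Prog.run, Expr.eval, cell_eval, Memory.set, m4, m5, m6, m11, hne] using h v hv

/-! ### The whole classical part -/

/-- The classical part of the program. -/
def preprocess (c : ℕ) : Prog :=
  .seq (budget c) (.seq initLabels (.seq mergeLabels (.seq findInterval placeVertices)))

/-- The memory holds the input. -/
structure IsInput {n : ℕ} (p K : ℕ) (G : SimpleGraph (Fin n)) (S : Finset (Fin n)) (M : Memory) :
    Prop where
  size : M 0 0 0 = n
  depth : M 0 1 0 = p
  accuracy : M 0 2 0 = K
  adj : ∀ u v : Fin n, M 1 u v ≠ 0 ↔ G.Adj u v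
  sep : ∀ u : Fin n, u ∈ S → M 2 u 0 = 1
  not_sep : ∀ u : Fin n, u ∉ S → M 2 u 0 = 0

lemma isInput_inputMemory {n : ℕ} (p K : ℕ) (G : SimpleGraph (Fin n)) (S : Finset (Fin n)) :
    IsInput p K G S (inputMemory p K G S) where
  size := by simp [inputMemory]
  depth := by simp [inputMemory]
  accuracy := by simp [inputMemory]
  adj u v := by
    simp only [inputMemory, one_ne_zero, false_and, if_false, if_true, ne_eq, ite_eq_right_iff,
      imp_false, not_not]
    exact ⟨fun ⟨_, _, h1, h2, h⟩ => Fin.ext h1 ▸ Fin.ext h2 ▸ h, fun h => ⟨u, v, rfl, rfl, h⟩⟩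
  sep u hu := by
    have : ∃ u' ∈ S, (u' : ℕ) = u := ⟨u, hu, rfl⟩
    simp [inputMemory, if_pos this]
  not_sep u hu := by
    have : ¬ ∃ u' ∈ S, (u' : ℕ) = u := fun ⟨_, h1, h2⟩ => hu (Fin.ext h2 ▸ h1)
    simp [inputMemory, this]

lemma IsInput.of_eq {n p K : ℕ} {G : SimpleGraph (Fin n)} {S : Finset (Fin n)} {M M' : Memory}
    (h : IsInput p K G S M) (hM : ∀ a < 3, M' a = M a) : IsInput p K G S M' where
  size := by rw [hM 0 (by norm_num), h.size]
  depth := by rw [hM 0 (by norm_num), h.depth]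
  accuracy := by rw [hM 0 (by norm_num), h.accuracy]
  adj u v := by rw [hM 1 (by norm_num), h.adj]
  sep u hu := by rw [hM 2 (by norm_num), h.sep u hu]
  not_sep u hu := by rw [hM 2 (by norm_num), h.not_sep u hu]

lemma IsInput.mem_sep {n p K : ℕ} {G : SimpleGraph (Fin n)} {S : Finset (Fin n)} {M : Memory}
    (h : IsInput p K G S M) (u : Fin n) : M 2 u 0 ≠ 0 ↔ u ∈ S := by
  by_cases hu : u ∈ S
  · simp [h.sep u hu, hu]
  · simp [h.not_sep u hu, hu]

lemma IsInput.count_sep {n p K : ℕ} {G : SimpleGraph (Fin n)} {S : Finset (Fin n)} {M : Memory}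
    (h : IsInput p K G S M) : Nat.count (fun v => M 2 v 0 ≠ 0) n = S.card := by
  rw [← card_filter_eq_count]
  congr 1
  ext u
  simp [h.mem_sep]

/-- Counting is injective on the vertices of one device and stays below the total, so the addresses
are distinct and fit. Adjacent outer vertices carry equal labels and hence fall on the same side of
the interval, which gives `no_edge`. -/
lemma placed_layout {n m p K : ℕ} {G : SimpleGraph (Fin n)} {S : Finset (Fin n)} {M : Memory}
    (h : IsInput p K G S M) (hm : m ≤ n) (hA : Nat.count (OnA M) n ≤ m)
    (hB : Nat.count (OnB M) n ≤ m)
    (hl : ∀ u v : Fin n, u ∉ S → v ∉ S → G.Adj u v → M 7 u 0 = M 7 v 0) :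
    Nonempty (Layout p m G S (placeVertices.run M)) := by
  have hrun := placeVertices_run M
  rw [h.size] at hrun
  have h' : IsInput p K G S (placeVertices.run M) := h.of_eq (run_below _ (by decide) M)
  have hlA : ∀ u : Fin n, OnA M u → Nat.count (OnA M) u < m := fun u hu =>
    lt_of_lt_of_le (Nat.count_strict_mono hu u.2) hA
  have hlB : ∀ u : Fin n, OnB M u → Nat.count (OnB M) u < m := fun u hu =>
    lt_of_lt_of_le (Nat.count_strict_mono hu u.2) hB
  have hAB : ∀ v, ¬ OnA M v → OnB M v := fun v hv => Or.inr fun hi => hv (Or.inr hi)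
  have hSA : ∀ u ∈ S, OnA M (u : Fin n) := fun u hu => Or.inl ((h.mem_sep u).mpr hu)
  have hSB : ∀ u ∈ S, OnB M (u : Fin n) := fun u hu => Or.inl ((h.mem_sep u).mpr hu)
  let loc : Fin n → Qubit m := fun u =>
    if hu : OnA M u then (false, ⟨_, hlA u hu⟩) else (true, ⟨_, hlB u (hAB u hu)⟩)
  let cop : Fin n → Qubit m := fun u =>
    if hu : OnB M u then (true, ⟨_, hlB u hu⟩) else loc u
  have locA : ∀ (u : Fin n) (hu : OnA M u), loc u = (false, ⟨_, hlA u hu⟩) := fun u hu =>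
    dif_pos hu
  have locB : ∀ (u : Fin n) (hu : ¬ OnA M u), loc u = (true, ⟨_, hlB u (hAB u hu)⟩) := fun u hu =>
    dif_neg hu
  have copB : ∀ (u : Fin n) (hu : OnB M u), cop u = (true, ⟨_, hlB u hu⟩) := fun u hu =>
    dif_pos hu
  have devA : ∀ u : Fin n, (loc u).1 = false ↔ OnA M u := fun u => by
    by_cases hu : OnA M u
    · simp [locA u hu, hu]
    · simp [locB u hu, hu]
  have devB : ∀ u : Fin n, (loc u).1 = true ↔ ¬ OnA M u := fun u => by
    rw [← devA, Bool.not_eq_false]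
  clear_value loc cop
  refine ⟨⟨loc, cop, h'.size, h'.depth, h'.adj, h'.sep, h'.not_sep, ?_, ?_, ?_, ?_, ?_, ?_, ?_, ?_,
    ?_, ?_, ?_, ?_⟩⟩
  · intro u hu
    rw [devA] at hu
    rw [(hrun u u.2).1, if_pos hu, locA u hu]
  · intro u hu
    rw [devB] at hu
    rwa [(hrun u u.2).1, if_neg hu]
  · intro u hu
    rw [devB] at hu
    rw [(hrun u u.2).2.1, if_neg hu, locB u hu]
  · intro u hu
    rw [devA] at hu
    rwa [(hrun u u.2).2.1, if_pos hu]
  · intro u hu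
    rw [(hrun u u.2).2.2, if_pos ((h.mem_sep u).mpr hu), copB u (hSB u hu)]
  · intro u hu
    rwa [(hrun u u.2).2.2, if_neg (fun hh => hu ((h.mem_sep u).mp hh))]
  · exact fun u hu => (devA u).mpr (hSA u hu)
  · exact fun u hu => by rw [copB u (hSB u hu)]
  · intro u v huv
    by_cases hu : OnA M u <;> by_cases hv : OnA M v
    · rw [locA u hu, locA v hv] at huv
      simp only [Prod.mk.injEq, true_and, Fin.mk.injEq] at huv
      exact Fin.ext (Nat.count_injective hu hv huv)
    · rw [locA u hu, locB v hv] at huv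
      simp at huv
    · rw [locB u hu, locA v hv] at huv
      simp at huv
    · rw [locB u hu, locB v hv] at huv
      simp only [Prod.mk.injEq, true_and, Fin.mk.injEq] at huv
      exact Fin.ext (Nat.count_injective (hAB u hu) (hAB v hv) huv)
  · intro u hu v hv huv
    rw [copB u (hSB u hu), copB v (hSB v hv)] at huv
    simp only [Prod.mk.injEq, true_and, Fin.mk.injEq] at huv
    exact Fin.ext (Nat.count_injective (hSB u hu) (hSB v hv) huv)
  · intro u hu v huv
    rw [copB u (hSB u hu)] at huv
    have hv : ¬ OnA M v := (devB v).mp (by rw [← huv])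
    rw [locB v hv] at huv
    simp only [Prod.mk.injEq, true_and, Fin.mk.injEq] at huv
    have := Fin.ext (Nat.count_injective (hSB u hu) (hAB v hv) huv)
    exact hv (this ▸ hSA u hu)
  · intro u v hu hv hvS hadj
    rw [devB] at hu
    rw [devA] at hv
    have huS : u ∉ S := fun hS => hu (hSA u hS)
    have := hl u v huS hvS hadj
    rcases hv with hv | hv
    · exact hvS ((h.mem_sep v).mp hv)
    · refine hu (Or.inr ?_)
      simp only [Inside] at hv ⊢
      rwa [this]

theorem preprocess_run (c : ℕ) {n p K : ℕ} {G : SimpleGraph (Fin n)} {S : Finset (Fin n)}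
    {M : Memory} (h : IsInput p K G S M) (hK : 1 ≤ K) (hS : IsBalancedSeparator (2 / 3) G S)
    (hcard : (S.card : ℝ) ≤ n / 6) :
    Nonempty (Layout p (5 * n / 6) G S ((preprocess c).run M)) ∧
      ∃ j, HasBudget ((preprocess c).run M) (2 ^ c * 4 ^ (p * (S.card + 1)) * 4 ^ j)
        (c + p * (S.card + 1) + 2 * j) ∧ K ≤ 2 ^ j ∧ 2 ^ j ≤ 2 * K := by
  obtain ⟨A, B, hdisj, hunion, hedge, hA, hB⟩ := hS
  obtain ⟨e, j, he, hb, hj, hj'⟩ := budget_run c (M := M) (by rw [h.accuracy]; exact hK)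
  rw [h.size, h.depth, h.count_sep] at he
  rw [h.accuracy] at hj hj'
  subst he
  have hcard' : 6 * S.card ≤ n := by
    have : (6 * S.card : ℝ) ≤ n := by linarith
    exact_mod_cast this
  have hA' : 3 * A.card ≤ 2 * n := by
    have : (3 * A.card : ℝ) ≤ 2 * n := by linarith
    exact_mod_cast this
  have hB' : 3 * B.card ≤ 2 * n := by
    have : (3 * B.card : ℝ) ≤ 2 * n := by linarith
    exact_mod_cast this
  have f1 : ∀ a < 3, (budget c).run M a = M a :=
    run_below _ (fun a ha => by interval_cases a <;> rfl) M
  rw [show (preprocess c).run M = placeVertices.run (findInterval.run (mergeLabels.run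
    (initLabels.run ((budget c).run M)))) from rfl]
  set M₁ := (budget c).run M
  have h1 := h.of_eq f1
  clear_value M₁
  have f2 : ∀ a < 3, initLabels.run M₁ a = M₁ a := run_below _ (by decide) M₁
  have l2 := initLabels_run M₁
  have b2 : initLabels.run M₁ 3 = M₁ 3 := run_of_not_writes _ (by decide) _
  set M₂ := initLabels.run M₁
  have h2 := h1.of_eq f2
  clear_value M₂
  rw [h1.size] at l2
  have f3 : ∀ a < 3, mergeLabels.run M₂ a = M₂ a := run_below _ (by decide) M₂
  have b3 : mergeLabels.run M₂ 3 = M₂ 3 := run_of_not_writes _ (by decide) _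
  classical
  let side : ℕ → Prop := fun v => ∃ u ∈ A, (u : ℕ) = v
  have hside : ∀ u : Fin n, side u ↔ u ∈ A := fun u =>
    ⟨fun ⟨_, h1, h2⟩ => Fin.ext h2 ▸ h1, fun h => ⟨u, h, rfl⟩⟩
  have hcompl : ∀ u : Fin n, u ∉ S ↔ u ∈ A ∨ u ∈ B := fun u => by
    rw [← Finset.mem_union, hunion, Finset.mem_compl]
  have l3 := mergeLabels_run (M := M₂) (side := side) ?_ ?_
  rotate_left
  · rw [h2.size]
    rintro u hu v hv ⟨e1, e2, e3⟩
    have e1' : G.Adj ⟨u, hu⟩ ⟨v, hv⟩ := (h2.adj _ _).mp e1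
    have e2' : (⟨u, hu⟩ : Fin n) ∉ S := fun hh => (h2.mem_sep _).mpr hh e2
    have e3' : (⟨v, hv⟩ : Fin n) ∉ S := fun hh => (h2.mem_sep _).mpr hh e3
    have d1 := hside ⟨u, hu⟩
    have d2 := hside ⟨v, hv⟩
    simp only at d1 d2
    rw [d1, d2]
    rw [hcompl] at e2' e3'
    constructor
    · exact fun hu' => e3'.resolve_right fun hv' => hedge _ hu' _ hv' e1'
    · exact fun hv' => e2'.resolve_right fun hu' => hedge _ hv' _ hu' e1'.symm
  · rw [h2.size]
    refine ⟨fun w hw => by rwa [l2 w hw], fun w hw w' hw' heq => ?_, fun _ _ _ _ h => h.elim⟩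
    rw [l2 w hw, l2 w' hw'] at heq
    rw [heq]
  rw [h2.size] at l3
  set M₃ := mergeLabels.run M₂
  have h3 := h2.of_eq f3
  clear_value M₃
  have hnot : ∀ u : Fin n, M₃ 2 u 0 = 0 ↔ u ∉ S := fun u => by
    rw [← h3.mem_sep, not_not]
  have hbal := findInterval_run M₃ ?_
  rotate_left
  · rw [h3.size]
    refine exists_isBalanced l3 ?_ ?_
    · rw [← card_filter_eq_count]
      refine le_trans (Nat.mul_le_mul_left _ (Finset.card_le_card ?_)) hA'
      intro u hu
      simp only [Finset.mem_filter, Finset.mem_univ, true_and] at hu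
      exact (hside u).mp hu.2
    · rw [← card_filter_eq_count]
      refine le_trans (Nat.mul_le_mul_left _ (Finset.card_le_card ?_)) hB'
      intro u hu
      simp only [Finset.mem_filter, Finset.mem_univ, true_and, hnot, hside, hcompl] at hu
      exact hu.1.resolve_left hu.2
  rw [h3.size] at hbal
  have f4 : ∀ a < 3, findInterval.run M₃ a = M₃ a := run_below _ (by decide) M₃
  have b4 : findInterval.run M₃ 3 = M₃ 3 := run_of_not_writes _ (by decide) _
  have l4 : findInterval.run M₃ 7 = M₃ 7 := run_of_not_writes _ (by decide) _
  set M₄ := findInterval.run M₃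
  have h4 := h3.of_eq f4
  clear_value M₄
  rw [← l4, ← f4 2 (by norm_num)] at hbal
  have b5 : placeVertices.run M₄ 3 = M₄ 3 := run_of_not_writes _ (by decide) _
  -- Each device holds `|S|` qubits for the separator and one side; `6 |S| ≤ n` and `3 · side ≤ 2n`
  -- give at most `5n/6`, also after rounding down.
  refine ⟨placed_layout h4 (by omega) ?_ ?_ ?_, j, ?_, hj, hj'⟩
  · have : Nat.count (OnA M₄) n = S.card + Nat.count (fun v => M₄ 2 v 0 = 0 ∧
        Inside (fun w => M₄ 7 w 0) (M₄ 8 4 0) (M₄ 8 5 0) v) n := by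
      rw [← h4.count_sep]
      exact count_eq_add n (fun v _ => by by_cases hv : M₄ 2 v 0 = 0 <;> simp [OnA, hv])
        (fun v _ h h' => h h'.1)
    have := hbal.1
    beta_reduce at this
    omega
  · have : Nat.count (OnB M₄) n = S.card + Nat.count (fun v => M₄ 2 v 0 = 0 ∧
        ¬ Inside (fun w => M₄ 7 w 0) (M₄ 8 4 0) (M₄ 8 5 0) v) n := by
      rw [← h4.count_sep]
      exact count_eq_add n (fun v _ => by by_cases hv : M₄ 2 v 0 = 0 <;> simp [OnB, hv])
        (fun v _ h h' => h h'.1)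
    have := hbal.2
    beta_reduce at this
    omega
  · intro u v hu hv hadj
    rw [l4]
    refine l3.eq u u.2 v v.2 ⟨(h2.adj u v).mpr hadj, ?_, ?_⟩
    · exact h2.not_sep u hu
    · exact h2.not_sep v hv
  · refine HasBudget.of_eq hb ?_
    exact b5.trans (b4.trans (b3.trans b2))

/-! ## The running time and the result -/

lemma sample_cost_le {M : Memory} {n p : ℕ} (hn : M 0 0 0 = n) (hp : M 0 1 0 = p) :
    1 + sample.cost M ≤ 100 * ((p + 1) * (n + 1) ^ 3) := by
  simp only [sample, accumulate, circuit, resetAll, resetQubit, xGate, zGate, prepare, layer,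
    copySeparator, openCopies, dephase, linearPhases, quadraticPhases, costGates, closeCopies,
    mixingGates, readOut, Prog.cost, cell_eval, hn, hp]
  -- Both sides become polynomials in `n` and `p`; with the monomials as atoms the comparison is
  -- linear.
  ring_nf
  omega

lemma preprocess_cost_le (c : ℕ) {M : Memory} {n p K : ℕ} (hn : M 0 0 0 = n) (hp : M 0 1 0 = p)
    (hK : M 0 2 0 = K) :
    (preprocess c).cost M ≤ 100 * ((p + 1) * (n + 1) ^ 3) + 100 * K := by
  simp only [preprocess, budget, quadrupleLayers, quadrupleVertices, quadruple, quadrupleAccuracy,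
    initLabels, mergeLabels, mergeEdge, unifyLabels, findInterval, tryInterval, countSides,
    placeVertices, Prog.cost, Expr.eval, cell_eval, hn, hp, hK]
  ring_nf
  omega

lemma estimate_cost_le {M : Memory} {n p N h : ℕ} (hn : M 0 0 0 = n) (hp : M 0 1 0 = p)
    (hM : HasBudget M N h) : estimate.cost M ≤ 2 + N * (100 * ((p + 1) * (n + 1) ^ 3)) + 2 * h := by
  have h1 := Nat.mul_le_mul_left N (sample_cost_le hn hp)
  simp only [estimate, Prog.cost, cell_eval, hM.1, hM.2]
  omega

lemma prob_initial (m : ℕ) (M : Memory) : (initial m M).prob = 1 := by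
  have h : ∀ x : Fin m → Bool, ‖(if x = fun _ => false then 1 else 0 : ℂ)‖ ^ 2 =
      if x = fun _ => false then (1 : ℝ) else 0 := fun x => by split_ifs <;> simp
  simp [Config.prob, initial, normSq, h]

/-- The program that fails with probability at most `2⁻ᶜ`. -/
def estimator (c : ℕ) : Prog := .seq (preprocess c) estimate

section

variable {n p K : ℕ} {G : SimpleGraph (Fin n)} {S : Finset (Fin n)}

lemma exec_estimator {m : ℕ} (c : ℕ) (E : Env n p) (s : Config m) :
    ∃ t ≤ s.time + (preprocess c).cost s.mem, (estimator c).exec E s =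
      estimate.exec E { s with mem := (preprocess c).run s.mem, time := t } := by
  obtain ⟨t, ht⟩ := exec_classical E (preprocess c) rfl s
  refine ⟨t, ?_, ?_⟩
  · exact (exec_time_le E (k := 3) (preprocess c) rfl s _
      (by rw [ht]; exact List.mem_singleton_self _)).2
  · rw [estimator, Prog.exec, ht, List.flatMap_singleton]

theorem successProb_estimator {c : ℕ} {δ ε : ℝ} (hc : 1 ≤ δ * 2 ^ c) (hε : 0 < ε)
    (hK : 1 ≤ ε * K) (hS : IsBalancedSeparator (2 / 3) G S) (hcard : (S.card : ℝ) ≤ n / 6)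
    (E : Env n p) (hf : ∀ x, |E.f x| ≤ 1) :
    1 - δ ≤ successProb ((estimator c).exec E (initial (5 * n / 6) (inputMemory p K G S)))
      (expectation E.f (qaoaState G E.γ E.β)) ε := by
  have hK0 : 1 ≤ K := by
    rcases Nat.eq_zero_or_pos K with rfl | h
    · norm_num at hK
    · exact h
  obtain ⟨⟨L⟩, j, hb, hj, -⟩ := preprocess_run c (isInput_inputMemory p K G S) hK0 hS hcard
  obtain ⟨t, -, ht⟩ := exec_estimator (m := 5 * n / 6) c E (initial _ (inputMemory p K G S))
  rw [ht]
  change successProb (estimate.exec E { initial _ (inputMemory p K G S) with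
    mem := (preprocess c).run (inputMemory p K G S), time := t }) _ _ ≥ _
  clear ht
  generalize (preprocess c).run (inputMemory p K G S) = M at L hb
  refine successProb_estimate (s := { initial _ (inputMemory p K G S) with mem := M, time := t })
    L (by omega) hf zero_le_one (prob_initial _ (inputMemory p K G S)) rfl hb.1 hb.2 ?_ hε ?_
  -- With `e = p (|S| + 1)`, this is `2^c · 4^e · 4^j · 2^(-e) = 2^(c + e + 2j)`.
  · rw [mul_comm (S.card + 1) p]
    generalize p * (S.card + 1) = e
    push_cast
    rw [one_div, inv_pow, pow_add, pow_add, pow_mul, show (4 : ℝ) ^ e = 2 ^ e * 2 ^ e by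
      rw [← mul_pow]; norm_num]
    field_simp
    norm_num
  · generalize p * (S.card + 1) = e
    have hj' : 1 ≤ ε * 2 ^ j := hK.trans (by
      have : (K : ℝ) ≤ 2 ^ j := by exact_mod_cast hj
      gcongr)
    have h1 : 1 ≤ (ε * 2 ^ j) ^ 2 := one_le_pow₀ hj'
    have h2 : 1 ≤ (δ * 2 ^ c) * (ε * 2 ^ j) ^ 2 := one_le_mul_of_one_le_of_one_le hc h1
    push_cast
    calc (2 : ℝ) ^ c * 4 ^ e * 4 ^ j = 2 ^ c * 4 ^ e * 4 ^ j * 1 := by ring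
      _ ≤ 2 ^ c * 4 ^ e * 4 ^ j * ((δ * 2 ^ c) * (ε * 2 ^ j) ^ 2) := by gcongr
      _ = δ * (ε * 2 ^ (c + e + 2 * j)) ^ 2 := by
        have h4 : ∀ k : ℕ, (4 : ℝ) ^ k = 2 ^ k * 2 ^ k := fun k => by
          rw [← mul_pow]; norm_num
        rw [h4, h4]
        ring

/-- The running time in terms of the parameters. -/
lemma time_le {c p n κ j K t : ℕ} (hp : 1 ≤ p) (hj : K ≤ 2 ^ j) (hj' : 2 ^ j ≤ 2 * K)
    (ht : t ≤ 100 * ((p + 1) * (n + 1) ^ 3) + 100 * K + (2 + 2 ^ c * 4 ^ (p * (κ + 1)) * 4 ^ j *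
      (100 * ((p + 1) * (n + 1) ^ 3)) + 2 * (c + p * (κ + 1) + 2 * j))) :
    t ≤ 4 ^ ((2 * p - 1) * (κ + 2)) * (1400 * 2 ^ c * (p * n + 1) ^ 3) * K ^ 2 := by
  have h4 : ∀ k : ℕ, 4 ^ k = 2 ^ (2 * k) := fun k => by
    rw [pow_mul]; norm_num
  -- A polynomial in `p n` cannot pay for the `p` layers when `n = 0`; the slack in the exponent, `p
  -- (κ + 1) + p ≤ (2p - 1)(κ + 2)`, does.
  have hp4 : p + 1 ≤ 4 ^ p := Nat.lt_pow_self (by norm_num)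
  have hn : n + 1 ≤ p * n + 1 := Nat.succ_le_succ (Nat.le_mul_of_pos_left _ hp)
  have hj4 : 4 ^ j ≤ 4 * K ^ 2 := by
    calc 4 ^ j = (2 ^ j) ^ 2 := by rw [h4, ← pow_mul, mul_comm]
      _ ≤ (2 * K) ^ 2 := Nat.pow_le_pow_left hj' 2
      _ = 4 * K ^ 2 := by ring
  have hexp : p * (κ + 1) + p ≤ (2 * p - 1) * (κ + 2) := by
    calc p * (κ + 1) + p = p * (κ + 2) := by ring
      _ ≤ _ := Nat.mul_le_mul_right _ (by omega)
  have hbound : 350 * ((2 ^ c * 4 ^ (p * (κ + 1)) * 4 ^ j) * ((p + 1) * (n + 1) ^ 3)) ≤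
      4 ^ ((2 * p - 1) * (κ + 2)) * (1400 * 2 ^ c * (p * n + 1) ^ 3) * K ^ 2 := by
    calc _ ≤ 350 * ((2 ^ c * 4 ^ (p * (κ + 1)) * (4 * K ^ 2)) * (4 ^ p * (p * n + 1) ^ 3)) := by
          gcongr
      _ = 4 ^ (p * (κ + 1) + p) * (1400 * 2 ^ c * (p * n + 1) ^ 3) * K ^ 2 := by
          rw [pow_add]; ring
      _ ≤ _ := by gcongr; norm_num
  -- With `N` samples and `W = (p + 1)(n + 1)³`, all of `W`, `K`, `h` and `1` are at most `N W`, so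
  -- the total is at most `304 N W`; `350` is a round bound.
  refine le_trans ?_ hbound
  have hW : 0 < (p + 1) * (n + 1) ^ 3 := by positivity
  generalize (p + 1) * (n + 1) ^ 3 = W at ht hW ⊢
  have hN : 2 ^ c * 4 ^ (p * (κ + 1)) * 4 ^ j = 2 ^ (c + 2 * (p * (κ + 1)) + 2 * j) := by
    rw [h4, h4, pow_add, pow_add]
  rw [hN] at ht ⊢
  have hh := (Nat.lt_two_pow_self (n := c + 2 * (p * (κ + 1)) + 2 * j)).le
  have hK : K ≤ 2 ^ (c + 2 * (p * (κ + 1)) + 2 * j) :=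
    hj.trans (Nat.pow_le_pow_right (by norm_num) (by omega))
  have hN1 : 0 < 2 ^ (c + 2 * (p * (κ + 1)) + 2 * j) := by positivity
  generalize 2 ^ (c + 2 * (p * (κ + 1)) + 2 * j) = N at ht hh hK hN1 ⊢
  have hNW : N ≤ N * W := Nat.le_mul_of_pos_right _ hW
  have hWN : W ≤ N * W := Nat.le_mul_of_pos_left _ hN1
  rw [show N * (100 * W) = 100 * (N * W) by ring] at ht
  omega

theorem time_estimator (c : ℕ) (hK : 1 ≤ K) (hp : 1 ≤ p) (hS : IsBalancedSeparator (2 / 3) G S)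
    (hcard : (S.card : ℝ) ≤ n / 6) (E : Env n p) :
    ∀ s ∈ (estimator c).exec E (initial (5 * n / 6) (inputMemory p K G S)),
      s.time ≤ 4 ^ ((2 * p - 1) * (S.card + 2)) * (1400 * 2 ^ c * (p * n + 1) ^ 3) * K ^ 2 := by
  have hin := isInput_inputMemory p K G S
  obtain ⟨-, j, hb, hj, hj'⟩ := preprocess_run c hin hK hS hcard
  obtain ⟨t, ht, hexec⟩ := exec_estimator (m := 5 * n / 6) c E (initial _ (inputMemory p K G S))
  intro s hs
  rw [hexec] at hs
  have hin' := hin.of_eq (run_below (preprocess c) (k := 3)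
    (fun a ha => by interval_cases a <;> rfl) _)
  have h1 := (exec_time_le E (k := 4) estimate (by decide) _ s hs).2
  have h2 := estimate_cost_le hin'.size hin'.depth hb
  have h3 := preprocess_cost_le c hin.size hin.depth hin.accuracy
  simp only [initial, zero_add] at h1 ht
  exact time_le hp hj hj' (h1.trans (add_le_add (ht.trans h3) h2))

end

end Hybrid

end

/-! ### The main theorem -/

theorem theorem3 (δ : ℝ) (hδ : 0 < δ) :
    ∃ (prog : Hybrid.Prog) (P : Polynomial ℕ),
      ∀ (n p : ℕ), 1 ≤ p →
      ∀ (G : SimpleGraph (Fin n)) (S : Finset (Fin n)),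
        IsBalancedSeparator (2 / 3) G S → (S.card : ℝ) ≤ n / 6 →
      ∀ (γ β : Fin p → ℝ) (f : (Fin n → Bool) → ℝ), (∀ x, f x ∈ Set.Icc (-1 : ℝ) 1) →
      ∀ ε : ℝ, 0 < ε → ε ≤ 1 →
      ∀ branches : List (Hybrid.Config (5 * n / 6)),
        branches = prog.exec ⟨γ, β, f⟩ (Hybrid.initial (5 * n / 6)
          (Hybrid.inputMemory p ⌈1 / ε⌉₊ G S)) →
        1 - δ ≤ Hybrid.successProb branches (expectation f (qaoaState G γ β)) ε ∧
        ∀ s ∈ branches, (s.time : ℝ) ≤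
          4 ^ ((2 * p - 1) * (S.card + 2)) * (P.eval (p * n) : ℕ) / ε ^ 2 := by
  obtain ⟨c, hc⟩ := pow_unbounded_of_one_lt (1 / δ) (one_lt_two (α := ℝ))
  have hc' : 1 ≤ δ * 2 ^ c := by
    rw [div_lt_iff₀ hδ] at hc
    linarith
  refine ⟨Hybrid.estimator c, Polynomial.C (5600 * 2 ^ c) * (Polynomial.X + 1) ^ 3, ?_⟩
  rintro n p hp G S hS hcard γ β f hf ε hε hε1 branches rfl
  set K := ⌈1 / ε⌉₊
  have hK : 1 / ε ≤ K := Nat.le_ceil _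
  have hεK : 1 ≤ ε * K := by
    rw [div_le_iff₀ hε] at hK
    linarith
  have hK1 : 1 ≤ K := Nat.one_le_iff_ne_zero.mpr (Nat.ceil_pos.mpr (by positivity)).ne'
  refine ⟨Hybrid.successProb_estimator hc' hε hεK hS hcard ⟨γ, β, f⟩ fun x => abs_le.mpr (hf x),
    fun s hs => ?_⟩
  have ht := Hybrid.time_estimator c hK1 hp hS hcard ⟨γ, β, f⟩ s hs
  -- Since `ε ≤ 1`, rounding `1/ε` up at most doubles it. Squaring costs the factor `4` between
  -- `1400` and `5600`.
  have hK2 : (K : ℝ) ≤ 2 / ε := by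
    have h1 : (K : ℝ) < 1 / ε + 1 := Nat.ceil_lt_add_one (by positivity)
    have h2 : 1 ≤ 1 / ε := by rwa [le_div_iff₀ hε, one_mul]
    calc (K : ℝ) ≤ 1 / ε + 1 / ε := by linarith
      _ = 2 / ε := by ring
  calc (s.time : ℝ) ≤ ((4 ^ ((2 * p - 1) * (S.card + 2)) *
        (1400 * 2 ^ c * (p * n + 1) ^ 3) * K ^ 2 : ℕ) : ℝ) := by exact_mod_cast ht
    _ = 4 ^ ((2 * p - 1) * (S.card + 2)) * (1400 * 2 ^ c * (p * n + 1) ^ 3) * K ^ 2 := by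
        push_cast; ring
    _ ≤ 4 ^ ((2 * p - 1) * (S.card + 2)) * (1400 * 2 ^ c * (p * n + 1) ^ 3) * (2 / ε) ^ 2 := by
        gcongr
    _ = _ := by
        simp only [Polynomial.eval_mul, Polynomial.eval_C, Polynomial.eval_pow,
          Polynomial.eval_add, Polynomial.eval_X, Polynomial.eval_one]
        push_cast
        ring
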